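/- **Theorem.** A double complex is a bigraded complex vector space $\mathcal A=\bigoplus_{p,q\in\mathbb Z}\mathcal A^{p,q}$ with maps $\partial,\bar\partial$ of bidegrees $(1,0)$ and $(0,1)$ such that $\partial^2=\bar\partial^2=\partial\bar\partial+\bar\partial\partial=0$; it is bounded if $\mathcal A^{p,q}=0$ for $|p|+|q|$ large. A *square* is a double complex with one copy of $\mathbb C$ in each of the bidegrees $(p,q),(p+1,q),(p,q+1),(p+1,q+1)$ and all four arrows isomorphisms. A *zigzag* has one copy of $\mathbb C$ in each bidegree of a finite staircase lying in at most two consecutive total degrees, with the identity as every arrow between adjacent bidegrees of the staircase. For integers $k,p,q$ the *odd zigzag* $Z^{p,q}_k$ of total degree $k$ is the one supported on - $\{(a,b): a+b=k,\ a\ge p,\ b\ge q\}\cup\{(a,b): a+b=k+1,\ a>p,\ b>q\}$ if $p+q<k$ (looking down); - $\{(a,b): a+b=k,\ a\le p,\ b\le q\}\cup\{(a,b): a+b=k-1,\ a<p,\ b<q\}$ if $p+q>k$ (looking up); - $\{(p,q)\}$ if $p+q=k$ (a dot). The *even zigzags* are, for $l\ge 1$, those supported on $\{(p+i,q-i),(p+i+1,q-i):0\le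 i<l\}$ (horizontal) and on $\{(p-i,q+i),(p-i,q+i+1):0\le i<l\}$ (vertical). Let $\overline{\mathcal U}$ be the free abelian group on the isomorphism classes of bounded double complexes that are direct sums of squares and finitely many zigzags, modulo the relations $[\mathcal A\oplus\mathcal B]=[\mathcal A]+[\mathcal B]$ and modulo the subgroup generated by the squares. Let $\chi$ be the homomorphism on $\overline{\mathcal U}$ that sends $[\mathcal A]$ to the array of all the dimensions (over $\mathbb C$) of - the de Rham cohomologies $H^k(\mathrm{Tot}\,\mathcal A,\ \partial+\bar\partial)$, $k\in\mathbb Z$; - in each bidegree $(p,q)$, the Bott–Chern cohomology $\frac{\ker\partial\cap\ker\bar\partial}{\operatorname{im}\partial\bar\partial}$, the Aeppli cohomology $\frac{\ker\partial\bar\partial}{\operatorname{im}\partial+\operatorname{im}\bar\partial}$, the Dolbeault cohomology $\frac{\ker\bar\partial}{\operatorname{im}\bar\partial}$, and the six Varouchas cohomologies $$\frac{\operatorname{im}\partial\cap\operatorname{im}\bar\partial}{\operatorname{im}\partial\bar\partial},\quad \frac{\operatorname{im}\partial\cap\ker\bar\partial}{\operatorname{im}\partial\bar\partial},\quad \frac{\ker\partial\bar\partial}{\ker\bar\partial+\operatorname{im}\partial},\quad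 \frac{\ker\partial\cap\operatorname{im}\bar\partial}{\operatorname{im}\partial\bar\partial},\quad \frac{\ker\partial\bar\partial}{\ker\partial+\operatorname{im}\bar\partial},\quad \frac{\ker\partial\bar\partial}{\ker\bar\partial+\ker\partial};$$ - the terms $E_r^{p,q}$ and $\tilde E_r^{p,q}$, for all $r\ge1$ and $p,q\in\mathbb Z$, of the Frölicher spectral sequence and of its conjugate, i.e. of the spectral sequences of the filtrations $F_l\mathrm{Tot}^k=\bigoplus_{p+q=k,\,p\ge l}\mathcal A^{p,q}$ and $\tilde F_l\mathrm{Tot}^k=\bigoplus_{p+q=k,\,q\ge l}\mathcal A^{p,q}$. For $k\in\mathbb Z$ let $S_k^+=\{(p,q)\in\mathbb Z^2:p+q>k\}$ and $S_k^-=\{(p,q)\in\mathbb Z^2:p+q<k\}$. For a map $v:S_k^{\pm}\to\mathbb Z$ with finite support and such that $\sum_{p}v(p,q)=0$ for every $q$ and $\sum_{q}v(p,q)=0$ for every $p$ (sums over the points of $S_k^\pm$), let $$Z^{v\pm}_k=\sum_{(p,q)\in S_k^{\pm}}v(p,q)\,[Z^{p,q}_k]\in\overline{\mathcal U}.$$ Then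 $\ker\chi$ is the subgroup of $\overline{\mathcal U}$ generated by the elements $Z^{v+}_k$ and $Z^{v-}_k$, for all $k\in\mathbb Z$ and all such $v$. -/

import Mathlib

/-! ### Double complexes -/

/-- A double complex of complex vector spaces: a bigraded vector space `A = ⨁ A^{p,q}` with maps
`∂` of bidegree `(1,0)` and `∂̄` of bidegree `(0,1)` such that `∂² = 0`, `∂̄² = 0`, `∂∂̄ + ∂̄∂ = 0`. -/
structure DoubleComplex : Type 1 where
  carrier : Type
  [addCommGroup : AddCommGroup carrier]
  [module : Module ℂ carrier]
  /-- the component of bidegree `(p, q)` -/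
  comp : ℤ → ℤ → Submodule ℂ carrier
  isInternal : DirectSum.IsInternal fun pq : ℤ × ℤ => comp pq.1 pq.2
  del : carrier →ₗ[ℂ] carrier
  delbar : carrier →ₗ[ℂ] carrier
  del_mem : ∀ p q x, x ∈ comp p q → del x ∈ comp (p + 1) q
  delbar_mem : ∀ p q x, x ∈ comp p q → delbar x ∈ comp p (q + 1)
  del_del : ∀ x, del (del x) = 0
  delbar_delbar : ∀ x, delbar (delbar x) = 0
  anticomm : ∀ x, del (delbar x) + delbar (del x) = 0

namespace DoubleComplex

attribute [instance] DoubleComplex.addCommGroup DoubleComplex.module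

/-- `A^{p,q} = 0` for `|p| + |q|` large enough. -/
def IsBounded (A : DoubleComplex) : Prop :=
  ∃ N : ℤ, ∀ p q : ℤ, N < |p| + |q| → A.comp p q = ⊥

/-- Morphisms of double complexes. -/
structure Hom (A B : DoubleComplex) where
  toLin : A.carrier →ₗ[ℂ] B.carrier
  map_comp : ∀ p q x, x ∈ A.comp p q → toLin x ∈ B.comp p q
  map_del : ∀ x, toLin (A.del x) = B.del (toLin x)
  map_delbar : ∀ x, toLin (A.delbar x) = B.delbar (toLin x)

/-- Isomorphisms of double complexes. -/
structure Iso (A B : DoubleComplex) where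
  toEquiv : A.carrier ≃ₗ[ℂ] B.carrier
  mem_comp_iff : ∀ p q x, toEquiv x ∈ B.comp p q ↔ x ∈ A.comp p q
  map_del : ∀ x, toEquiv (A.del x) = B.del (toEquiv x)
  map_delbar : ∀ x, toEquiv (A.delbar x) = B.delbar (toEquiv x)

def Iso.refl (A : DoubleComplex) : Iso A A where
  toEquiv := LinearEquiv.refl ℂ A.carrier
  mem_comp_iff _ _ _ := Iff.rfl
  map_del _ := rfl
  map_delbar _ := rfl

def Iso.symm {A B : DoubleComplex} (e : Iso A B) : Iso B A where
  toEquiv := e.toEquiv.symm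
  mem_comp_iff p q x := by rw [← e.mem_comp_iff]; simp
  map_del x := by rw [LinearEquiv.symm_apply_eq, e.map_del]; simp
  map_delbar x := by rw [LinearEquiv.symm_apply_eq, e.map_delbar]; simp

def Iso.trans {A B C : DoubleComplex} (e : Iso A B) (f : Iso B C) : Iso A C where
  toEquiv := e.toEquiv.trans f.toEquiv
  mem_comp_iff p q x := by simp [f.mem_comp_iff, e.mem_comp_iff]
  map_del x := by simp [f.map_del, e.map_del]
  map_delbar x := by simp [f.map_delbar, e.map_delbar]

def Iso.toHom {A B : DoubleComplex} (e : Iso A B) : Hom A B where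
  toLin := e.toEquiv.toLinearMap
  map_comp p q x hx := (e.mem_comp_iff p q x).2 hx
  map_del := e.map_del
  map_delbar := e.map_delbar

/-! ### Direct sums -/

theorem iSupIndep_of_joint {ι τ X : Type} [AddCommGroup X] [Module ℂ X] (C : ι → Submodule ℂ X)
    {Y : τ → Type} [∀ t, AddCommGroup (Y t)] [∀ t, Module ℂ (Y t)]
    (f : ∀ t, X →ₗ[ℂ] Y t) (D : ∀ t, ι → Submodule ℂ (Y t))
    (hinj : ∀ x, (∀ t, f t x = 0) → x = 0)
    (hmem : ∀ t i x, x ∈ C i → f t x ∈ D t i) (hD : ∀ t, iSupIndep (D t)) : iSupIndep C := by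
  intro i
  rw [Submodule.disjoint_def]
  intro x hx hx'
  apply hinj
  intro t
  refine (Submodule.disjoint_def.1 (hD t i)) _ (hmem t i x hx) ?_
  have h : (⨆ j, ⨆ (_ : j ≠ i), C j) ≤ (⨆ j, ⨆ (_ : j ≠ i), D t j).comap (f t) := by
    refine iSup₂_le fun j hj y hy => ?_
    exact (le_iSup₂_of_le (f := fun j (_ : j ≠ i) => D t j) j hj le_rfl) (hmem t j y hy)
  exact h hx'

/-- The direct sum of two double complexes. -/
def sum (A B : DoubleComplex) : DoubleComplex where
  carrier := A.carrier × B.carrier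
  comp p q := (A.comp p q).prod (B.comp p q)
  isInternal := by
    apply DirectSum.isInternal_submodule_of_iSupIndep_of_iSup_eq_top
    · have h1 := A.isInternal.submodule_iSupIndep
      have h2 := B.isInternal.submodule_iSupIndep
      intro i
      rw [Submodule.disjoint_def]
      rintro ⟨a, b⟩ ⟨ha, hb⟩ hx
      have hle : (⨆ j, ⨆ (_ : j ≠ i), (A.comp j.1 j.2).prod (B.comp j.1 j.2)) ≤
          (⨆ j, ⨆ (_ : j ≠ i), A.comp j.1 j.2).prod (⨆ j, ⨆ (_ : j ≠ i), B.comp j.1 j.2) := by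
        refine iSup₂_le fun j hj => Submodule.prod_mono ?_ ?_
        · exact le_iSup₂_of_le (f := fun (j : ℤ × ℤ) (_ : j ≠ i) => A.comp j.1 j.2) j hj le_rfl
        · exact le_iSup₂_of_le (f := fun (j : ℤ × ℤ) (_ : j ≠ i) => B.comp j.1 j.2) j hj le_rfl
      obtain ⟨ha', hb'⟩ := hle hx
      rw [Submodule.disjoint_def.1 (h1 i) a ha ha', Submodule.disjoint_def.1 (h2 i) b hb hb']
      rfl
    · rw [eq_top_iff]
      rintro ⟨a, b⟩ -
      have ha : a ∈ ⨆ i : ℤ × ℤ, A.comp i.1 i.2 := by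
        rw [A.isInternal.submodule_iSup_eq_top]; trivial
      have hb : b ∈ ⨆ i : ℤ × ℤ, B.comp i.1 i.2 := by
        rw [B.isInternal.submodule_iSup_eq_top]; trivial
      have hA : (⨆ i : ℤ × ℤ, A.comp i.1 i.2) ≤
          (⨆ i : ℤ × ℤ, (A.comp i.1 i.2).prod (B.comp i.1 i.2)).comap
            (LinearMap.inl ℂ A.carrier B.carrier) :=
        iSup_le fun i y hy => Submodule.mem_iSup_of_mem
          (p := fun i : ℤ × ℤ => (A.comp i.1 i.2).prod (B.comp i.1 i.2)) i ⟨hy, zero_mem _⟩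
      have hB : (⨆ i : ℤ × ℤ, B.comp i.1 i.2) ≤
          (⨆ i : ℤ × ℤ, (A.comp i.1 i.2).prod (B.comp i.1 i.2)).comap
            (LinearMap.inr ℂ A.carrier B.carrier) :=
        iSup_le fun i y hy => Submodule.mem_iSup_of_mem
          (p := fun i : ℤ × ℤ => (A.comp i.1 i.2).prod (B.comp i.1 i.2)) i ⟨zero_mem _, hy⟩
      have h1 : ((a, 0) : A.carrier × B.carrier) ∈
          ⨆ i : ℤ × ℤ, (A.comp i.1 i.2).prod (B.comp i.1 i.2) := hA ha
      have h2 : ((0, b) : A.carrier × B.carrier) ∈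
          ⨆ i : ℤ × ℤ, (A.comp i.1 i.2).prod (B.comp i.1 i.2) := hB hb
      simpa using add_mem h1 h2
  del := A.del.prodMap B.del
  delbar := A.delbar.prodMap B.delbar
  del_mem p q x hx := ⟨A.del_mem p q _ hx.1, B.del_mem p q _ hx.2⟩
  delbar_mem p q x hx := ⟨A.delbar_mem p q _ hx.1, B.delbar_mem p q _ hx.2⟩
  del_del x := by simp [A.del_del, B.del_del]
  delbar_delbar x := by simp [A.delbar_delbar, B.delbar_delbar]
  anticomm x := by simp [A.anticomm, B.anticomm]

open Classical in
/-- The direct sum of an arbitrary family of double complexes. -/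
noncomputable def directSum {ι : Type} (F : ι → DoubleComplex) : DoubleComplex where
  carrier := Π₀ i, (F i).carrier
  comp p q :=
    { carrier := {x | ∀ i, x i ∈ (F i).comp p q}
      add_mem' := fun hx hy i => add_mem (hx i) (hy i)
      zero_mem' := fun i => zero_mem _
      smul_mem' := fun c x hx i => Submodule.smul_mem _ c (hx i) }
  isInternal := by
    apply DirectSum.isInternal_submodule_of_iSupIndep_of_iSup_eq_top
    · refine iSupIndep_of_joint _ (fun i => DFinsupp.lapply i)
        (fun i pq => (F i).comp pq.1 pq.2) ?_ ?_ ?_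
      · intro x hx
        ext i
        exact hx i
      · intro i pq x hx
        exact hx i
      · exact fun i => (F i).isInternal.submodule_iSupIndep
    · rw [eq_top_iff]
      rintro x -
      induction x using DFinsupp.induction with
      | h0 => exact zero_mem _
      | ha i b f _ _ ih =>
        refine add_mem ?_ ih
        have hb : b ∈ ⨆ pq : ℤ × ℤ, (F i).comp pq.1 pq.2 := by
          rw [(F i).isInternal.submodule_iSup_eq_top]; trivial
        rw [← DFinsupp.lsingle_apply (R := ℂ), ← Submodule.mem_comap]
        revert hb
        apply (iSup_le fun pq y hy => ?_ :
          (⨆ pq : ℤ × ℤ, (F i).comp pq.1 pq.2) ≤ _)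
        refine Submodule.mem_iSup_of_mem pq ?_
        intro j
        rw [DFinsupp.lsingle_apply]
        by_cases h : i = j
        · subst h; simpa using hy
        · rw [DFinsupp.single_eq_of_ne (Ne.symm h)]; exact zero_mem _
  del := DFinsupp.mapRange.linearMap fun i => (F i).del
  delbar := DFinsupp.mapRange.linearMap fun i => (F i).delbar
  del_mem p q x hx i := (F i).del_mem p q _ (hx i)
  delbar_mem p q x hx i := (F i).delbar_mem p q _ (hx i)
  del_del x := by ext i; exact (F i).del_del _
  delbar_delbar x := by ext i; exact (F i).delbar_delbar _
  anticomm x := by ext i; exact (F i).anticomm _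

/-! ### Squares and zigzags -/

open Classical in
/-- The double complex with one basis vector `e_{(a,b)}` for each `(a,b) ∈ S`, with
`∂ e_{(a,b)} = e_{(a+1,b)}` and `∂̄ e_{(a,b)} = c (a,b) e_{(a,b+1)}`, where `e_{(a,b)}` is read as `0`
for `(a,b) ∉ S`. -/
noncomputable def ofShape (S : Set (ℤ × ℤ)) (c : ℤ × ℤ → ℂ)
    (h1 : ∀ a b, (a, b) ∈ S → (a + 1, b) ∈ S → (a + 1 + 1, b) ∉ S)
    (h2 : ∀ a b, (a, b) ∈ S → (a, b + 1) ∈ S → (a, b + 1 + 1) ∉ S)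
    (h3 : ∀ a b, (a, b) ∈ S → (a + 1, b + 1) ∈ S →
      (a, b + 1) ∈ S ∧ (a + 1, b) ∈ S ∧ c (a, b) + c (a + 1, b) = 0) : DoubleComplex where
  carrier := S →₀ ℂ
  comp p q := Finsupp.supported ℂ ℂ {s : S | (s : ℤ × ℤ) = (p, q)}
  isInternal := by
    apply DirectSum.isInternal_submodule_of_iSupIndep_of_iSup_eq_top
    · refine iSupIndep_of_joint _ (fun s : S => Finsupp.lapply s)
        (fun s pq => if (s : ℤ × ℤ) = pq then ⊤ else ⊥) ?_ ?_ ?_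
      · intro x hx
        ext s
        exact hx s
      · intro s pq x hx
        by_cases h : (s : ℤ × ℤ) = pq
        · simp [h]
        · rw [if_neg h, Submodule.mem_bot]
          exact (Finsupp.mem_supported' ℂ x).1 hx s h
      · intro s pq
        by_cases h : (s : ℤ × ℤ) = pq
        · have : (⨆ j, ⨆ (_ : j ≠ pq), if (s : ℤ × ℤ) = j then (⊤ : Submodule ℂ ℂ) else ⊥) = ⊥ := by
            rw [iSup_eq_bot]; intro j
            rw [iSup_eq_bot]; intro hj
            rw [if_neg]; rintro rfl; exact hj h
          rw [this]; exact disjoint_bot_right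
        · simp only [if_neg h]; exact disjoint_bot_left
    · rw [eq_top_iff]
      rintro x -
      induction x using Finsupp.induction_linear with
      | zero => exact zero_mem _
      | add f g hf hg => exact add_mem hf hg
      | single s a =>
        refine Submodule.mem_iSup_of_mem (s : ℤ × ℤ) ?_
        exact Finsupp.single_mem_supported ℂ a rfl
  del := Finsupp.linearCombination ℂ fun s : S =>
    if h : ((s : ℤ × ℤ).1 + 1, (s : ℤ × ℤ).2) ∈ S then Finsupp.single ⟨_, h⟩ 1 else 0
  delbar := Finsupp.linearCombination ℂ fun s : S =>
    if h : ((s : ℤ × ℤ).1, (s : ℤ × ℤ).2 + 1) ∈ S then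
      Finsupp.single ⟨_, h⟩ (c (s : ℤ × ℤ)) else 0
  del_mem p q x hx := by
    rw [Finsupp.supported_eq_span_single] at hx
    induction hx using Submodule.span_induction with
    | mem x hx =>
      obtain ⟨s, hs, rfl⟩ := hx
      rw [Finsupp.linearCombination_single, one_smul]
      split_ifs with h
      · apply Finsupp.single_mem_supported
        rcases s with ⟨⟨a, b⟩, hab⟩
        simp only [Set.mem_ofPred_eq, Prod.mk.injEq] at hs ⊢
        omega
      · exact zero_mem _
    | zero => rw [map_zero]; exact zero_mem _
    | add x y _ _ hx hy => rw [map_add]; exact add_mem hx hy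
    | smul a x _ hx => rw [map_smul]; exact Submodule.smul_mem _ _ hx
  delbar_mem p q x hx := by
    rw [Finsupp.supported_eq_span_single] at hx
    induction hx using Submodule.span_induction with
    | mem x hx =>
      obtain ⟨s, hs, rfl⟩ := hx
      rw [Finsupp.linearCombination_single, one_smul]
      split_ifs with h
      · apply Finsupp.single_mem_supported
        rcases s with ⟨⟨a, b⟩, hab⟩
        simp only [Set.mem_ofPred_eq, Prod.mk.injEq] at hs ⊢
        omega
      · exact zero_mem _
    | zero => rw [map_zero]; exact zero_mem _
    | add x y _ _ hx hy => rw [map_add]; exact add_mem hx hy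
    | smul a x _ hx => rw [map_smul]; exact Submodule.smul_mem _ _ hx
  del_del x := by
    induction x using Finsupp.induction_linear with
    | zero => simp
    | add f g hf hg => rw [map_add, map_add, hf, hg, add_zero]
    | single s a =>
      rw [Finsupp.linearCombination_single]
      split_ifs with h
      · rw [map_smul, Finsupp.linearCombination_single, dif_neg (h1 _ _ s.2 h)]
        simp
      · simp
  delbar_delbar x := by
    induction x using Finsupp.induction_linear with
    | zero => simp
    | add f g hf hg => rw [map_add, map_add, hf, hg, add_zero]
    | single s a =>
      rw [Finsupp.linearCombination_single]
      split_ifs with h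
      · rw [map_smul, Finsupp.linearCombination_single, dif_neg (h2 _ _ s.2 h)]
        simp
      · simp
  anticomm x := by
    induction x using Finsupp.induction_linear with
    | zero => simp
    | add f g hf hg =>
      simp only [map_add]
      rw [add_add_add_comm, hf, hg, add_zero]
    | single s a =>
      rw [Finsupp.linearCombination_single, Finsupp.linearCombination_single]
      by_cases hs : ((s : ℤ × ℤ).1 + 1, (s : ℤ × ℤ).2 + 1) ∈ S
      · obtain ⟨hu, hr, hc⟩ := h3 _ _ s.2 hs
        rw [dif_pos hu, dif_pos hr, map_smul, map_smul, Finsupp.linearCombination_single,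
          Finsupp.linearCombination_single, dif_pos hs, dif_pos hs, ← smul_add]
        simp only [Finsupp.smul_single, smul_eq_mul, mul_one, one_mul]
        rw [← Finsupp.single_add]
        have : c (s : ℤ × ℤ) + c ((s : ℤ × ℤ).1 + 1, (s : ℤ × ℤ).2) = 0 := hc
        rw [this]; simp
      · have e1 : ∀ (h : ((s : ℤ × ℤ).1, (s : ℤ × ℤ).2 + 1) ∈ S),
            ¬ ((((⟨_, h⟩ : S) : ℤ × ℤ).1 + 1, ((⟨_, h⟩ : S) : ℤ × ℤ).2) ∈ S) := fun h => hs
        have e2 : ∀ (h : ((s : ℤ × ℤ).1 + 1, (s : ℤ × ℤ).2) ∈ S),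
            ¬ ((((⟨_, h⟩ : S) : ℤ × ℤ).1, ((⟨_, h⟩ : S) : ℤ × ℤ).2 + 1) ∈ S) := fun h => hs
        split_ifs with hu hr hr
        · rw [map_smul, map_smul, Finsupp.linearCombination_single,
            Finsupp.linearCombination_single, dif_neg (e1 hu), dif_neg (e2 hr)]
          simp
        · rw [map_smul, Finsupp.linearCombination_single, dif_neg (e1 hu)]
          simp
        · rw [smul_zero, map_zero, zero_add, map_smul, Finsupp.linearCombination_single,
            dif_neg (e2 hr)]
          simp
        · simp

/-- A set of bidegrees lying in two consecutive total degrees. -/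
def IsThin (S : Set (ℤ × ℤ)) : Prop :=
  ∃ m : ℤ, ∀ x ∈ S, x.1 + x.2 = m ∨ x.1 + x.2 = m + 1

/-- The double complex with one copy of `ℂ` in each bidegree of a thin set `S`, in which every
arrow between two horizontally or vertically adjacent bidegrees of `S` is the identity. -/
noncomputable def thin (S : Set (ℤ × ℤ)) (hS : IsThin S) : DoubleComplex :=
  ofShape S (fun _ => 1)
    (by
      obtain ⟨m, hm⟩ := hS
      intro a b h1 h2 h3
      have := hm _ h1; have := hm _ h3
      dsimp only at *; omega)
    (by
      obtain ⟨m, hm⟩ := hS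
      intro a b h1 h2 h3
      have := hm _ h1; have := hm _ h3
      dsimp only at *; omega)
    (by
      obtain ⟨m, hm⟩ := hS
      intro a b h1 h2
      have := hm _ h1; have := hm _ h2
      dsimp only at *; omega)

/-- The four bidegrees of the square with bottom left corner `(p, q)`. -/
def squareSupport (p q : ℤ) : Set (ℤ × ℤ) :=
  {x | (x.1 = p ∨ x.1 = p + 1) ∧ (x.2 = q ∨ x.2 = q + 1)}

/-- The square with bottom left corner `(p, q)`: all arrows are `1`, but for the right vertical
arrow, which is `-1`. -/
noncomputable def square (p q : ℤ) : DoubleComplex :=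
  ofShape (squareSupport p q) (fun x => if x.1 = p then 1 else -1)
    (by
      intro a b h1 h2 h3
      have h1 := h1.1; have h2 := h2.1; have h3 := h3.1
      dsimp only at *; omega)
    (by
      intro a b h1 h2 h3
      have h1 := h1.2; have h2 := h2.2; have h3 := h3.2
      dsimp only at *; omega)
    (by
      rintro a b ⟨h1, h2⟩ ⟨h3, h4⟩
      dsimp only at *
      have : a = p := by omega
      subst this
      refine ⟨⟨Or.inl rfl, h4⟩, ⟨h3, h2⟩, by simp⟩)

/-- The bidegrees of the odd zigzag `Z_k^{p,q}` of total degree `k`. If `p + q < k`, it is looking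
down (components in total degrees `k` and `k + 1`), its top left component has first degree `p` and
its bottom right component has second degree `q`. If `p + q > k`, it is looking up (components in
total degrees `k - 1` and `k`), its bottom right component has first degree `p` and its top left
component has second degree `q`. If `p + q = k`, it is the dot in bidegree `(p, q)`. -/
def oddSupport (k p q : ℤ) : Set (ℤ × ℤ) :=
  {x | (p + q < k ∧ ((x.1 + x.2 = k ∧ p ≤ x.1 ∧ q ≤ x.2) ∨
          (x.1 + x.2 = k + 1 ∧ p < x.1 ∧ q < x.2))) ∨
       (k ≤ p + q ∧ ((x.1 + x.2 = k ∧ x.1 ≤ p ∧ x.2 ≤ q) ∨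
          (x.1 + x.2 = k - 1 ∧ x.1 < p ∧ x.2 < q)))}

/-- The bidegrees of the horizontal even zigzag `Z_{1,l}^{p,q}` of length `2l`, whose leftmost
component has bidegree `(p, q)`. -/
def horizontalSupport (p q : ℤ) (l : ℕ) : Set (ℤ × ℤ) :=
  {x | ∃ i : ℤ, 0 ≤ i ∧ i < l ∧ (x = (p + i, q - i) ∨ x = (p + i + 1, q - i))}

/-- The bidegrees of the vertical even zigzag `Z_{2,l}^{p,q}` of length `2l`, whose bottom
component has bidegree `(p, q)`. -/
def verticalSupport (p q : ℤ) (l : ℕ) : Set (ℤ × ℤ) :=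
  {x | ∃ i : ℤ, 0 ≤ i ∧ i < l ∧ (x = (p - i, q + i) ∨ x = (p - i, q + i + 1))}

theorem isThin_oddSupport (k p q : ℤ) : IsThin (oddSupport k p q) := by
  by_cases h : p + q < k
  · refine ⟨k, fun x hx => ?_⟩
    rcases hx with hx | hx <;> omega
  · refine ⟨k - 1, fun x hx => ?_⟩
    rcases hx with hx | hx <;> omega

theorem isThin_horizontalSupport (p q : ℤ) (l : ℕ) : IsThin (horizontalSupport p q l) := by
  refine ⟨p + q, fun x hx => ?_⟩
  obtain ⟨i, -, -, rfl | rfl⟩ := hx <;> dsimp only <;> omega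

theorem isThin_verticalSupport (p q : ℤ) (l : ℕ) : IsThin (verticalSupport p q l) := by
  refine ⟨p + q, fun x hx => ?_⟩
  obtain ⟨i, -, -, rfl | rfl⟩ := hx <;> dsimp only <;> omega

/-- The odd zigzag `Z_k^{p,q}` of total degree `k`. -/
noncomputable def oddZigzag (k p q : ℤ) : DoubleComplex :=
  thin (oddSupport k p q) (isThin_oddSupport k p q)

/-- The horizontal even zigzag `Z_{1,l}^{p,q}` of length `2l`. -/
noncomputable def horizontalZigzag (p q : ℤ) (l : ℕ) : DoubleComplex :=
  thin (horizontalSupport p q l) (isThin_horizontalSupport p q l)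

/-- The vertical even zigzag `Z_{2,l}^{p,q}` of length `2l`. -/
noncomputable def verticalZigzag (p q : ℤ) (l : ℕ) : DoubleComplex :=
  thin (verticalSupport p q l) (isThin_verticalSupport p q l)

/-- The squares and the zigzags. -/
inductive Shape
  | square (p q : ℤ)
  | odd (k p q : ℤ)
  | horizontal (p q : ℤ) (l : ℕ) (hl : 1 ≤ l)
  | vertical (p q : ℤ) (l : ℕ) (hl : 1 ≤ l)

/-- The double complex of a given shape. -/
noncomputable def Shape.complex : Shape → DoubleComplex
  | .square p q => DoubleComplex.square p q
  | .odd k p q => oddZigzag k p q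
  | .horizontal p q l _ => horizontalZigzag p q l
  | .vertical p q l _ => verticalZigzag p q l

/-- A shape is a zigzag if it is not a square. -/
def Shape.IsZigzag : Shape → Prop
  | .square _ _ => False
  | _ => True

/-- `A` is a direct sum of squares and zigzags, of which only finitely many are zigzags. -/
def HasFinitelyManyZigzags (A : DoubleComplex) : Prop :=
  ∃ (ι : Type) (s : ι → Shape), Nonempty (Iso A (directSum fun i => (s i).complex)) ∧
    {i | (s i).IsZigzag}.Finite

theorem finite_oddSupport (k p q : ℤ) : (oddSupport k p q).Finite := by
  refine ((Set.finite_Icc (min p (k - q)) (max p (k + 1 - q))).prod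
    (Set.finite_Icc (min q (k - p)) (max q (k + 1 - p)))).subset fun x hx => ?_
  simp only [Set.mem_prod, Set.mem_Icc]
  rcases hx with hx | hx <;> omega

theorem finite_horizontalSupport (p q : ℤ) (l : ℕ) : (horizontalSupport p q l).Finite := by
  refine ((Set.finite_Icc p (p + l)).prod (Set.finite_Icc (q - l) q)).subset fun x hx => ?_
  simp only [Set.mem_prod, Set.mem_Icc]
  obtain ⟨i, h0, h1, rfl | rfl⟩ := hx <;> dsimp only <;> omega

theorem finite_verticalSupport (p q : ℤ) (l : ℕ) : (verticalSupport p q l).Finite := by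
  refine ((Set.finite_Icc (p - l) p).prod (Set.finite_Icc q (q + l))).subset fun x hx => ?_
  simp only [Set.mem_prod, Set.mem_Icc]
  obtain ⟨i, h0, h1, rfl | rfl⟩ := hx <;> dsimp only <;> omega

theorem isBounded_oddZigzag (k p q : ℤ) : (oddZigzag k p q).IsBounded := by
  refine ⟨2 * (|k| + |p| + |q| + 1), fun a b hab => ?_⟩
  rw [eq_bot_iff]
  intro x hx
  rw [Submodule.mem_bot]
  refine Finsupp.ext fun s => ?_
  refine (Finsupp.mem_supported' ℂ x).1 hx s ?_
  rcases s with ⟨⟨c, d⟩, hs⟩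
  intro h
  have h : (c, d) = (a, b) := h
  rw [Prod.mk.injEq] at h
  obtain ⟨rfl, rfl⟩ := h
  have hs : (p + q < k ∧ ((c + d = k ∧ p ≤ c ∧ q ≤ d) ∨ (c + d = k + 1 ∧ p < c ∧ q < d))) ∨
       (k ≤ p + q ∧ ((c + d = k ∧ c ≤ p ∧ d ≤ q) ∨ (c + d = k - 1 ∧ c < p ∧ d < q))) := hs
  simp only [abs_eq_max_neg] at hab
  omega

open Classical in
/-- A double complex is the direct sum of the one element family that it forms. -/
noncomputable def isoDirectSumUnit (A : DoubleComplex) : Iso A (directSum fun _ : Unit => A) where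
  toEquiv :=
    ({ DFinsupp.lsingle (R := ℂ) (M := fun _ : Unit => A.carrier) () with
      invFun := fun x => x ()
      left_inv := fun x => by simp
      right_inv := fun x => DFinsupp.ext fun i => by simp } :
      A.carrier ≃ₗ[ℂ] Π₀ _ : Unit, A.carrier)
  mem_comp_iff p q x := by
    constructor
    · intro h
      have h := h ()
      change (DFinsupp.single () x : Π₀ _ : Unit, A.carrier) () ∈ A.comp p q at h
      simpa using h
    · intro h i
      change (DFinsupp.single () x : Π₀ _ : Unit, A.carrier) i ∈ A.comp p q
      simpa using h
  map_del x := DFinsupp.ext fun i => by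
    change (DFinsupp.single () (A.del x) : Π₀ _ : Unit, A.carrier) i =
      A.del ((DFinsupp.single () x : Π₀ _ : Unit, A.carrier) i)
    simp
  map_delbar x := DFinsupp.ext fun i => by
    change (DFinsupp.single () (A.delbar x) : Π₀ _ : Unit, A.carrier) i =
      A.delbar ((DFinsupp.single () x : Π₀ _ : Unit, A.carrier) i)
    simp

theorem hasFinitelyManyZigzags_oddZigzag (k p q : ℤ) :
    (oddZigzag k p q).HasFinitelyManyZigzags :=
  ⟨Unit, fun _ => .odd k p q, ⟨isoDirectSumUnit _⟩, Set.toFinite _⟩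

/-! ### Cohomological invariants -/

/-- The total differential. -/
def d (A : DoubleComplex) : A.carrier →ₗ[ℂ] A.carrier := A.del + A.delbar

/-- The component of total degree `k`. -/
def tot (A : DoubleComplex) (k : ℤ) : Submodule ℂ A.carrier :=
  ⨆ (p : ℤ) (q : ℤ) (_ : p + q = k), A.comp p q

/-- The column filtration `F_l Tot^k` of the total complex. -/
def filtration (A : DoubleComplex) (l k : ℤ) : Submodule ℂ A.carrier :=
  ⨆ (p : ℤ) (q : ℤ) (_ : p + q = k ∧ l ≤ p), A.comp p q

/-- The row filtration of the total complex. -/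
def conjFiltration (A : DoubleComplex) (l k : ℤ) : Submodule ℂ A.carrier :=
  ⨆ (p : ℤ) (q : ℤ) (_ : p + q = k ∧ l ≤ q), A.comp p q

/-- For a filtration `F` of the total complex, the space
`Z_r^l = {x ∈ F_l Tot^k : d x ∈ F_{l+r} Tot^{k+1}}`. -/
def pageCycles (A : DoubleComplex) (F : ℤ → ℤ → Submodule ℂ A.carrier) (r l k : ℤ) :
    Submodule ℂ A.carrier :=
  F l k ⊓ (F (l + r) (k + 1)).comap A.d

/-- For a filtration `F` of the total complex, the space `Z_{r-1}^{l+1} + d Z_{r-1}^{l-r+1}`, so that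
page `r` of the spectral sequence, in filtration degree `l` and total degree `k`, is the quotient
`pageCycles / pageBoundaries`. -/
def pageBoundaries (A : DoubleComplex) (F : ℤ → ℤ → Submodule ℂ A.carrier) (r l k : ℤ) :
    Submodule ℂ A.carrier :=
  A.pageCycles F (r - 1) (l + 1) k ⊔ (A.pageCycles F (r - 1) (l - r + 1) (k - 1)).map A.d

/-- The indices of the cohomological invariants: de Rham, Bott-Chern, Aeppli, Dolbeault, the six
Varouchas cohomologies, the pages `r ≥ 1` of the Frölicher spectral sequence and of its
conjugate. -/
inductive Inv
  | deRham (k : ℤ)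
  | bottChern (p q : ℤ)
  | aeppli (p q : ℤ)
  | dolbeault (p q : ℤ)
  | varouchasA (p q : ℤ)
  | varouchasB (p q : ℤ)
  | varouchasC (p q : ℤ)
  | varouchasD (p q : ℤ)
  | varouchasE (p q : ℤ)
  | varouchasF (p q : ℤ)
  | frolicher (r : ℕ) (hr : 1 ≤ r) (p q : ℤ)
  | conjFrolicher (r : ℕ) (hr : 1 ≤ r) (p q : ℤ)

open LinearMap in
/-- The numerators of the cohomologies. -/
def num (A : DoubleComplex) : Inv → Submodule ℂ A.carrier
  | .deRham k => A.tot k ⊓ ker A.d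
  | .bottChern p q => A.comp p q ⊓ (ker A.del ⊓ ker A.delbar)
  | .aeppli p q => A.comp p q ⊓ ker (A.del ∘ₗ A.delbar)
  | .dolbeault p q => A.comp p q ⊓ ker A.delbar
  | .varouchasA p q => A.comp p q ⊓ (range A.del ⊓ range A.delbar)
  | .varouchasB p q => A.comp p q ⊓ (range A.del ⊓ ker A.delbar)
  | .varouchasC p q => A.comp p q ⊓ ker (A.del ∘ₗ A.delbar)
  | .varouchasD p q => A.comp p q ⊓ (ker A.del ⊓ range A.delbar)
  | .varouchasE p q => A.comp p q ⊓ ker (A.del ∘ₗ A.delbar)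
  | .varouchasF p q => A.comp p q ⊓ ker (A.del ∘ₗ A.delbar)
  | .frolicher r _ p q => A.pageCycles A.filtration r p (p + q)
  | .conjFrolicher r _ p q => A.pageCycles A.conjFiltration r q (p + q)

open LinearMap in
/-- The denominators of the cohomologies (to be intersected with the numerators). -/
def den (A : DoubleComplex) : Inv → Submodule ℂ A.carrier
  | .deRham k => (A.tot (k - 1)).map A.d
  | .bottChern _ _ => range (A.del ∘ₗ A.delbar)
  | .aeppli _ _ => range A.del ⊔ range A.delbar
  | .dolbeault _ _ => range A.delbar
  | .varouchasA _ _ => range (A.del ∘ₗ A.delbar)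
  | .varouchasB _ _ => range (A.del ∘ₗ A.delbar)
  | .varouchasC _ _ => ker A.delbar ⊔ range A.del
  | .varouchasD _ _ => range (A.del ∘ₗ A.delbar)
  | .varouchasE _ _ => ker A.del ⊔ range A.delbar
  | .varouchasF _ _ => ker A.delbar ⊔ ker A.del
  | .frolicher r _ p q => A.pageBoundaries A.filtration r p (p + q)
  | .conjFrolicher r _ p q => A.pageBoundaries A.conjFiltration r q (p + q)

/-- The cohomology spaces, including the spaces on the pages of the spectral sequences. -/
abbrev cohomology (A : DoubleComplex) (i : Inv) : Type :=
  A.num i ⧸ (A.den i).submoduleOf (A.num i)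

/-- The numerical invariants: the dimensions of the cohomology spaces. -/
noncomputable def invariant (A : DoubleComplex) (i : Inv) : ℕ :=
  Module.finrank ℂ (A.cohomology i)

/-! #### Functoriality of the cohomologies -/

section functoriality

variable {A B : DoubleComplex}

theorem Hom.map_d (f : Hom A B) (x : A.carrier) : f.toLin (A.d x) = B.d (f.toLin x) := by
  simp [d, f.map_del, f.map_delbar]

theorem Hom.tot_le (f : Hom A B) (k : ℤ) : A.tot k ≤ (B.tot k).comap f.toLin :=
  iSup_le fun p => iSup_le fun q => iSup_le fun h x hx =>
    Submodule.mem_iSup_of_mem p (Submodule.mem_iSup_of_mem q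
      (Submodule.mem_iSup_of_mem h (f.map_comp p q x hx)))

theorem Hom.filtration_le (f : Hom A B) (l k : ℤ) :
    A.filtration l k ≤ (B.filtration l k).comap f.toLin :=
  iSup_le fun p => iSup_le fun q => iSup_le fun h x hx =>
    Submodule.mem_iSup_of_mem p (Submodule.mem_iSup_of_mem q
      (Submodule.mem_iSup_of_mem h (f.map_comp p q x hx)))

theorem Hom.conjFiltration_le (f : Hom A B) (l k : ℤ) :
    A.conjFiltration l k ≤ (B.conjFiltration l k).comap f.toLin :=
  iSup_le fun p => iSup_le fun q => iSup_le fun h x hx =>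
    Submodule.mem_iSup_of_mem p (Submodule.mem_iSup_of_mem q
      (Submodule.mem_iSup_of_mem h (f.map_comp p q x hx)))

theorem Hom.pageCycles_mem (f : Hom A B) {F : ℤ → ℤ → Submodule ℂ A.carrier}
    {G : ℤ → ℤ → Submodule ℂ B.carrier} (h : ∀ l k, F l k ≤ (G l k).comap f.toLin) (r l k : ℤ)
    {x : A.carrier} (hx : x ∈ A.pageCycles F r l k) : f.toLin x ∈ B.pageCycles G r l k := by
  refine ⟨h _ _ hx.1, ?_⟩
  change B.d (f.toLin x) ∈ G (l + r) (k + 1)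
  rw [← f.map_d]
  exact h _ _ hx.2

theorem Hom.pageBoundaries_mem (f : Hom A B) {F : ℤ → ℤ → Submodule ℂ A.carrier}
    {G : ℤ → ℤ → Submodule ℂ B.carrier} (h : ∀ l k, F l k ≤ (G l k).comap f.toLin) (r l k : ℤ)
    {x : A.carrier} (hx : x ∈ A.pageBoundaries F r l k) :
    f.toLin x ∈ B.pageBoundaries G r l k := by
  obtain ⟨y, hy, _, ⟨z, hz, rfl⟩, rfl⟩ := Submodule.mem_sup.1 hx
  rw [map_add, f.map_d]
  exact Submodule.add_mem_sup (f.pageCycles_mem h _ _ _ hy)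
    ⟨_, f.pageCycles_mem h _ _ _ hz, rfl⟩

theorem Hom.ker_del (f : Hom A B) {x : A.carrier} (hx : x ∈ LinearMap.ker A.del) :
    f.toLin x ∈ LinearMap.ker B.del := by
  rw [LinearMap.mem_ker] at *; rw [← f.map_del, hx, map_zero]

theorem Hom.ker_delbar (f : Hom A B) {x : A.carrier} (hx : x ∈ LinearMap.ker A.delbar) :
    f.toLin x ∈ LinearMap.ker B.delbar := by
  rw [LinearMap.mem_ker] at *; rw [← f.map_delbar, hx, map_zero]

theorem Hom.ker_comp (f : Hom A B) {x : A.carrier}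
    (hx : x ∈ LinearMap.ker (A.del ∘ₗ A.delbar)) :
    f.toLin x ∈ LinearMap.ker (B.del ∘ₗ B.delbar) := by
  rw [LinearMap.mem_ker, LinearMap.comp_apply] at *
  rw [← f.map_delbar, ← f.map_del, hx, map_zero]

theorem Hom.range_del (f : Hom A B) {x : A.carrier} (hx : x ∈ LinearMap.range A.del) :
    f.toLin x ∈ LinearMap.range B.del := by
  obtain ⟨y, rfl⟩ := hx; exact ⟨_, (f.map_del y).symm⟩

theorem Hom.range_delbar (f : Hom A B) {x : A.carrier} (hx : x ∈ LinearMap.range A.delbar) :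
    f.toLin x ∈ LinearMap.range B.delbar := by
  obtain ⟨y, rfl⟩ := hx; exact ⟨_, (f.map_delbar y).symm⟩

theorem Hom.range_comp (f : Hom A B) {x : A.carrier}
    (hx : x ∈ LinearMap.range (A.del ∘ₗ A.delbar)) :
    f.toLin x ∈ LinearMap.range (B.del ∘ₗ B.delbar) := by
  obtain ⟨y, rfl⟩ := hx
  exact ⟨f.toLin y, by simp [f.map_del, f.map_delbar]⟩

theorem Hom.map_num (f : Hom A B) (i : Inv) {x : A.carrier} (hx : x ∈ A.num i) :
    f.toLin x ∈ B.num i := by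
  cases i with
  | deRham k =>
    refine ⟨f.tot_le k hx.1, ?_⟩
    have h : A.d x = 0 := hx.2
    change B.d (f.toLin x) = 0
    rw [← f.map_d, h, map_zero]
  | bottChern p q => exact ⟨f.map_comp _ _ _ hx.1, f.ker_del hx.2.1, f.ker_delbar hx.2.2⟩
  | aeppli p q => exact ⟨f.map_comp _ _ _ hx.1, f.ker_comp hx.2⟩
  | dolbeault p q => exact ⟨f.map_comp _ _ _ hx.1, f.ker_delbar hx.2⟩
  | varouchasA p q => exact ⟨f.map_comp _ _ _ hx.1, f.range_del hx.2.1, f.range_delbar hx.2.2⟩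
  | varouchasB p q => exact ⟨f.map_comp _ _ _ hx.1, f.range_del hx.2.1, f.ker_delbar hx.2.2⟩
  | varouchasC p q => exact ⟨f.map_comp _ _ _ hx.1, f.ker_comp hx.2⟩
  | varouchasD p q => exact ⟨f.map_comp _ _ _ hx.1, f.ker_del hx.2.1, f.range_delbar hx.2.2⟩
  | varouchasE p q => exact ⟨f.map_comp _ _ _ hx.1, f.ker_comp hx.2⟩
  | varouchasF p q => exact ⟨f.map_comp _ _ _ hx.1, f.ker_comp hx.2⟩
  | frolicher r hr p q => exact f.pageCycles_mem f.filtration_le _ _ _ hx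
  | conjFrolicher r hr p q => exact f.pageCycles_mem f.conjFiltration_le _ _ _ hx

theorem mem_sup_map {X Y : Type} [AddCommGroup X] [Module ℂ X] [AddCommGroup Y] [Module ℂ Y]
    (f : X →ₗ[ℂ] Y) {M N : Submodule ℂ X} {M' N' : Submodule ℂ Y} (hM : ∀ {x}, x ∈ M → f x ∈ M')
    (hN : ∀ {x}, x ∈ N → f x ∈ N') {x : X} (hx : x ∈ M ⊔ N) : f x ∈ M' ⊔ N' := by
  obtain ⟨y, hy, z, hz, rfl⟩ := Submodule.mem_sup.1 hx
  rw [map_add]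
  exact Submodule.add_mem_sup (hM hy) (hN hz)

theorem Hom.map_den (f : Hom A B) (i : Inv) {x : A.carrier} (hx : x ∈ A.den i) :
    f.toLin x ∈ B.den i := by
  cases i with
  | deRham k =>
    obtain ⟨y, hy, rfl⟩ := hx
    exact ⟨_, f.tot_le _ hy, (f.map_d y).symm⟩
  | bottChern p q => exact f.range_comp hx
  | aeppli p q => exact mem_sup_map f.toLin f.range_del f.range_delbar hx
  | dolbeault p q => exact f.range_delbar hx
  | varouchasA p q => exact f.range_comp hx
  | varouchasB p q => exact f.range_comp hx
  | varouchasC p q => exact mem_sup_map f.toLin f.ker_delbar f.range_del hx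
  | varouchasD p q => exact f.range_comp hx
  | varouchasE p q => exact mem_sup_map f.toLin f.ker_del f.range_delbar hx
  | varouchasF p q => exact mem_sup_map f.toLin f.ker_delbar f.ker_del hx
  | frolicher r hr p q => exact f.pageBoundaries_mem f.filtration_le _ _ _ hx
  | conjFrolicher r hr p q => exact f.pageBoundaries_mem f.conjFiltration_le _ _ _ hx

theorem Iso.invariant_eq (e : Iso A B) (i : Inv) : A.invariant i = B.invariant i := by
  have hn : (A.num i).map e.toEquiv.toLinearMap = B.num i := by
    apply le_antisymm
    · rintro _ ⟨x, hx, rfl⟩; exact e.toHom.map_num i hx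
    · intro y hy; exact ⟨_, e.symm.toHom.map_num i hy, e.toEquiv.apply_symm_apply y⟩
  have hmem : ∀ x, e.toEquiv x ∈ B.den i ↔ x ∈ A.den i := by
    intro x
    refine ⟨fun h => ?_, fun h => e.toHom.map_den i h⟩
    have := e.symm.toHom.map_den i h
    change e.toEquiv.symm (e.toEquiv x) ∈ _ at this
    rwa [LinearEquiv.symm_apply_apply] at this
  refine LinearEquiv.finrank_eq (Submodule.Quotient.equiv _ _
    (e.toEquiv.ofSubmodules _ _ hn) ?_)
  ext y
  constructor
  · rintro ⟨x, hx, rfl⟩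
    exact (hmem x.1).2 hx
  · intro hy
    have hy : (y : B.carrier) ∈ B.den i := hy
    refine ⟨(e.toEquiv.ofSubmodules _ _ hn).symm y, ?_, by simp⟩
    change (((e.toEquiv.ofSubmodules _ _ hn).symm y : A.num i) : A.carrier) ∈ A.den i
    rw [← hmem]
    simpa using hy

/-- The induced map in cohomology. -/
noncomputable def Hom.mapCohomology (f : Hom A B) (i : Inv) :
    A.cohomology i →ₗ[ℂ] B.cohomology i :=
  Submodule.mapQ _ _ (f.toLin.restrict fun _ hx => f.map_num i hx)
    fun _ hx => f.map_den i hx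

end functoriality

/-! #### The cohomologies of squares vanish -/

/-- `A` has a contraction of `∂̄` that anticommutes with `∂`, and vice versa. -/
def IsContractible (A : DoubleComplex) : Prop :=
  ∃ h h' : A.carrier →ₗ[ℂ] A.carrier,
    (∀ p q x, x ∈ A.comp p q → h x ∈ A.comp p (q - 1)) ∧
    (∀ p q x, x ∈ A.comp p q → h' x ∈ A.comp (p - 1) q) ∧
    (∀ x, A.delbar (h x) + h (A.delbar x) = x) ∧ (∀ x, A.del (h x) + h (A.del x) = 0) ∧
    (∀ x, A.del (h' x) + h' (A.del x) = x) ∧ (∀ x, A.delbar (h' x) + h' (A.delbar x) = 0)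

theorem d_d (A : DoubleComplex) (x : A.carrier) : A.d (A.d x) = 0 := by
  simp only [d, LinearMap.add_apply, map_add, A.del_del, A.delbar_delbar, zero_add, add_zero]
  rw [add_comm]; exact A.anticomm x

theorem page_le {A : DoubleComplex} (F : ℤ → ℤ → Submodule ℂ A.carrier)
    (hF : ∀ l l' k, l ≤ l' → F l' k ≤ F l k) (g : A.carrier →ₗ[ℂ] A.carrier)
    (hg : ∀ l k x, x ∈ F l k → g x ∈ F l (k - 1)) (hd : ∀ x, A.d (g x) + g (A.d x) = x)
    (r l k : ℤ) (hr : 1 ≤ r) : A.pageCycles F r l k ≤ A.pageBoundaries F r l k := by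
  rintro x ⟨hx, hx'⟩
  change A.d x ∈ F (l + r) (k + 1) at hx'
  have h1 : g (A.d x) ∈ F (l + r) k := by simpa using hg _ _ _ hx'
  have h2 : A.d (g (A.d x)) = A.d x := by
    have := hd (A.d x)
    rwa [A.d_d, map_zero, add_zero] at this
  have h3 : A.d (g x) = x - g (A.d x) := eq_sub_of_add_eq (hd x)
  refine Submodule.mem_sup.2 ⟨g (A.d x), ⟨hF _ _ _ (by omega) h1, ?_⟩, A.d (g x),
    ⟨g x, ⟨hF _ _ _ (by omega) (hg _ _ _ hx), ?_⟩, rfl⟩, ?_⟩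
  · change A.d (g (A.d x)) ∈ F (l + 1 + (r - 1)) (k + 1)
    rw [h2]; convert hx' using 2; omega
  · change A.d (g x) ∈ F (l - r + 1 + (r - 1)) (k - 1 + 1)
    have e1 : l - r + 1 + (r - 1) = l := by omega
    have e2 : k - 1 + 1 = k := by omega
    rw [h3, e1, e2]
    exact sub_mem hx (hF _ _ _ (by omega) h1)
  · rw [h3]; abel

open LinearMap in
theorem IsContractible.num_le_den {A : DoubleComplex} (hA : A.IsContractible) (i : Inv) :
    A.num i ≤ A.den i := by
  obtain ⟨h, h', hc, hc', hb, hdel, ha, hbar⟩ := hA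
  have kb : ker A.delbar ≤ range A.delbar := by
    intro x hx
    rw [mem_ker] at hx
    have := hb x
    rw [hx, map_zero, add_zero] at this
    exact ⟨_, this⟩
  have kk : ker A.del ⊓ ker A.delbar ≤ range (A.del ∘ₗ A.delbar) := by
    rintro x ⟨hx, hx'⟩
    rw [SetLike.mem_coe, mem_ker] at hx hx'
    have e1 := hb x
    rw [hx', map_zero, add_zero] at e1
    have e2 := hdel x
    rw [hx, map_zero, add_zero] at e2
    have e3 := ha (h x)
    rw [e2, map_zero, add_zero] at e3
    refine ⟨- h' (h x), ?_⟩
    have e4 := A.anticomm (h' (h x))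
    rw [e3, e1] at e4
    rw [map_neg, comp_apply]
    exact neg_eq_of_add_eq_zero_right e4
  have rd : range A.del ≤ ker A.del := by
    rintro _ ⟨y, rfl⟩; exact A.del_del y
  have rb : range A.delbar ≤ ker A.delbar := by
    rintro _ ⟨y, rfl⟩; exact A.delbar_delbar y
  have ks : ker (A.del ∘ₗ A.delbar) ≤ range A.del ⊔ range A.delbar := by
    intro x hx
    rw [mem_ker, comp_apply] at hx
    obtain ⟨y, hy⟩ := kk (x := A.delbar x) ⟨hx, A.delbar_delbar x⟩
    rw [comp_apply] at hy
    have hz : x + A.del y ∈ ker A.delbar := by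
      rw [mem_ker, map_add, ← hy]; exact A.anticomm y
    have := Submodule.add_mem_sup (S := range A.del) (T := range A.delbar)
      (neg_mem (⟨y, rfl⟩ : A.del y ∈ range A.del)) (kb hz)
    have e : - A.del y + (x + A.del y) = x := by abel
    rwa [e] at this
  have hd : ∀ x, A.d (h x) + h (A.d x) = x := by
    intro x
    simp only [d, LinearMap.add_apply, map_add]
    rw [add_add_add_comm, hdel, hb, zero_add]
  have hd' : ∀ x, A.d (h' x) + h' (A.d x) = x := by
    intro x
    simp only [d, LinearMap.add_apply, map_add]
    rw [add_add_add_comm, ha, hbar, add_zero]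
  have ht : ∀ k x, x ∈ A.tot k → h x ∈ A.tot (k - 1) := by
    intro k
    refine (iSup_le fun p => iSup_le fun q => iSup_le fun e x hx => ?_ :
      A.tot k ≤ (A.tot (k - 1)).comap h)
    exact Submodule.mem_iSup_of_mem p (Submodule.mem_iSup_of_mem (q - 1)
      (Submodule.mem_iSup_of_mem (by omega) (hc p q x hx)))
  have hf : ∀ l k x, x ∈ A.filtration l k → h x ∈ A.filtration l (k - 1) := by
    intro l k
    refine (iSup_le fun p => iSup_le fun q => iSup_le fun e x hx => ?_ :
      A.filtration l k ≤ (A.filtration l (k - 1)).comap h)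
    exact Submodule.mem_iSup_of_mem p (Submodule.mem_iSup_of_mem (q - 1)
      (Submodule.mem_iSup_of_mem (by omega) (hc p q x hx)))
  have hf' : ∀ l k x, x ∈ A.conjFiltration l k → h' x ∈ A.conjFiltration l (k - 1) := by
    intro l k
    refine (iSup_le fun p => iSup_le fun q => iSup_le fun e x hx => ?_ :
      A.conjFiltration l k ≤ (A.conjFiltration l (k - 1)).comap h')
    exact Submodule.mem_iSup_of_mem (p - 1) (Submodule.mem_iSup_of_mem q
      (Submodule.mem_iSup_of_mem (by omega) (hc' p q x hx)))
  have hm : ∀ l l' k, l ≤ l' → A.filtration l' k ≤ A.filtration l k := by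
    intro l l' k hl
    exact iSup_le fun p => iSup_le fun q => iSup_le fun e x hx =>
      Submodule.mem_iSup_of_mem p (Submodule.mem_iSup_of_mem q
        (Submodule.mem_iSup_of_mem (by omega) hx))
  have hm' : ∀ l l' k, l ≤ l' → A.conjFiltration l' k ≤ A.conjFiltration l k := by
    intro l l' k hl
    exact iSup_le fun p => iSup_le fun q => iSup_le fun e x hx =>
      Submodule.mem_iSup_of_mem p (Submodule.mem_iSup_of_mem q
        (Submodule.mem_iSup_of_mem (by omega) hx))
  cases i with
  | deRham k =>
    rintro x ⟨hx, hx'⟩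
    rw [SetLike.mem_coe, mem_ker] at hx'
    have := hd x
    rw [hx', map_zero, add_zero] at this
    exact ⟨h x, ht _ _ hx, this⟩
  | bottChern p q => exact inf_le_right.trans kk
  | aeppli p q => exact inf_le_right.trans ks
  | dolbeault p q => exact inf_le_right.trans kb
  | varouchasA p q => exact inf_le_right.trans ((inf_le_inf rd rb).trans kk)
  | varouchasB p q => exact inf_le_right.trans ((inf_le_inf rd le_rfl).trans kk)
  | varouchasC p q =>
    exact inf_le_right.trans (ks.trans (sup_le le_sup_right (rb.trans le_sup_left)))
  | varouchasD p q => exact inf_le_right.trans ((inf_le_inf le_rfl rb).trans kk)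
  | varouchasE p q => exact inf_le_right.trans (ks.trans (sup_le_sup rd le_rfl))
  | varouchasF p q =>
    exact inf_le_right.trans (ks.trans (sup_le (rd.trans le_sup_right) (rb.trans le_sup_left)))
  | frolicher r hr p q => exact page_le _ hm h hf hd _ _ _ (by exact_mod_cast hr)
  | conjFrolicher r hr p q => exact page_le _ hm' h' hf' hd' _ _ _ (by exact_mod_cast hr)

open Classical in
theorem isContractible_square (p q : ℤ) : (square p q).IsContractible := by
  let S := squareSupport p q
  let c : ℤ × ℤ → ℂ := fun x => if x.1 = p then 1 else -1
  have hS : ∀ a b, ((a, b) : ℤ × ℤ) ∈ S ↔ (a = p ∨ a = p + 1) ∧ (b = q ∨ b = q + 1) :=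
    fun a b => Iff.rfl
  let D : (S →₀ ℂ) →ₗ[ℂ] (S →₀ ℂ) := (square p q).del
  let Db : (S →₀ ℂ) →ₗ[ℂ] (S →₀ ℂ) := (square p q).delbar
  let H : (S →₀ ℂ) →ₗ[ℂ] (S →₀ ℂ) := Finsupp.linearCombination ℂ fun s : S =>
    if h : ((s : ℤ × ℤ).1, (s : ℤ × ℤ).2 - 1) ∈ S then
      Finsupp.single ⟨_, h⟩ (c (s : ℤ × ℤ)) else 0
  let H' : (S →₀ ℂ) →ₗ[ℂ] (S →₀ ℂ) := Finsupp.linearCombination ℂ fun s : S =>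
    if h : ((s : ℤ × ℤ).1 - 1, (s : ℤ × ℤ).2) ∈ S then Finsupp.single ⟨_, h⟩ 1 else 0
  let e : ℤ → ℤ → (S →₀ ℂ) := fun a b => if h : (a, b) ∈ S then Finsupp.single ⟨_, h⟩ 1 else 0
  have eD : ∀ a b, (a, b) ∈ S → D (e a b) = e (a + 1) b := by
    intro a b h
    simp only [e, dif_pos h]
    exact (Finsupp.linearCombination_single ℂ _ _).trans (one_smul _ _)
  have eDb : ∀ a b, (a, b) ∈ S → Db (e a b) = c (a, b) • e a (b + 1) := by
    intro a b h
    simp only [e, dif_pos h]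
    refine ((Finsupp.linearCombination_single ℂ _ _).trans (one_smul _ _)).trans ?_
    split_ifs
    · simp; rfl
    · simp
  have eH : ∀ a b, (a, b) ∈ S → H (e a b) = c (a, b) • e a (b - 1) := by
    intro a b h
    simp only [e, dif_pos h]
    refine ((Finsupp.linearCombination_single ℂ _ _).trans (one_smul _ _)).trans ?_
    split_ifs <;> simp
  have eH' : ∀ a b, (a, b) ∈ S → H' (e a b) = e (a - 1) b := by
    intro a b h
    simp only [e, dif_pos h]
    exact (Finsupp.linearCombination_single ℂ _ _).trans (one_smul _ _)
  have e0 : ∀ a b, (a, b) ∉ S → e a b = 0 := fun a b h => dif_neg h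
  have m00 : (p, q) ∈ S := (hS _ _).2 (by omega)
  have m10 : (p + 1, q) ∈ S := (hS _ _).2 (by omega)
  have m01 : (p, q + 1) ∈ S := (hS _ _).2 (by omega)
  have m11 : (p + 1, q + 1) ∈ S := (hS _ _).2 (by omega)
  have z1 : ∀ b, e (p + 1 + 1) b = 0 := fun b => e0 _ _ (by rw [hS]; omega)
  have z2 : ∀ b, e (p - 1) b = 0 := fun b => e0 _ _ (by rw [hS]; omega)
  have z3 : ∀ a, e a (q + 1 + 1) = 0 := fun b => e0 _ _ (by rw [hS]; omega)
  have z4 : ∀ a, e a (q - 1) = 0 := fun b => e0 _ _ (by rw [hS]; omega)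
  have c0 : ∀ b, c (p, b) = 1 := fun b => by simp [c]
  have c1 : ∀ b, c (p + 1, b) = -1 := fun b => by simp [c]
  have key : ∀ P Q : (S →₀ ℂ) →ₗ[ℂ] (S →₀ ℂ), P (e p q) = Q (e p q) →
      P (e (p + 1) q) = Q (e (p + 1) q) → P (e p (q + 1)) = Q (e p (q + 1)) →
      P (e (p + 1) (q + 1)) = Q (e (p + 1) (q + 1)) → ∀ x, P x = Q x := by
    intro P Q h00 h10 h01 h11 x
    induction x using Finsupp.induction_linear with
    | zero => simp
    | add f g hf hg => rw [map_add, map_add, hf, hg]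
    | single s a =>
      have hs : P (Finsupp.single s 1) = Q (Finsupp.single s 1) := by
        rcases s with ⟨⟨a, b⟩, hab⟩
        have : (Finsupp.single ⟨(a, b), hab⟩ 1 : S →₀ ℂ) = e a b := by
          simp only [e, dif_pos hab]
        rw [this]
        rcases (hS a b).1 hab with ⟨rfl | rfl, rfl | rfl⟩ <;> assumption
      have : (Finsupp.single s a : S →₀ ℂ) = a • Finsupp.single s 1 := by simp
      rw [this, map_smul, map_smul, hs]
  have hH : ∀ a b (x : S →₀ ℂ), x ∈ Finsupp.supported ℂ ℂ {s : S | (s : ℤ × ℤ) = (a, b)} →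
      H x ∈ Finsupp.supported ℂ ℂ {s : S | (s : ℤ × ℤ) = (a, b - 1)} := by
    intro a b x hx
    rw [Finsupp.supported_eq_span_single] at hx
    induction hx using Submodule.span_induction with
    | mem x hx =>
      obtain ⟨s, hs, rfl⟩ := hx
      rw [Finsupp.linearCombination_single, one_smul]
      split_ifs with h
      · apply Finsupp.single_mem_supported
        rcases s with ⟨⟨a, b⟩, hab⟩
        simp only [Set.mem_ofPred_eq, Prod.mk.injEq] at hs ⊢
        omega
      · exact zero_mem _
    | zero => rw [map_zero]; exact zero_mem _
    | add x y _ _ hx hy => rw [map_add]; exact add_mem hx hy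
    | smul a x _ hx => rw [map_smul]; exact Submodule.smul_mem _ _ hx
  have hH' : ∀ a b (x : S →₀ ℂ), x ∈ Finsupp.supported ℂ ℂ {s : S | (s : ℤ × ℤ) = (a, b)} →
      H' x ∈ Finsupp.supported ℂ ℂ {s : S | (s : ℤ × ℤ) = (a - 1, b)} := by
    intro a b x hx
    rw [Finsupp.supported_eq_span_single] at hx
    induction hx using Submodule.span_induction with
    | mem x hx =>
      obtain ⟨s, hs, rfl⟩ := hx
      rw [Finsupp.linearCombination_single, one_smul]
      split_ifs with h
      · apply Finsupp.single_mem_supported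
        rcases s with ⟨⟨a, b⟩, hab⟩
        simp only [Set.mem_ofPred_eq, Prod.mk.injEq] at hs ⊢
        omega
      · exact zero_mem _
    | zero => rw [map_zero]; exact zero_mem _
    | add x y _ _ hx hy => rw [map_add]; exact add_mem hx hy
    | smul a x _ hx => rw [map_smul]; exact Submodule.smul_mem _ _ hx
  refine ⟨H, H', hH, hH', key (Db ∘ₗ H + H ∘ₗ Db) LinearMap.id ?_ ?_ ?_ ?_,
    key (D ∘ₗ H + H ∘ₗ D) 0 ?_ ?_ ?_ ?_, key (D ∘ₗ H' + H' ∘ₗ D) LinearMap.id ?_ ?_ ?_ ?_,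
    key (Db ∘ₗ H' + H' ∘ₗ Db) 0 ?_ ?_ ?_ ?_⟩
  all_goals
    simp only [LinearMap.add_apply, LinearMap.comp_apply, LinearMap.id_apply,
      LinearMap.zero_apply, eD, eDb, eH, eH', m00, m10, m01, m11, z1, z2, z3, z4, c0, c1,
      map_zero, smul_zero, one_smul, neg_smul, add_zero, zero_add, add_sub_cancel_right,
      neg_neg, map_neg, neg_zero, add_neg_cancel]

/-! #### Additivity and finiteness of the invariants -/

/-- The projections of a direct sum and its inclusions. -/
def sumFst (A B : DoubleComplex) : Hom (A.sum B) A where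
  toLin := LinearMap.fst ℂ A.carrier B.carrier
  map_comp _ _ _ hx := hx.1
  map_del _ := rfl
  map_delbar _ := rfl

def sumSnd (A B : DoubleComplex) : Hom (A.sum B) B where
  toLin := LinearMap.snd ℂ A.carrier B.carrier
  map_comp _ _ _ hx := hx.2
  map_del _ := rfl
  map_delbar _ := rfl

def sumInl (A B : DoubleComplex) : Hom A (A.sum B) where
  toLin := LinearMap.inl ℂ A.carrier B.carrier
  map_comp _ _ _ hx := ⟨hx, zero_mem _⟩
  map_del _ := Prod.ext rfl (map_zero B.del).symm
  map_delbar _ := Prod.ext rfl (map_zero B.delbar).symm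

def sumInr (A B : DoubleComplex) : Hom B (A.sum B) where
  toLin := LinearMap.inr ℂ A.carrier B.carrier
  map_comp _ _ _ hx := ⟨zero_mem _, hx⟩
  map_del _ := Prod.ext (map_zero A.del).symm rfl
  map_delbar _ := Prod.ext (map_zero A.delbar).symm rfl

theorem invariant_sum (A B : DoubleComplex) (i : Inv) [FiniteDimensional ℂ (A.cohomology i)]
    [FiniteDimensional ℂ (B.cohomology i)] :
    (A.sum B).invariant i = A.invariant i + B.invariant i := by
  let f : (A.sum B).cohomology i →ₗ[ℂ] A.cohomology i × B.cohomology i :=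
    ((sumFst A B).mapCohomology i).prod ((sumSnd A B).mapCohomology i)
  let g : A.cohomology i × B.cohomology i →ₗ[ℂ] (A.sum B).cohomology i :=
    ((sumInl A B).mapCohomology i).coprod ((sumInr A B).mapCohomology i)
  have hfg : f ∘ₗ g = LinearMap.id := by
    refine LinearMap.ext fun x => ?_
    rcases x with ⟨a, b⟩
    obtain ⟨a, rfl⟩ := Submodule.Quotient.mk_surjective _ a
    obtain ⟨b, rfl⟩ := Submodule.Quotient.mk_surjective _ b
    refine Prod.ext ?_ ?_
    · change Submodule.Quotient.mk _ = Submodule.Quotient.mk _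
      congr 1
      exact Subtype.ext (add_zero (a : A.carrier))
    · change Submodule.Quotient.mk _ = Submodule.Quotient.mk _
      congr 1
      exact Subtype.ext (zero_add (b : B.carrier))
  have hgf : g ∘ₗ f = LinearMap.id := by
    refine LinearMap.ext fun x => ?_
    obtain ⟨x, rfl⟩ := Submodule.Quotient.mk_surjective _ x
    change Submodule.Quotient.mk _ = Submodule.Quotient.mk _
    congr 1
    exact Subtype.ext (Prod.ext (add_zero (x : (A.sum B).carrier).1)
      (zero_add (x : (A.sum B).carrier).2))
  unfold invariant
  rw [← Module.finrank_prod]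
  exact LinearEquiv.finrank_eq (LinearEquiv.ofLinearMap f g hfg hgf)

theorem invariant_eq_zero {A : DoubleComplex} {i : Inv} (h : A.num i ≤ A.den i) :
    A.invariant i = 0 := by
  have : (A.den i).submoduleOf (A.num i) = ⊤ := by
    rw [eq_top_iff]; exact fun x _ => h x.2
  have : Subsingleton (A.cohomology i) := Submodule.Quotient.subsingleton_iff.2 this
  exact Module.finrank_zero_of_subsingleton

/-- The projection of a direct sum to one of its summands. -/
noncomputable def directSumProj {ι : Type} (F : ι → DoubleComplex) (j : ι) :
    Hom (directSum F) (F j) where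
  toLin := (DFinsupp.lapply j : (Π₀ i, (F i).carrier) →ₗ[ℂ] (F j).carrier)
  map_comp _ _ _ hx := hx j
  map_del _ := rfl
  map_delbar _ := rfl

open Classical in
/-- The inclusion of a summand in a direct sum. -/
noncomputable def directSumIncl {ι : Type} (F : ι → DoubleComplex) (j : ι) :
    Hom (F j) (directSum F) where
  toLin := (DFinsupp.lsingle (R := ℂ) (M := fun i => (F i).carrier) j :
    (F j).carrier →ₗ[ℂ] Π₀ i, (F i).carrier)
  map_comp p q x hx i := by
    change (DFinsupp.single j x : Π₀ i, (F i).carrier) i ∈ (F i).comp p q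
    by_cases h : j = i
    · subst h; simpa using hx
    · rw [DFinsupp.single_eq_of_ne (Ne.symm h)]; exact zero_mem _
  map_del x := DFinsupp.ext fun i => by
    change (DFinsupp.single j ((F j).del x) : Π₀ i, (F i).carrier) i =
      (F i).del ((DFinsupp.single j x : Π₀ i, (F i).carrier) i)
    by_cases h : j = i
    · subst h; simp
    · rw [DFinsupp.single_eq_of_ne (Ne.symm h), DFinsupp.single_eq_of_ne (Ne.symm h), map_zero]
  map_delbar x := DFinsupp.ext fun i => by
    change (DFinsupp.single j ((F j).delbar x) : Π₀ i, (F i).carrier) i =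
      (F i).delbar ((DFinsupp.single j x : Π₀ i, (F i).carrier) i)
    by_cases h : j = i
    · subst h; simp
    · rw [DFinsupp.single_eq_of_ne (Ne.symm h), DFinsupp.single_eq_of_ne (Ne.symm h), map_zero]

open Classical in
theorem mem_den_directSum {ι : Type} (F : ι → DoubleComplex) (i : Inv)
    (x : Π₀ j, (F j).carrier) (hx : ∀ j, x j ∈ (F j).den i) :
    x ∈ ((directSum F).den i : Submodule ℂ (Π₀ j, (F j).carrier)) := by
  rw [← DFinsupp.sum_single (f := x)]
  exact Submodule.sum_mem _ fun j _ => (directSumIncl F j).map_den i (hx j)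

theorem finiteDimensional_shape (s : Shape) : FiniteDimensional ℂ s.complex.carrier := by
  have key : ∀ S : Set (ℤ × ℤ), S.Finite → FiniteDimensional ℂ (S →₀ ℂ) := by
    intro S hS
    have := hS.to_subtype
    infer_instance
  cases s with
  | square p q =>
    refine key _ (((Set.finite_Icc p (p + 1)).prod (Set.finite_Icc q (q + 1))).subset
      fun x hx => ?_)
    simp only [Set.mem_prod, Set.mem_Icc]
    have := hx.1; have := hx.2
    omega
  | odd k p q => exact key _ (finite_oddSupport k p q)
  | horizontal p q l _ => exact key _ (finite_horizontalSupport p q l)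
  | vertical p q l _ => exact key _ (finite_verticalSupport p q l)

theorem num_le_den_of_not_isZigzag (s : Shape) (hs : ¬ s.IsZigzag) (i : Inv) :
    s.complex.num i ≤ s.complex.den i := by
  cases s with
  | square p q => exact (isContractible_square p q).num_le_den i
  | odd k p q => exact absurd trivial hs
  | horizontal p q l _ => exact absurd trivial hs
  | vertical p q l _ => exact absurd trivial hs

theorem HasFinitelyManyZigzags.finiteDimensional {A : DoubleComplex}
    (hA : A.HasFinitelyManyZigzags) (i : Inv) : FiniteDimensional ℂ (A.cohomology i) := by
  obtain ⟨ι, s, ⟨e⟩, hfin⟩ := hA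
  let T := {j | (s j).IsZigzag}
  have : Finite T := hfin
  have : Fintype T := Fintype.ofFinite T
  have : ∀ j, FiniteDimensional ℂ (s j).complex.carrier := fun j => finiteDimensional_shape _
  let F := fun j => (s j).complex
  let π : A.cohomology i →ₗ[ℂ] ((j : T) → (F j).cohomology i) :=
    LinearMap.pi fun j => (directSumProj F j).mapCohomology i ∘ₗ e.toHom.mapCohomology i
  refine FiniteDimensional.of_injective π ?_
  rw [← LinearMap.ker_eq_bot, LinearMap.ker_eq_bot']
  intro x hx
  obtain ⟨x, rfl⟩ := Submodule.Quotient.mk_surjective _ x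
  rw [Submodule.Quotient.mk_eq_zero]
  change (x : A.carrier) ∈ A.den i
  let y : Π₀ j, (F j).carrier := e.toEquiv x
  have hy : ∀ j, y j ∈ (F j).den i := by
    intro j
    by_cases hj : (s j).IsZigzag
    · have h : Submodule.Quotient.mk (p := ((F j).den i).submoduleOf ((F j).num i))
          ⟨y j, (directSumProj F j).map_num i (e.toHom.map_num i x.2)⟩ = 0 :=
        congrFun hx ⟨j, hj⟩
      have h2 := (Submodule.Quotient.mk_eq_zero _).1 h
      exact h2
    · exact num_le_den_of_not_isZigzag (s j) hj i
        ((directSumProj F j).map_num i (e.toHom.map_num i x.2))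
  have := e.symm.toHom.map_den i (mem_den_directSum F i y hy)
  change e.toEquiv.symm (e.toEquiv (x : A.carrier)) ∈ A.den i at this
  rwa [LinearEquiv.symm_apply_apply] at this

/-! ### The group of formal double complexes modulo squares -/

/-- Bounded double complexes with finitely many zigzags. -/
abbrev BoundedFin : Type 1 := {A : DoubleComplex // A.IsBounded ∧ A.HasFinitelyManyZigzags}

/-- The relation of being isomorphic. -/
instance isoSetoid : Setoid BoundedFin where
  r A B := Nonempty (Iso A.1 B.1)
  iseqv := ⟨fun A => ⟨Iso.refl A.1⟩, fun ⟨e⟩ => ⟨e.symm⟩, fun ⟨e⟩ ⟨f⟩ => ⟨e.trans f⟩⟩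

/-- Isomorphism classes of bounded double complexes with finitely many zigzags. -/
abbrev IsoClass : Type 1 := Quotient isoSetoid

/-- The subgroup of relations `[C] = [A] + [B]` whenever `C ≅ A ⊕ B`. -/
def sumRelations : AddSubgroup (FreeAbelianGroup IsoClass) :=
  AddSubgroup.closure {x | ∃ A B C : BoundedFin, Nonempty (Iso C.1 (A.1.sum B.1)) ∧
    x = FreeAbelianGroup.of ⟦C⟧ - (FreeAbelianGroup.of ⟦A⟧ + FreeAbelianGroup.of ⟦B⟧)}

/-- The free abelian group on the isomorphism classes, where `[A ⊕ B]` is identified with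
`[A] + [B]`. -/
abbrev FormalGroup : Type 1 := FreeAbelianGroup IsoClass ⧸ sumRelations

/-- The class of a double complex in the group of formal double complexes. -/
def formalClass (A : BoundedFin) : FormalGroup :=
  QuotientAddGroup.mk (FreeAbelianGroup.of ⟦A⟧)

/-- The subgroup generated by the squares. -/
def squareSubgroup : AddSubgroup FormalGroup :=
  AddSubgroup.closure {x | ∃ (A : BoundedFin) (p q : ℤ),
    Nonempty (Iso A.1 (square p q)) ∧ x = formalClass A}

/-- The group of formal double complexes modulo squares. -/
abbrev ReducedGroup : Type 1 := FormalGroup ⧸ squareSubgroup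

/-- The class of a double complex in the group of formal double complexes modulo squares. -/
def reducedClass (A : BoundedFin) : ReducedGroup :=
  QuotientAddGroup.mk (formalClass A)

/-- The array of all invariants, as a function of the isomorphism class. -/
noncomputable def invariantArray : IsoClass → Inv → ℤ :=
  Quotient.lift (fun A i => (A.1.invariant i : ℤ)) fun _ _ ⟨e⟩ =>
    funext fun i => congrArg _ (e.invariant_eq i)

/-- The additive extension of the array of all invariants to formal double complexes. -/
noncomputable def chiFormal : FormalGroup →+ (Inv → ℤ) :=
  QuotientAddGroup.lift sumRelations (FreeAbelianGroup.lift invariantArray) (by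
    refine (AddSubgroup.closure_le (K := (FreeAbelianGroup.lift invariantArray).ker)).2 ?_
    rintro _ ⟨A, B, C, ⟨e⟩, rfl⟩
    rw [SetLike.mem_coe, AddMonoidHom.mem_ker, map_sub, map_add, FreeAbelianGroup.lift_apply_of,
      FreeAbelianGroup.lift_apply_of, FreeAbelianGroup.lift_apply_of]
    funext i
    have := A.2.2.finiteDimensional i
    have := B.2.2.finiteDimensional i
    change (C.1.invariant i : ℤ) - (A.1.invariant i + B.1.invariant i) = 0
    rw [e.invariant_eq, invariant_sum]
    push_cast
    ring)

/-- The homomorphism `χ` that sends a formal double complex to the array of its Betti, Bott-Chern,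
Aeppli, Hodge and Varouchas numbers and of the dimensions on the pages of its Frölicher spectral
sequences. -/
noncomputable def chi : ReducedGroup →+ (Inv → ℤ) :=
  QuotientAddGroup.lift squareSubgroup chiFormal (by
    refine (AddSubgroup.closure_le (K := chiFormal.ker)).2 ?_
    rintro _ ⟨A, p, q, ⟨e⟩, rfl⟩
    rw [SetLike.mem_coe, AddMonoidHom.mem_ker]
    funext i
    change (A.1.invariant i : ℤ) = 0
    rw [e.invariant_eq, invariant_eq_zero ((isContractible_square p q).num_le_den i)]
    rfl)

theorem chi_reducedClass (A : BoundedFin) (i : Inv) :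
    chi (reducedClass A) i = A.1.invariant i := rfl

/-! ### The family `Z_k^{v±}` -/

/-- The class of the odd zigzag `Z_k^{p,q}`. -/
noncomputable def oddClass (k p q : ℤ) : ReducedGroup :=
  reducedClass ⟨oddZigzag k p q, isBounded_oddZigzag k p q,
    hasFinitelyManyZigzags_oddZigzag k p q⟩

/-- The bidegrees of total degree greater than `k`. -/
def regionPlus (k : ℤ) : Set (ℤ × ℤ) := {x | k < x.1 + x.2}

/-- The bidegrees of total degree less than `k`. -/
def regionMinus (k : ℤ) : Set (ℤ × ℤ) := {x | x.1 + x.2 < k}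

/-- A filling of a region by integers, almost all zero, whose row and column sums vanish. The
filling is extended by zero outside of the region. -/
structure IsFilling (S : Set (ℤ × ℤ)) (v : ℤ × ℤ →₀ ℤ) : Prop where
  support_subset : ∀ p q, v (p, q) ≠ 0 → (p, q) ∈ S
  row_sum : ∀ q, ∑ᶠ p, v (p, q) = 0
  column_sum : ∀ p, ∑ᶠ q, v (p, q) = 0

/-- The formal double complex `Z_k^v = ⨁ v(p,q) Z_k^{p,q}`. -/
noncomputable def fillingSum (k : ℤ) (v : ℤ × ℤ →₀ ℤ) : ReducedGroup :=
  v.sum fun pq n => n • oddClass k pq.1 pq.2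

end DoubleComplex

/-! The group is generated by zigzags. Squares are zero in it by definition, and a bounded infinite
sum of squares is zero by an Eilenberg swindle, so removing the finitely many zigzag summands one at
a time writes every class as an integral combination of odd, horizontal and vertical zigzags
(`exists_zigzag_combination`). A zigzag is a thin complex, so `∂∂̄ = 0` on it. Its bidegreewise
cohomologies can therefore be read off from the support, by checking which of the four neighbours of
`(p, q)` are present. Its de Rham cohomology and spectral sequences come from propagating
coordinates along the staircase.

The combinations given by fillings lie in the kernel for the following reason. With `k` fixed and
`(p, q)` strictly on one side of the antidiagonal, every invariant of `Z_k^{p,q}` has the form `f p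
+ g q`. De Rham, Dolbeault and Frölicher numbers depend on at most one of the two variables. The
others are indicators of quadrants that, within the region, are differences of two half-planes
(`exists_split_of_le`, `exists_split_of_ge`). A filling has zero row and column sums, so it is
orthogonal to all such functions.

Conversely, let a combination lie in the kernel. On all pages `r ≥ 1` an odd zigzag contributes the
same numbers to the Frölicher sequence and a vertical one contributes nothing. A horizontal zigzag
of length `2l` contributes its two ends exactly while `r ≤ l`. Comparing two consecutive pages
isolates one length and relates each horizontal coefficient to one further left. Finite support then
forces all of them to vanish. Exchanging the two gradings handles the vertical zigzags.

Only odd zigzags remain. Differences of Bott-Chern and Varouchas numbers single out the zigzags with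
a prescribed end, which gives the row and column sums above the antidiagonal and the coefficients of
the dots. All of these vanish. Subtracting them from the first pages of the two spectral sequences
gives the sums below. For each `k`, the coefficients therefore split into a filling of each region.
-/

namespace DoubleComplex

/-! ### Thin complexes in coordinates -/

section coordinates

variable {S : Set (ℤ × ℤ)} {hS : IsThin S}

variable (S hS) in
/-- The underlying finitely supported function of an element of a thin complex. -/
noncomputable def toFinsupp : (thin S hS).carrier ≃ₗ[ℂ] (S →₀ ℂ) := LinearEquiv.refl ℂ (S →₀ ℂ)

open Classical in
/-- The coordinate in bidegree `s` of an element of a thin complex. -/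
noncomputable def coeff (s : ℤ × ℤ) : (thin S hS).carrier →ₗ[ℂ] ℂ :=
  if h : s ∈ S then (Finsupp.lapply ⟨s, h⟩ : (S →₀ ℂ) →ₗ[ℂ] ℂ) ∘ₗ (toFinsupp S hS).toLinearMap
  else 0

theorem coeff_mk {s : ℤ × ℤ} (h : s ∈ S) (x : (thin S hS).carrier) :
    coeff s x = toFinsupp S hS x ⟨s, h⟩ := by
  rw [coeff, dif_pos h]; rfl

theorem coeff_of_notMem {s : ℤ × ℤ} (h : s ∉ S) (x : (thin S hS).carrier) : coeff s x = 0 := by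
  rw [coeff, dif_neg h]; rfl

theorem coeff_ext {x y : (thin S hS).carrier} (h : ∀ s, coeff s x = coeff s y) : x = y := by
  refine (toFinsupp S hS).injective (Finsupp.ext fun s => ?_)
  have := h s
  rwa [coeff_mk s.2, coeff_mk s.2] at this

theorem mem_of_coeff_ne_zero {s : ℤ × ℤ} {x : (thin S hS).carrier} (h : coeff s x ≠ 0) :
    s ∈ S := by
  by_contra h'; exact h (coeff_of_notMem h' x)

open Classical in
/-- The basis vector of bidegree `s`, or zero if `s` does not belong to `S`. -/
noncomputable def basisVec (S : Set (ℤ × ℤ)) (hS : IsThin S) (s : ℤ × ℤ) : (thin S hS).carrier :=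
  (toFinsupp S hS).symm (if h : s ∈ S then Finsupp.single ⟨s, h⟩ 1 else 0)

open Classical in
theorem coeff_basisVec (s t : ℤ × ℤ) :
    coeff t (basisVec S hS s) = if t = s ∧ s ∈ S then 1 else 0 := by
  by_cases ht : t ∈ S
  · rw [coeff_mk ht, basisVec, LinearEquiv.apply_symm_apply]
    by_cases hs : s ∈ S
    · rw [dif_pos hs, Finsupp.single_apply]
      simp [hs, eq_comm]
    · simp [hs]
  · rw [coeff_of_notMem ht, if_neg]
    rintro ⟨rfl, h⟩; exact ht h

theorem basisVec_of_notMem {s : ℤ × ℤ} (hs : s ∉ S) : basisVec S hS s = 0 := by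
  rw [basisVec, dif_neg hs, map_zero]

theorem eq_of_coeff_basisVec_ne_zero {s t : ℤ × ℤ} (h : coeff t (basisVec S hS s) ≠ 0) : t = s := by
  classical
  rw [coeff_basisVec] at h
  exact (ite_ne_right_iff.1 h).1.1

/-- Reduces exactness of whole elements to exactness of single basis vectors, which is then shown by
induction along the staircase. -/
theorem mem_of_basisVec_mem {D : Submodule ℂ (thin S hS).carrier} {x : (thin S hS).carrier}
    (h : ∀ s, coeff s x ≠ 0 → basisVec S hS s ∈ D) : x ∈ D := by
  rw [← (toFinsupp S hS).symm_apply_apply x, ← Finsupp.sum_single (toFinsupp S hS x), Finsupp.sum,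
    map_sum]
  refine Submodule.sum_mem _ fun s hs => ?_
  have e : (toFinsupp S hS).symm (Finsupp.single s (toFinsupp S hS x s)) =
      toFinsupp S hS x s • basisVec S hS s := by
    rw [basisVec, dif_pos s.2, ← map_smul, Finsupp.smul_single, smul_eq_mul, mul_one]
  rw [e]
  refine Submodule.smul_mem _ _ (h _ ?_)
  rw [coeff_mk s.2]
  exact Finsupp.mem_support_iff.1 hs

theorem linearMap_ext_basisVec {X : Type} [AddCommGroup X] [Module ℂ X]
    {f g : (thin S hS).carrier →ₗ[ℂ] X} (h : ∀ s ∈ S, f (basisVec S hS s) = g (basisVec S hS s)) :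
    f = g := by
  have e : f ∘ₗ (toFinsupp S hS).symm.toLinearMap = g ∘ₗ (toFinsupp S hS).symm.toLinearMap := by
    refine Finsupp.lhom_ext' fun s => LinearMap.ext_ring ?_
    have := h s s.2
    rwa [basisVec, dif_pos s.2] at this
  refine LinearMap.ext fun x => ?_
  simpa using LinearMap.congr_fun e (toFinsupp S hS x)

open Classical in
theorem del_basisVec {a b : ℤ} (h : (a, b) ∈ S) :
    (thin S hS).del (basisVec S hS (a, b)) = basisVec S hS (a + 1, b) := by
  rw [basisVec, dif_pos h]
  have e : Finsupp.linearCombination ℂ (fun s : S =>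
      if h : ((s : ℤ × ℤ).1 + 1, (s : ℤ × ℤ).2) ∈ S then (Finsupp.single ⟨_, h⟩ 1 : S →₀ ℂ) else 0)
      (Finsupp.single ⟨(a, b), h⟩ 1) = _ :=
    (Finsupp.linearCombination_single ℂ _ _).trans (one_smul _ _)
  exact e

open Classical in
theorem delbar_basisVec {a b : ℤ} (h : (a, b) ∈ S) :
    (thin S hS).delbar (basisVec S hS (a, b)) = basisVec S hS (a, b + 1) := by
  rw [basisVec, dif_pos h]
  have e : Finsupp.linearCombination ℂ (fun s : S =>
      if h : ((s : ℤ × ℤ).1, (s : ℤ × ℤ).2 + 1) ∈ S then (Finsupp.single ⟨_, h⟩ 1 : S →₀ ℂ) else 0)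
      (Finsupp.single ⟨(a, b), h⟩ 1) = _ :=
    (Finsupp.linearCombination_single ℂ _ _).trans (one_smul _ _)
  exact e

-- Only the target bidegree has to be tested for membership: `coeff` is zero off `S`, so an absent
-- source contributes zero by itself.
open Classical in
theorem coeff_del (a b : ℤ) (x : (thin S hS).carrier) :
    coeff (a, b) ((thin S hS).del x) = if (a, b) ∈ S then coeff (a - 1, b) x else 0 := by
  by_cases hab : (a, b) ∈ S
  swap
  · rw [coeff_of_notMem hab, if_neg hab]
  rw [if_pos hab]
  refine LinearMap.congr_fun (f := coeff (a, b) ∘ₗ (thin S hS).del) (g := coeff (a - 1, b))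
    (linearMap_ext_basisVec fun s hs => ?_) x
  obtain ⟨p, q⟩ := s
  rw [LinearMap.comp_apply, del_basisVec hs, coeff_basisVec, coeff_basisVec]
  refine if_congr ?_ rfl rfl
  simp only [Prod.mk.injEq, hs, and_true]
  constructor
  · rintro ⟨⟨rfl, rfl⟩, -⟩; simp
  · rintro ⟨h, rfl⟩
    have : p + 1 = a := by omega
    subst this; simpa using hab

open Classical in
theorem coeff_delbar (a b : ℤ) (x : (thin S hS).carrier) :
    coeff (a, b) ((thin S hS).delbar x) = if (a, b) ∈ S then coeff (a, b - 1) x else 0 := by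
  by_cases hab : (a, b) ∈ S
  swap
  · rw [coeff_of_notMem hab, if_neg hab]
  rw [if_pos hab]
  refine LinearMap.congr_fun (f := coeff (a, b) ∘ₗ (thin S hS).delbar) (g := coeff (a, b - 1))
    (linearMap_ext_basisVec fun s hs => ?_) x
  obtain ⟨p, q⟩ := s
  rw [LinearMap.comp_apply, delbar_basisVec hs, coeff_basisVec, coeff_basisVec]
  refine if_congr ?_ rfl rfl
  simp only [Prod.mk.injEq, hs, and_true]
  constructor
  · rintro ⟨⟨rfl, rfl⟩, -⟩; simp
  · rintro ⟨rfl, h⟩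
    have : q + 1 = b := by omega
    subst this; simpa using hab

theorem d_basisVec {a b : ℤ} (h : (a, b) ∈ S) :
    (thin S hS).d (basisVec S hS (a, b)) = basisVec S hS (a + 1, b) + basisVec S hS (a, b + 1) := by
  rw [d, LinearMap.add_apply, del_basisVec h, delbar_basisVec h]

open Classical in
theorem coeff_d (a b : ℤ) (x : (thin S hS).carrier) : coeff (a, b) ((thin S hS).d x) =
    if (a, b) ∈ S then coeff (a - 1, b) x + coeff (a, b - 1) x else 0 := by
  rw [d, LinearMap.add_apply, map_add, coeff_del, coeff_delbar]
  split_ifs <;> simp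

theorem toFinsupp_mem_supported {P : ℤ × ℤ → Prop} {x : (thin S hS).carrier} :
    toFinsupp S hS x ∈ Finsupp.supported ℂ ℂ {s : S | P s} ↔ ∀ s, coeff s x ≠ 0 → P s := by
  rw [Finsupp.mem_supported']
  constructor
  · intro h s hs
    by_contra h'
    have hm := mem_of_coeff_ne_zero hs
    rw [coeff_mk hm] at hs
    exact hs (h ⟨s, hm⟩ h')
  · intro h s hs
    by_contra h'
    rw [← coeff_mk s.2] at h'
    exact hs (h _ h')

theorem mem_comp_thin {p q : ℤ} {x : (thin S hS).carrier} :
    x ∈ (thin S hS).comp p q ↔ ∀ s, coeff s x ≠ 0 → s = (p, q) :=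
  toFinsupp_mem_supported (P := fun s => s = (p, q))

/-- The total degree and both filtrations are suprema of components selected by a predicate on
bidegrees, so one criterion on the support serves all three. -/
theorem mem_iSup_comp_thin {P : ℤ → ℤ → Prop} {x : (thin S hS).carrier} :
    x ∈ ⨆ (p : ℤ) (q : ℤ) (_ : P p q), (thin S hS).comp p q ↔
      ∀ s, coeff s x ≠ 0 → P s.1 s.2 := by
  rw [← toFinsupp_mem_supported (P := fun s => P s.1 s.2)]
  have e : {s : S | P (s : ℤ × ℤ).1 (s : ℤ × ℤ).2} =
      ⋃ (p : ℤ) (q : ℤ) (_ : P p q), {s : S | (s : ℤ × ℤ) = (p, q)} := by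
    ext s
    rcases s with ⟨⟨a, b⟩, hs⟩
    simp only [Set.mem_ofPred_eq, Set.mem_iUnion, Prod.mk.injEq, exists_prop]
    constructor
    · intro h; exact ⟨a, b, h, rfl, rfl⟩
    · rintro ⟨_, _, h, rfl, rfl⟩; exact h
  have e' : ∀ p q : ℤ, Finsupp.supported ℂ ℂ (⋃ (_ : P p q), {s : S | (s : ℤ × ℤ) = (p, q)}) =
      ⨆ (_ : P p q), Finsupp.supported ℂ ℂ {s : S | (s : ℤ × ℤ) = (p, q)} := by
    intro p q
    by_cases h : P p q <;> simp [h]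
  simp_rw [e, Finsupp.supported_iUnion, e']
  exact Iff.rfl

theorem mem_tot_thin {k : ℤ} {x : (thin S hS).carrier} :
    x ∈ (thin S hS).tot k ↔ ∀ s, coeff s x ≠ 0 → s.1 + s.2 = k :=
  mem_iSup_comp_thin

theorem mem_filtration_thin {l k : ℤ} {x : (thin S hS).carrier} :
    x ∈ (thin S hS).filtration l k ↔ ∀ s, coeff s x ≠ 0 → s.1 + s.2 = k ∧ l ≤ s.1 :=
  mem_iSup_comp_thin

theorem mem_conjFiltration_thin {l k : ℤ} {x : (thin S hS).carrier} :
    x ∈ (thin S hS).conjFiltration l k ↔ ∀ s, coeff s x ≠ 0 → s.1 + s.2 = k ∧ l ≤ s.2 :=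
  mem_iSup_comp_thin

open Classical in
theorem exists_coeff_eq (hfin : S.Finite) (f : ℤ × ℤ → ℂ) :
    ∃ x : (thin S hS).carrier, ∀ s, coeff s x = if s ∈ S then f s else 0 := by
  have := hfin.to_subtype
  refine ⟨(toFinsupp S hS).symm (Finsupp.equivFunOnFinite.symm fun s : S => f s), fun s => ?_⟩
  by_cases h : s ∈ S
  · rw [coeff_mk h, if_pos h, LinearEquiv.apply_symm_apply]; rfl
  · rw [coeff_of_notMem h, if_neg h]

/-- The composite raises the total degree by two, whereas a thin set meets only two consecutive
degrees. -/
theorem del_delbar_thin (x : (thin S hS).carrier) : (thin S hS).del ((thin S hS).delbar x) = 0 := by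
  refine coeff_ext fun s => ?_
  rcases s with ⟨a, b⟩
  rw [coeff_del, coeff_delbar, map_zero]
  split_ifs with h1 h2
  · by_contra h3
    have h3 : (a - 1, b - 1) ∈ S := mem_of_coeff_ne_zero h3
    obtain ⟨m, hm⟩ := id hS
    have := hm _ h1; have := hm _ h3
    dsimp only at *; omega
  · rfl
  · rfl

theorem basisVec_mem_comp (p q : ℤ) : basisVec S hS (p, q) ∈ (thin S hS).comp p q := by
  rw [mem_comp_thin]
  intro s hs
  rw [coeff_basisVec] at hs
  by_contra h
  exact hs (if_neg fun h' => h h'.1)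

theorem eq_smul_basisVec {p q : ℤ} {x : (thin S hS).carrier} (hx : x ∈ (thin S hS).comp p q) :
    x = coeff (p, q) x • basisVec S hS (p, q) := by
  rw [mem_comp_thin] at hx
  refine coeff_ext fun s => ?_
  rw [map_smul, coeff_basisVec, smul_eq_mul]
  by_cases h : coeff s x = 0
  · rw [h]
    split_ifs with h'
    · rw [← h'.1, h, zero_mul]
    · rw [mul_zero]
  · have h2 := hx s h
    subst h2
    rw [if_pos ⟨rfl, mem_of_coeff_ne_zero h⟩, mul_one]

end coordinates

/-! ### Dimensions of subquotients -/

theorem finrank_eq_zero_of_le {X : Type} [AddCommGroup X] [Module ℂ X] {N D : Submodule ℂ X}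
    (h : N ≤ D) : Module.finrank ℂ (N ⧸ D.submoduleOf N) = 0 := by
  have : D.submoduleOf N = ⊤ := by
    rw [eq_top_iff]; exact fun x _ => h x.2
  have : Subsingleton (N ⧸ D.submoduleOf N) := Submodule.Quotient.subsingleton_iff.2 this
  exact Module.finrank_zero_of_subsingleton

theorem finrank_eq_one_of_generator {X : Type} [AddCommGroup X] [Module ℂ X] {N D : Submodule ℂ X}
    (y : X) (hN : y ∈ N) (hD : y ∉ D) (h : ∀ x ∈ N, ∃ c : ℂ, x - c • y ∈ D) :
    Module.finrank ℂ (N ⧸ D.submoduleOf N) = 1 := by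
  rw [finrank_eq_one_iff_of_nonzero' (Submodule.Quotient.mk ⟨y, hN⟩)]
  · intro w
    obtain ⟨⟨x, hx⟩, rfl⟩ := Submodule.Quotient.mk_surjective _ w
    obtain ⟨c, hc⟩ := h x hx
    refine ⟨c, ?_⟩
    symm
    rw [← Submodule.Quotient.mk_smul, Submodule.Quotient.eq]
    exact hc
  · intro h0
    rw [Submodule.Quotient.mk_eq_zero] at h0
    exact hD h0

section bidegree

variable {S : Set (ℤ × ℤ)} {hS : IsThin S}

-- The component of bidegree `(p, q)` is zero or the line through `basisVec S hS (p, q)`. A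
-- subquotient of it is nonzero exactly when that vector lies in the numerator and not in the
-- denominator. All the bidegreewise invariants are computed through this.
open Classical in
theorem finrank_subquotient_thin (p q : ℤ) (N D : Submodule ℂ (thin S hS).carrier) :
    Module.finrank ℂ (((thin S hS).comp p q ⊓ N : Submodule ℂ _) ⧸
        D.submoduleOf ((thin S hS).comp p q ⊓ N)) =
      if (p, q) ∈ S ∧ basisVec S hS (p, q) ∈ N ∧ basisVec S hS (p, q) ∉ D then 1 else 0 := by
  split_ifs with h
  · obtain ⟨h1, h2, h3⟩ := h
    refine finrank_eq_one_of_generator _ ⟨basisVec_mem_comp p q, h2⟩ h3 fun x hx => ?_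
    refine ⟨coeff (p, q) x, ?_⟩
    rw [← eq_smul_basisVec hx.1, sub_self]; exact zero_mem _
  · refine finrank_eq_zero_of_le fun x hx => ?_
    have e := eq_smul_basisVec hx.1
    by_cases hc : coeff (p, q) x = 0
    · rw [hc, zero_smul] at e; rw [e]; exact zero_mem _
    · have h2 : basisVec S hS (p, q) ∈ N := by
        have := Submodule.smul_mem N (coeff (p, q) x)⁻¹ hx.2
        rwa [e, map_smul, coeff_basisVec, if_pos ⟨rfl, mem_of_coeff_ne_zero hc⟩, smul_smul,
          smul_eq_mul, mul_one, inv_mul_cancel₀ hc, one_smul] at this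
      have h3 : basisVec S hS (p, q) ∈ D := by
        by_contra h3
        exact h ⟨mem_of_coeff_ne_zero hc, h2, h3⟩
      rw [e]; exact Submodule.smul_mem _ _ h3

/-- In general a sum of subspaces can contain a vector lying in neither. Here `hM` and `hN` say that
an element with nonzero coordinate at `s` brings the basis vector along, which holds for kernels and
images of `∂` and `∂̄`. Needed for the denominators that are sums: Aeppli and Varouchas C, E, F. -/
theorem basisVec_mem_sup (s : ℤ × ℤ) {M N : Submodule ℂ (thin S hS).carrier}
    (hM : ∀ x ∈ M, coeff s x ≠ 0 → basisVec S hS s ∈ M)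
    (hN : ∀ x ∈ N, coeff s x ≠ 0 → basisVec S hS s ∈ N) (hs : s ∈ S) :
    basisVec S hS s ∈ M ⊔ N ↔ basisVec S hS s ∈ M ∨ basisVec S hS s ∈ N := by
  constructor
  · intro h
    obtain ⟨x, hx, y, hy, e⟩ := Submodule.mem_sup.1 h
    have e := congrArg (coeff s) e
    rw [map_add, coeff_basisVec, if_pos ⟨rfl, hs⟩] at e
    by_cases h0 : coeff s x = 0
    · right
      refine hN y hy fun h1 => ?_
      rw [h0, h1] at e
      norm_num at e
    · left; exact hM x hx h0
  · rintro (h | h)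
    · exact Submodule.mem_sup_left h
    · exact Submodule.mem_sup_right h

open LinearMap

theorem basisVec_mem_ker_del {p q : ℤ} (hs : (p, q) ∈ S) :
    basisVec S hS (p, q) ∈ ker (thin S hS).del ↔ (p + 1, q) ∉ S := by
  rw [mem_ker]
  constructor
  · intro h h'
    have := congrArg (coeff (p + 1, q)) h
    rw [coeff_del, if_pos h', coeff_basisVec, map_zero, add_sub_cancel_right,
      if_pos ⟨rfl, hs⟩] at this
    exact one_ne_zero this
  · intro h
    refine coeff_ext fun s => ?_
    obtain ⟨a, b⟩ := s
    rw [coeff_del, map_zero, coeff_basisVec]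
    split_ifs with h1 h2
    · rw [Prod.mk.injEq] at h2
      obtain ⟨⟨rfl, rfl⟩, -⟩ := h2
      rw [sub_add_cancel] at h; exact absurd h1 h
    · rfl
    · rfl

theorem basisVec_mem_ker_delbar {p q : ℤ} (hs : (p, q) ∈ S) :
    basisVec S hS (p, q) ∈ ker (thin S hS).delbar ↔ (p, q + 1) ∉ S := by
  rw [mem_ker]
  constructor
  · intro h h'
    have := congrArg (coeff (p, q + 1)) h
    rw [coeff_delbar, if_pos h', coeff_basisVec, map_zero, add_sub_cancel_right,
      if_pos ⟨rfl, hs⟩] at this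
    exact one_ne_zero this
  · intro h
    refine coeff_ext fun s => ?_
    obtain ⟨a, b⟩ := s
    rw [coeff_delbar, map_zero, coeff_basisVec]
    split_ifs with h1 h2
    · rw [Prod.mk.injEq] at h2
      obtain ⟨⟨rfl, rfl⟩, -⟩ := h2
      rw [sub_add_cancel] at h; exact absurd h1 h
    · rfl
    · rfl

theorem basisVec_mem_range_del {p q : ℤ} (hs : (p, q) ∈ S) :
    basisVec S hS (p, q) ∈ range (thin S hS).del ↔ (p - 1, q) ∈ S := by
  constructor
  · rintro ⟨x, hx⟩
    have := congrArg (coeff (p, q)) hx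
    rw [coeff_del, if_pos hs, coeff_basisVec, if_pos ⟨rfl, hs⟩] at this
    apply mem_of_coeff_ne_zero (hS := hS) (x := x)
    rw [this]; exact one_ne_zero
  · intro h
    refine ⟨basisVec S hS (p - 1, q), coeff_ext fun s => ?_⟩
    obtain ⟨a, b⟩ := s
    rw [coeff_del, coeff_basisVec, coeff_basisVec]
    by_cases e : (a, b) = (p, q)
    · rw [Prod.mk.injEq] at e
      obtain ⟨rfl, rfl⟩ := e
      rw [if_pos hs, if_pos ⟨rfl, h⟩, if_pos ⟨rfl, hs⟩]
    · rw [if_neg (c := (a, b) = (p, q) ∧ (p, q) ∈ S) (fun h => e h.1)]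
      split_ifs with h1 h2
      · exfalso; apply e
        have := h2.1
        rw [Prod.mk.injEq] at *
        omega
      · rfl
      · rfl

theorem basisVec_mem_range_delbar {p q : ℤ} (hs : (p, q) ∈ S) :
    basisVec S hS (p, q) ∈ range (thin S hS).delbar ↔ (p, q - 1) ∈ S := by
  constructor
  · rintro ⟨x, hx⟩
    have := congrArg (coeff (p, q)) hx
    rw [coeff_delbar, if_pos hs, coeff_basisVec, if_pos ⟨rfl, hs⟩] at this
    apply mem_of_coeff_ne_zero (hS := hS) (x := x)
    rw [this]; exact one_ne_zero
  · intro h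
    refine ⟨basisVec S hS (p, q - 1), coeff_ext fun s => ?_⟩
    obtain ⟨a, b⟩ := s
    rw [coeff_delbar, coeff_basisVec, coeff_basisVec]
    by_cases e : (a, b) = (p, q)
    · rw [Prod.mk.injEq] at e
      obtain ⟨rfl, rfl⟩ := e
      rw [if_pos hs, if_pos ⟨rfl, h⟩, if_pos ⟨rfl, hs⟩]
    · rw [if_neg (c := (a, b) = (p, q) ∧ (p, q) ∈ S) (fun h => e h.1)]
      split_ifs with h1 h2
      · exfalso; apply e
        have := h2.1
        rw [Prod.mk.injEq] at *
        omega
      · rfl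
      · rfl

theorem basisVec_mem_ker_del_of_coeff {s : ℤ × ℤ} (x : (thin S hS).carrier)
    (hx : x ∈ ker (thin S hS).del) (h : coeff s x ≠ 0) :
    basisVec S hS s ∈ ker (thin S hS).del := by
  obtain ⟨p, q⟩ := s
  rw [basisVec_mem_ker_del (mem_of_coeff_ne_zero h)]
  intro h'
  have := congrArg (coeff (p + 1, q)) hx
  rw [coeff_del, if_pos h', map_zero, add_sub_cancel_right] at this
  exact h this

theorem basisVec_mem_ker_delbar_of_coeff {s : ℤ × ℤ} (x : (thin S hS).carrier)
    (hx : x ∈ ker (thin S hS).delbar) (h : coeff s x ≠ 0) :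
    basisVec S hS s ∈ ker (thin S hS).delbar := by
  obtain ⟨p, q⟩ := s
  rw [basisVec_mem_ker_delbar (mem_of_coeff_ne_zero h)]
  intro h'
  have := congrArg (coeff (p, q + 1)) hx
  rw [coeff_delbar, if_pos h', map_zero, add_sub_cancel_right] at this
  exact h this

theorem basisVec_mem_range_del_of_coeff {s : ℤ × ℤ} (x : (thin S hS).carrier)
    (hx : x ∈ range (thin S hS).del) (h : coeff s x ≠ 0) :
    basisVec S hS s ∈ range (thin S hS).del := by
  obtain ⟨p, q⟩ := s
  have hs := mem_of_coeff_ne_zero h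
  rw [basisVec_mem_range_del hs]
  obtain ⟨y, rfl⟩ := hx
  rw [coeff_del, if_pos hs] at h
  exact mem_of_coeff_ne_zero h

theorem basisVec_mem_range_delbar_of_coeff {s : ℤ × ℤ} (x : (thin S hS).carrier)
    (hx : x ∈ range (thin S hS).delbar) (h : coeff s x ≠ 0) :
    basisVec S hS s ∈ range (thin S hS).delbar := by
  obtain ⟨p, q⟩ := s
  have hs := mem_of_coeff_ne_zero h
  rw [basisVec_mem_range_delbar hs]
  obtain ⟨y, rfl⟩ := hx
  rw [coeff_delbar, if_pos hs] at h
  exact mem_of_coeff_ne_zero h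

theorem basisVec_notMem_range_comp {s : ℤ × ℤ} (hs : s ∈ S) :
    basisVec S hS s ∉ range ((thin S hS).del ∘ₗ (thin S hS).delbar) := by
  rintro ⟨x, hx⟩
  rw [comp_apply, del_delbar_thin] at hx
  have := congrArg (coeff s) hx
  rw [map_zero, coeff_basisVec, if_pos ⟨rfl, hs⟩] at this
  exact zero_ne_one this

theorem mem_ker_comp_thin (x : (thin S hS).carrier) :
    x ∈ ker ((thin S hS).del ∘ₗ (thin S hS).delbar) := by
  rw [mem_ker, comp_apply, del_delbar_thin]

/-! ### Bidegreewise cohomologies of thin complexes in terms of neighbours -/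

open Classical in
theorem invariant_bottChern_thin (p q : ℤ) : (thin S hS).invariant (.bottChern p q) =
    if (p, q) ∈ S ∧ (p + 1, q) ∉ S ∧ (p, q + 1) ∉ S then 1 else 0 := by
  refine (finrank_subquotient_thin p q _ _).trans (if_congr (and_congr_right fun hs => ?_) rfl rfl)
  exact (and_iff_left (basisVec_notMem_range_comp hs)).trans
    (and_congr (basisVec_mem_ker_del hs) (basisVec_mem_ker_delbar hs))

open Classical in
theorem invariant_dolbeault_thin (p q : ℤ) : (thin S hS).invariant (.dolbeault p q) =
    if (p, q) ∈ S ∧ (p, q + 1) ∉ S ∧ (p, q - 1) ∉ S then 1 else 0 := by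
  refine (finrank_subquotient_thin p q _ _).trans (if_congr (and_congr_right fun hs => ?_) rfl rfl)
  exact and_congr (basisVec_mem_ker_delbar hs) (not_congr (basisVec_mem_range_delbar hs))

open Classical in
theorem invariant_varouchasA_thin (p q : ℤ) : (thin S hS).invariant (.varouchasA p q) =
    if (p, q) ∈ S ∧ (p - 1, q) ∈ S ∧ (p, q - 1) ∈ S then 1 else 0 := by
  refine (finrank_subquotient_thin p q _ _).trans (if_congr (and_congr_right fun hs => ?_) rfl rfl)
  exact (and_iff_left (basisVec_notMem_range_comp hs)).trans
    (and_congr (basisVec_mem_range_del hs) (basisVec_mem_range_delbar hs))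

open Classical in
theorem invariant_varouchasB_thin (p q : ℤ) : (thin S hS).invariant (.varouchasB p q) =
    if (p, q) ∈ S ∧ (p - 1, q) ∈ S ∧ (p, q + 1) ∉ S then 1 else 0 := by
  refine (finrank_subquotient_thin p q _ _).trans (if_congr (and_congr_right fun hs => ?_) rfl rfl)
  exact (and_iff_left (basisVec_notMem_range_comp hs)).trans
    (and_congr (basisVec_mem_range_del hs) (basisVec_mem_ker_delbar hs))

open Classical in
theorem invariant_varouchasD_thin (p q : ℤ) : (thin S hS).invariant (.varouchasD p q) =
    if (p, q) ∈ S ∧ (p + 1, q) ∉ S ∧ (p, q - 1) ∈ S then 1 else 0 := by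
  refine (finrank_subquotient_thin p q _ _).trans (if_congr (and_congr_right fun hs => ?_) rfl rfl)
  exact (and_iff_left (basisVec_notMem_range_comp hs)).trans
    (and_congr (basisVec_mem_ker_del hs) (basisVec_mem_range_delbar hs))

open Classical in
theorem invariant_aeppli_thin (p q : ℤ) : (thin S hS).invariant (.aeppli p q) =
    if (p, q) ∈ S ∧ (p - 1, q) ∉ S ∧ (p, q - 1) ∉ S then 1 else 0 := by
  refine (finrank_subquotient_thin p q _ _).trans (if_congr (and_congr_right fun hs => ?_) rfl rfl)
  change _ ∧ _ ∉ range (thin S hS).del ⊔ range (thin S hS).delbar ↔ _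
  rw [basisVec_mem_sup (p, q) basisVec_mem_range_del_of_coeff basisVec_mem_range_delbar_of_coeff hs,
    basisVec_mem_range_del hs, basisVec_mem_range_delbar hs, not_or]
  exact and_iff_right (mem_ker_comp_thin _)

open Classical in
theorem invariant_varouchasC_thin (p q : ℤ) : (thin S hS).invariant (.varouchasC p q) =
    if (p, q) ∈ S ∧ (p, q + 1) ∈ S ∧ (p - 1, q) ∉ S then 1 else 0 := by
  refine (finrank_subquotient_thin p q _ _).trans (if_congr (and_congr_right fun hs => ?_) rfl rfl)
  change _ ∧ _ ∉ ker (thin S hS).delbar ⊔ range (thin S hS).del ↔ _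
  rw [basisVec_mem_sup (p, q) basisVec_mem_ker_delbar_of_coeff basisVec_mem_range_del_of_coeff hs,
    basisVec_mem_range_del hs, basisVec_mem_ker_delbar hs, not_or, not_not]
  exact and_iff_right (mem_ker_comp_thin _)

open Classical in
theorem invariant_varouchasE_thin (p q : ℤ) : (thin S hS).invariant (.varouchasE p q) =
    if (p, q) ∈ S ∧ (p + 1, q) ∈ S ∧ (p, q - 1) ∉ S then 1 else 0 := by
  refine (finrank_subquotient_thin p q _ _).trans (if_congr (and_congr_right fun hs => ?_) rfl rfl)
  change _ ∧ _ ∉ ker (thin S hS).del ⊔ range (thin S hS).delbar ↔ _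
  rw [basisVec_mem_sup (p, q) basisVec_mem_ker_del_of_coeff basisVec_mem_range_delbar_of_coeff hs,
    basisVec_mem_ker_del hs, basisVec_mem_range_delbar hs, not_or, not_not]
  exact and_iff_right (mem_ker_comp_thin _)

open Classical in
theorem invariant_varouchasF_thin (p q : ℤ) : (thin S hS).invariant (.varouchasF p q) =
    if (p, q) ∈ S ∧ (p, q + 1) ∈ S ∧ (p + 1, q) ∈ S then 1 else 0 := by
  refine (finrank_subquotient_thin p q _ _).trans (if_congr (and_congr_right fun hs => ?_) rfl rfl)
  change _ ∧ _ ∉ ker (thin S hS).delbar ⊔ ker (thin S hS).del ↔ _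
  rw [basisVec_mem_sup (p, q) basisVec_mem_ker_delbar_of_coeff basisVec_mem_ker_del_of_coeff hs,
    basisVec_mem_ker_del hs, basisVec_mem_ker_delbar hs, not_or, not_not, not_not]
  exact and_iff_right (mem_ker_comp_thin _)

end bidegree

/-! ### Pages of the spectral sequences of thin complexes -/

section pages

variable {S : Set (ℤ × ℤ)} {hS : IsThin S}

/-- The condition that `d x` has total degree `k + 1` may be dropped, since it follows from `x`
having degree `k`. -/
theorem mem_pageCycles_thin {r l k : ℤ} {x : (thin S hS).carrier} :
    x ∈ (thin S hS).pageCycles (thin S hS).filtration r l k ↔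
      (∀ a b, coeff (a, b) x ≠ 0 → a + b = k ∧ l ≤ a) ∧
      ∀ a b, coeff (a, b) ((thin S hS).d x) ≠ 0 → l + r ≤ a := by
  rw [pageCycles, Submodule.mem_inf, Submodule.mem_comap, mem_filtration_thin, mem_filtration_thin]
  constructor
  · rintro ⟨h1, h2⟩
    exact ⟨fun a b h => h1 _ h, fun a b h => (h2 _ h).2⟩
  · rintro ⟨h1, h2⟩
    refine ⟨fun s => h1 s.1 s.2, fun ⟨a, b⟩ h => ⟨?_, h2 _ _ h⟩⟩
    by_contra h3
    rw [coeff_d] at h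
    have e1 : coeff (a - 1, b) x = 0 := by
      by_contra h4
      have := (h1 _ _ h4).1
      dsimp only at h3; omega
    have e2 : coeff (a, b - 1) x = 0 := by
      by_contra h4
      have := (h1 _ _ h4).1
      dsimp only at h3; omega
    rw [e1, e2, add_zero, ite_self] at h
    exact h rfl

/-- In total degree `p + q` the only bidegree with first degree `p` is `(p, q)`. A cycle without
that coordinate already lies one step deeper in the filtration, hence in the denominator of page
`r`. So each term `E_r^{p,q}` of a thin complex has dimension at most one, and is detected by the
coordinate at `(p, q)`. -/
theorem mem_pageCycles_succ {r p q : ℤ} {x : (thin S hS).carrier}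
    (hx : x ∈ (thin S hS).pageCycles (thin S hS).filtration r p (p + q))
    (h0 : coeff (p, q) x = 0) :
    x ∈ (thin S hS).pageCycles (thin S hS).filtration (r - 1) (p + 1) (p + q) := by
  rw [mem_pageCycles_thin] at hx ⊢
  refine ⟨fun a b h => ?_, fun a b h => ?_⟩
  · have := hx.1 a b h
    refine ⟨this.1, ?_⟩
    by_contra h'
    have e1 : a = p := by omega
    have e2 : b = q := by omega
    rw [e1, e2] at h
    exact h h0
  · have := hx.2 a b h; omega

theorem invariant_frolicher_eq_zero_of_cycles {r : ℕ} (hr : 1 ≤ r) {p q : ℤ}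
    (h : ∀ y ∈ (thin S hS).pageCycles (thin S hS).filtration r p (p + q), coeff (p, q) y = 0) :
    (thin S hS).invariant (.frolicher r hr p q) = 0 :=
  finrank_eq_zero_of_le fun x hx => Submodule.mem_sup_left (mem_pageCycles_succ hx (h x hx))

theorem d_mem_pageCycles {A : DoubleComplex} {F : ℤ → ℤ → Submodule ℂ A.carrier} {r l k : ℤ}
    {z : A.carrier} (hz : z ∈ A.pageCycles F (r - 1) (l - r + 1) (k - 1)) :
    A.d z ∈ A.pageCycles F r l k := by
  refine ⟨?_, ?_⟩
  · have h : A.d z ∈ F (l - r + 1 + (r - 1)) (k - 1 + 1) := hz.2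
    have e1 : l - r + 1 + (r - 1) = l := by omega
    rwa [e1, sub_add_cancel] at h
  · change A.d (A.d z) ∈ F (l + r) (k + 1)
    rw [A.d_d]; exact zero_mem _

/-- Subtracting a multiple of `d z` removes the coordinate of `x` at `(p, q)`, and what is left
falls into the deeper filtration step. -/
theorem mem_pageBoundaries_of_boundary {r p q : ℤ} {x z : (thin S hS).carrier}
    (hx : x ∈ (thin S hS).pageCycles (thin S hS).filtration r p (p + q))
    (hz : z ∈ (thin S hS).pageCycles (thin S hS).filtration (r - 1) (p - r + 1) (p + q - 1))
    (h : coeff (p, q) ((thin S hS).d z) ≠ 0) :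
    x ∈ (thin S hS).pageBoundaries (thin S hS).filtration r p (p + q) := by
  obtain ⟨c, hc⟩ : ∃ c : ℂ, coeff (p, q) (x - c • (thin S hS).d z) = 0 :=
    ⟨coeff (p, q) x / coeff (p, q) ((thin S hS).d z), by
      rw [map_sub, map_smul, smul_eq_mul, div_mul_cancel₀ _ h, sub_self]⟩
  have hw := mem_pageCycles_succ (sub_mem hx (Submodule.smul_mem _ c (d_mem_pageCycles hz))) hc
  have hd : c • (thin S hS).d z ∈ ((thin S hS).pageCycles (thin S hS).filtration (r - 1)
      (p - r + 1) (p + q - 1)).map (thin S hS).d :=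
    Submodule.smul_mem _ c (Submodule.mem_map_of_mem hz)
  have := Submodule.add_mem_sup hw hd
  rwa [sub_add_cancel] at this

theorem invariant_frolicher_eq_zero_of_boundary {r : ℕ} (hr : 1 ≤ r) {p q : ℤ}
    (z : (thin S hS).carrier) (hz : z ∈ (thin S hS).pageCycles (thin S hS).filtration (r - 1)
      (p - r + 1) (p + q - 1)) (h : coeff (p, q) ((thin S hS).d z) ≠ 0) :
    (thin S hS).invariant (.frolicher r hr p q) = 0 :=
  finrank_eq_zero_of_le fun _ hx => mem_pageBoundaries_of_boundary hx hz h

/-- The coordinate at `(p, q)` is a functional that vanishes on the denominator, by `h2` on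
boundaries and by filtration degree on the rest, but not on the cycle `y`. -/
theorem invariant_frolicher_eq_one {r : ℕ} (hr : 1 ≤ r) {p q : ℤ} (y : (thin S hS).carrier)
    (hy : y ∈ (thin S hS).pageCycles (thin S hS).filtration r p (p + q))
    (h1 : coeff (p, q) y ≠ 0)
    (h2 : ∀ z ∈ (thin S hS).pageCycles (thin S hS).filtration (r - 1) (p - r + 1) (p + q - 1),
      coeff (p, q) ((thin S hS).d z) = 0) :
    (thin S hS).invariant (.frolicher r hr p q) = 1 := by
  refine finrank_eq_one_of_generator y hy ?_ fun x hx => ?_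
  · intro h
    obtain ⟨a, ha, _, ⟨z, hz, rfl⟩, rfl⟩ := Submodule.mem_sup.1 h
    apply h1
    rw [map_add, h2 z hz, add_zero]
    by_contra h3
    have := ((mem_pageCycles_thin.1 ha).1 _ _ h3).2
    omega
  · refine ⟨coeff (p, q) x / coeff (p, q) y, Submodule.mem_sup_left (mem_pageCycles_succ
      (sub_mem hx (Submodule.smul_mem _ _ hy)) ?_)⟩
    rw [map_sub, map_smul, smul_eq_mul, div_mul_cancel₀ _ h1, sub_self]

theorem invariant_frolicher_of_notMem {r : ℕ} (hr : 1 ≤ r) {p q : ℤ} (h : (p, q) ∉ S) :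
    (thin S hS).invariant (.frolicher r hr p q) = 0 :=
  invariant_frolicher_eq_zero_of_cycles hr fun y _ => coeff_of_notMem h y

/-- A cycle `y` has `d y` in filtration degree at least `p + r > p`, so `d y` has no coordinate at
`(p, q + 1)`. That coordinate equals the one of `y` at `(p, q)`, because the other contribution
comes from column `p - 1`. A vertical arrow out of `(p, q)` thus kills the term from the first page
on. -/
theorem invariant_frolicher_of_succ_mem {r : ℕ} (hr : 1 ≤ r) {p q : ℤ} (h : (p, q + 1) ∈ S) :
    (thin S hS).invariant (.frolicher r hr p q) = 0 := by
  refine invariant_frolicher_eq_zero_of_cycles hr fun y hy => ?_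
  obtain ⟨h1, h2⟩ := mem_pageCycles_thin.1 hy
  have e1 : coeff (p, q + 1) ((thin S hS).d y) = 0 := by
    by_contra h3
    have := h2 _ _ h3
    omega
  have e2 : coeff (p - 1, q + 1) y = 0 := by
    by_contra h3
    have := h1 _ _ h3
    omega
  rwa [coeff_d, if_pos h, e2, zero_add, add_sub_cancel_right] at e1

/-- A vertical arrow into `(p, q)` also kills it. The basis vector below is a preimage lying in
column `p`, so its differential does not leave filtration degree `p`. -/
theorem invariant_frolicher_of_pred_mem {r : ℕ} (hr : 1 ≤ r) {p q : ℤ} (h : (p, q) ∈ S)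
    (h' : (p, q - 1) ∈ S) : (thin S hS).invariant (.frolicher r hr p q) = 0 := by
  classical
  refine invariant_frolicher_eq_zero_of_boundary hr (basisVec S hS (p, q - 1)) ?_ ?_
  · rw [mem_pageCycles_thin]
    refine ⟨fun a b hab => ?_, fun a b hab => ?_⟩
    · rw [coeff_basisVec] at hab
      have := (ite_ne_right_iff.1 hab).1.1
      rw [Prod.mk.injEq] at this
      omega
    · rw [coeff_d, coeff_basisVec, coeff_basisVec] at hab
      by_contra hlt
      rw [if_neg (c := (a - 1, b) = (p, q - 1) ∧ _), if_neg (c := (a, b - 1) = (p, q - 1) ∧ _)]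
        at hab
      · simp at hab
      · rw [Prod.mk.injEq]; omega
      · rw [Prod.mk.injEq]; omega
  · rw [coeff_d, if_pos h, coeff_basisVec, coeff_basisVec, if_neg, if_pos ⟨rfl, h'⟩, zero_add]
    · exact one_ne_zero
    · rw [Prod.mk.injEq]; omega

/-- Along an antidiagonal on which the coordinates of `d z` vanish, the vanishing of the coordinates
of `z` propagates to the right. -/
theorem coeff_eq_zero_of_coeff_d {z : (thin S hS).carrier} {a b : ℤ} (N : ℕ)
    (h0 : coeff (a, b) z = 0)
    (h : ∀ n : ℕ, n < N → (a + n + 1, b - n) ∈ S ∧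
      coeff (a + n + 1, b - n) ((thin S hS).d z) = 0) :
    ∀ n : ℕ, n ≤ N → coeff (a + n, b - n) z = 0 := by
  intro n
  induction n with
  | zero => intro _; simpa using h0
  | succ n ih =>
    intro hn
    obtain ⟨h1, h2⟩ := h n (by omega)
    rw [coeff_d, if_pos h1, add_sub_cancel_right, ih (by omega), zero_add] at h2
    have e1 : a + ((n + 1 : ℕ) : ℤ) = a + n + 1 := by push_cast; ring
    have e2 : b - ((n + 1 : ℕ) : ℤ) = b - n - 1 := by push_cast; ring
    rw [e1, e2]; exact h2

/-- Along an antidiagonal on which the coordinates of `d z` vanish, the vanishing of the coordinates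
of `z` propagates to the left. -/
theorem coeff_eq_zero_of_coeff_d' {z : (thin S hS).carrier} {a b : ℤ} (N : ℕ)
    (h0 : coeff (a, b) z = 0)
    (h : ∀ n : ℕ, n < N → (a - n, b + n + 1) ∈ S ∧
      coeff (a - n, b + n + 1) ((thin S hS).d z) = 0) :
    ∀ n : ℕ, n ≤ N → coeff (a - n, b + n) z = 0 := by
  intro n
  induction n with
  | zero => intro _; simpa using h0
  | succ n ih =>
    intro hn
    obtain ⟨h1, h2⟩ := h n (by omega)
    rw [coeff_d, if_pos h1, add_sub_cancel_right, ih (by omega), add_zero] at h2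
    have e1 : a - ((n + 1 : ℕ) : ℤ) = a - n - 1 := by push_cast; ring
    have e2 : b + ((n + 1 : ℕ) : ℤ) = b + n + 1 := by push_cast; ring
    rw [e1, e2]; exact h2

open Classical in
/-- In a finite thin set, there is an element whose coordinates in total degree `k` are alternating
signs. -/
theorem exists_alternating (hfin : S.Finite) (k : ℤ) : ∃ y : (thin S hS).carrier,
    ∀ a b, coeff (a, b) y = if (a, b) ∈ S ∧ a + b = k then (-1 : ℂ) ^ a else 0 := by
  obtain ⟨y, hy⟩ := exists_coeff_eq (hS := hS) hfin
    (fun s => if s.1 + s.2 = k then (-1 : ℂ) ^ s.1 else 0)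
  refine ⟨y, fun a b => ?_⟩
  rw [hy, ite_and]

-- The contributions of `(a - 1, b)` and `(a, b - 1)` have opposite signs and cancel, provided that
-- both or neither are present. So `d y` can be nonzero only where the staircase ends with a single
-- incoming arrow.
open Classical in
theorem coeff_d_alternating {k : ℤ} {y : (thin S hS).carrier}
    (hy : ∀ a b, coeff (a, b) y = if (a, b) ∈ S ∧ a + b = k then (-1 : ℂ) ^ a else 0) (a b : ℤ)
    (h : (a, b) ∈ S → a + b = k + 1 → ((a - 1, b) ∈ S ↔ (a, b - 1) ∈ S)) :
    coeff (a, b) ((thin S hS).d y) = 0 := by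
  rw [coeff_d, hy, hy]
  split_ifs with h0 h1 h2 h2
  · rw [zpow_sub_one₀ (by norm_num)]; ring
  · exact absurd ⟨(h h0 (by omega)).1 h1.1, by omega⟩ h2
  · exact absurd ⟨(h h0 (by omega)).2 h2.1, by omega⟩ h1
  · exact add_zero 0
  · rfl

theorem d_basisVec_eq_zero {p q : ℤ} (h1 : (p + 1, q) ∉ S) (h2 : (p, q + 1) ∉ S) :
    (thin S hS).d (basisVec S hS (p, q)) = 0 := by
  refine coeff_ext fun ⟨a, b⟩ => ?_
  rw [coeff_d, coeff_basisVec, coeff_basisVec, map_zero]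
  split_ifs with h3 h4 h5 h5
  · have := h4.1; have := h5.1
    rw [Prod.mk.injEq] at *; omega
  · have := h4.1
    rw [Prod.mk.injEq] at this
    obtain ⟨rfl, rfl⟩ := this
    rw [sub_add_cancel] at h1
    exact absurd h3 h1
  · have := h5.1
    rw [Prod.mk.injEq] at this
    obtain ⟨rfl, rfl⟩ := this
    rw [sub_add_cancel] at h2
    exact absurd h3 h2
  · exact add_zero 0
  · rfl

theorem basisVec_mem_pageCycles {p q : ℤ} (r : ℤ) (h1 : (p + 1, q) ∉ S) (h2 : (p, q + 1) ∉ S) :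
    basisVec S hS (p, q) ∈ (thin S hS).pageCycles (thin S hS).filtration r p (p + q) := by
  classical
  rw [mem_pageCycles_thin, d_basisVec_eq_zero h1 h2]
  refine ⟨fun a b hab => ?_, fun a b hab => absurd (map_zero _) hab⟩
  rw [coeff_basisVec] at hab
  have := (ite_ne_right_iff.1 hab).1.1
  rw [Prod.mk.injEq] at this
  omega

end pages

/-! ### Odd zigzags -/

theorem mem_oddSupport {k p q a b : ℤ} : (a, b) ∈ oddSupport k p q ↔
    (p + q < k ∧ ((a + b = k ∧ p ≤ a ∧ q ≤ b) ∨ (a + b = k + 1 ∧ p < a ∧ q < b))) ∨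
       (k ≤ p + q ∧ ((a + b = k ∧ a ≤ p ∧ b ≤ q) ∨ (a + b = k - 1 ∧ a < p ∧ b < q))) :=
  Iff.rfl

/-- The odd zigzag as a thin complex. -/
noncomputable abbrev oddThin (k p q : ℤ) : DoubleComplex :=
  thin (oddSupport k p q) (isThin_oddSupport k p q)

/-- On the lower degree of a zigzag looking up, `d` is injective even after forgetting the target in
column `p`, the bottom right end. This one fact gives injectivity of `d` in degree `k - 1` and shows
that the end vector is not a boundary. The dot is the case without lower degree. -/
theorem coeff_eq_zero_of_lookingUp {k p q : ℤ} (h : k ≤ p + q) (z : (oddThin k p q).carrier)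
    (hz : ∀ a b, coeff (a, b) ((oddThin k p q).d z) ≠ 0 → p ≤ a) {a b : ℤ} (hab : a + b = k - 1) :
    coeff (a, b) z = 0 := by
  -- The walk starts at `(k - q - 1, q)`, just outside the staircase on the upper left, and goes
  -- right. It crosses the `p + q - k` bidegrees of degree `k` in columns smaller than `p`.
  have key := coeff_eq_zero_of_coeff_d (a := k - q - 1) (b := q) (z := z) (p + q - k).toNat
    (coeff_of_notMem (by rw [mem_oddSupport]; omega) z) (by
      intro n hn
      refine ⟨by rw [mem_oddSupport]; omega, ?_⟩
      by_contra h'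
      have := hz _ _ h'
      omega)
  by_cases hm : (a, b) ∈ oddSupport k p q
  · have hm' := mem_oddSupport.1 hm
    have := key (a - (k - q - 1)).toNat (by omega)
    rw [Int.toNat_of_nonneg (by omega)] at this
    have e1 : k - q - 1 + (a - (k - q - 1)) = a := by ring
    have e2 : q - (a - (k - q - 1)) = b := by omega
    rwa [e1, e2] at this
  · exact coeff_of_notMem hm z

theorem coeff_d_eq_zero_of_lookingUp {k p q : ℤ} (h : k ≤ p + q) (z : (oddThin k p q).carrier)
    (hz : ∀ a b, coeff (a, b) ((oddThin k p q).d z) ≠ 0 → p ≤ a) {a b : ℤ} (hab : a + b = k) :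
    coeff (a, b) ((oddThin k p q).d z) = 0 := by
  refine (coeff_d a b z).trans ?_
  rw [coeff_eq_zero_of_lookingUp h z hz (by omega), coeff_eq_zero_of_lookingUp h z hz (by omega),
    add_zero, ite_self]

/-- Vertical arrows pair off all bidegrees of the zigzag but one, the one in column `P` and degree
`k`. It carries a class on every page: the alternating closed sum when looking down, the basis
vector of the end when looking up. The answer does not depend on `r`, which later lets odd zigzags
cancel between pages. -/
theorem invariant_frolicher_odd (k P Q : ℤ) {r : ℕ} (hr : 1 ≤ r) (p q : ℤ) :
    (oddZigzag k P Q).invariant (.frolicher r hr p q) = if p + q = k ∧ p = P then 1 else 0 := by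
  classical
  split_ifs with h
  · obtain ⟨hk, rfl⟩ := h
    by_cases hd : p + Q < k
    · obtain ⟨y, hy⟩ := exists_alternating (hS := isThin_oddSupport k p Q)
        (finite_oddSupport k p Q) k
      refine invariant_frolicher_eq_one hr y ?_ ?_ ?_
      · rw [mem_pageCycles_thin]
        refine ⟨fun a b hab => ?_, fun a b hab => ?_⟩
        · rw [hy] at hab
          have := (ite_ne_right_iff.1 hab).1
          rw [mem_oddSupport] at this
          omega
        · refine absurd (coeff_d_alternating hy a b ?_) hab
          simp only [mem_oddSupport]
          omega
      · rw [hy, if_pos]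
        · exact zpow_ne_zero _ (by norm_num)
        · rw [mem_oddSupport]; omega
      · intro z _
        rw [coeff_d, coeff_of_notMem, coeff_of_notMem, add_zero, ite_self] <;>
        · rw [mem_oddSupport]; omega
    · refine invariant_frolicher_eq_one hr (basisVec _ _ (p, q))
        (basisVec_mem_pageCycles _ ?_ ?_) ?_ ?_
      · rw [mem_oddSupport]; omega
      · rw [mem_oddSupport]; omega
      · rw [coeff_basisVec, if_pos]
        · exact one_ne_zero
        · refine ⟨rfl, ?_⟩
          rw [mem_oddSupport]; omega
      · intro z hz
        refine coeff_d_eq_zero_of_lookingUp (by omega) z (fun a b hab => ?_) hk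
        have := (mem_pageCycles_thin.1 hz).2 a b hab
        omega
  · by_cases h1 : (p, q) ∈ oddSupport k P Q
    · by_cases h2 : (p, q + 1) ∈ oddSupport k P Q
      · exact invariant_frolicher_of_succ_mem hr h2
      · refine invariant_frolicher_of_pred_mem hr h1 ?_
        rw [mem_oddSupport] at h1 h2 ⊢
        rcases h1 with ⟨h0, h1 | h1⟩ | ⟨h0, h1 | h1⟩
        · left; omega
        · left; omega
        · right; omega
        · exact absurd (Or.inr ⟨h0, Or.inl (by omega)⟩) h2
    · exact invariant_frolicher_of_notMem hr h1

/-- A closed element of degree `k` is determined by its leftmost coordinate, hence is a multiple of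
the alternating sum, and nothing lies in degree `k - 1`. In degree `k + 1` every basis vector is
exact. -/
theorem invariant_deRham_lookingDown {k p q : ℤ} (h : p + q < k) (j : ℤ) :
    (oddThin k p q).invariant (.deRham j) = if j = k then 1 else 0 := by
  classical
  split_ifs with hj
  · subst hj
    obtain ⟨y, hy⟩ := exists_alternating (hS := isThin_oddSupport j p q)
      (finite_oddSupport j p q) j
    have hy0 : coeff (p, j - p) y ≠ 0 := by
      rw [hy, if_pos]
      · exact zpow_ne_zero _ (by norm_num)
      · rw [mem_oddSupport]; omega
    have hdy : (oddThin j p q).d y = 0 := by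
      refine coeff_ext fun ⟨a, b⟩ => (coeff_d_alternating hy a b ?_).trans (map_zero _).symm
      simp only [mem_oddSupport]
      omega
    have hyt : y ∈ (oddThin j p q).tot j := mem_tot_thin.2 fun ⟨a, b⟩ hab => by
      rw [hy] at hab
      exact (ite_ne_right_iff.1 hab).1.2
    refine finrank_eq_one_of_generator y ⟨hyt, hdy⟩ ?_ ?_
    · rintro ⟨z, hz, rfl⟩
      apply hy0
      have hz0 : z = 0 := coeff_ext fun ⟨a, b⟩ => by
        rw [map_zero]
        by_contra hab
        have := mem_tot_thin.1 hz _ hab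
        have := mem_oddSupport.1 (mem_of_coeff_ne_zero hab)
        dsimp only at *; omega
      rw [hz0, map_zero, map_zero]
    · rintro x ⟨hxt, hx⟩
      have hx : (oddThin j p q).d x = 0 := hx
      let c : ℂ := coeff (p, j - p) x / coeff (p, j - p) y
      refine ⟨c, ?_⟩
      have hw : (oddThin j p q).d (x - c • y) = 0 := by
        rw [map_sub, map_smul, hx, hdy, smul_zero, sub_zero]
      have h0 : coeff (p, j - p) (x - c • y) = 0 := by
        rw [map_sub, map_smul, smul_eq_mul, div_mul_cancel₀ _ hy0, sub_self]
      have hwt : x - c • y ∈ (oddThin j p q).tot j := sub_mem hxt (Submodule.smul_mem _ _ hyt)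
      have hw0 : x - c • y = 0 := coeff_ext fun ⟨a, b⟩ => by
        rw [map_zero]
        by_contra hab
        have e := mem_tot_thin.1 hwt _ hab
        dsimp only at e
        have hm := mem_oddSupport.1 (mem_of_coeff_ne_zero hab)
        have key := coeff_eq_zero_of_coeff_d (a := p) (b := j - p) (z := x - c • y)
          (j - q - p).toNat h0 (fun n hn => ⟨by rw [mem_oddSupport]; omega,
            (congrArg (coeff _) hw).trans (map_zero _)⟩) (a - p).toNat (by omega)
        rw [Int.toNat_of_nonneg (by omega)] at key
        have e1 : p + (a - p) = a := by ring
        have e2 : j - p - (a - p) = b := by omega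
        rw [e1, e2] at key
        exact hab key
      rw [hw0]; exact zero_mem _
  · refine finrank_eq_zero_of_le fun x hx => mem_of_basisVec_mem fun ⟨a, b⟩ hab => ?_
    have e : a + b = j := mem_tot_thin.1 hx.1 _ hab
    have hm := mem_oddSupport.1 (mem_of_coeff_ne_zero hab)
    -- Induction from the lower right. For `n = 0` the bidegree lies outside the support, so the
    -- vector is zero. Each vector of degree `k` maps to the sum of two neighbours, so exactness
    -- passes from one to the next.
    have key : ∀ n : ℕ, basisVec _ (isThin_oddSupport k p q) (k - q + 1 - n, q + n) ∈
        ((oddThin k p q).tot (j - 1)).map (oddThin k p q).d := by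
      intro n
      induction n with
      | zero =>
        rw [basisVec_of_notMem]
        · exact zero_mem _
        · rw [mem_oddSupport]; push_cast; omega
      | succ n ih =>
        by_cases hn : (k - q - n, q + n + 1) ∈ oddSupport k p q
        · rw [mem_oddSupport] at hn
          have hn' : (k - q - n, q + n) ∈ oddSupport k p q := by
            rw [mem_oddSupport]; omega
          have e := d_basisVec (hS := isThin_oddSupport k p q) hn'
          have ht : basisVec _ (isThin_oddSupport k p q) (k - q - n, q + n) ∈
              (oddThin k p q).tot (j - 1) :=
            mem_tot_thin.2 fun s hs => by
              rw [eq_of_coeff_basisVec_ne_zero hs]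
              dsimp only; omega
          have e1 : k - q + 1 - ((n + 1 : ℕ) : ℤ) = k - q - n := by push_cast; ring
          have e2 : q + ((n + 1 : ℕ) : ℤ) = q + n + 1 := by push_cast; ring
          have e3 : k - q - (n : ℤ) + 1 = k - q + 1 - n := by ring
          rw [e1, e2, ← sub_eq_of_eq_add' e, e3]
          exact sub_mem ⟨_, ht, rfl⟩ ih
        · have e1 : k - q + 1 - ((n + 1 : ℕ) : ℤ) = k - q - n := by push_cast; ring
          have e2 : q + ((n + 1 : ℕ) : ℤ) = q + n + 1 := by push_cast; ring
          rw [e1, e2, basisVec_of_notMem hn]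
          exact zero_mem _
    have := key (b - q).toNat
    rw [Int.toNat_of_nonneg (by omega)] at this
    have e1 : k - q + 1 - (b - q) = a := by omega
    have e2 : q + (b - q) = b := by ring
    rwa [e1, e2] at this

/-- Modulo boundaries, neighbouring basis vectors of degree `k` are negatives of each other, so all
are multiples of the bottom right one, which is itself not exact. In degree `k - 1` the differential
is injective. -/
theorem invariant_deRham_lookingUp {k p q : ℤ} (h : k ≤ p + q) (j : ℤ) :
    (oddThin k p q).invariant (.deRham j) = if j = k then 1 else 0 := by
  classical
  split_ifs with hj
  · subst hj
    let y : (oddThin j p q).carrier := basisVec _ (isThin_oddSupport j p q) (p, j - p)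
    have hm : (p, j - p) ∈ oddSupport j p q := by rw [mem_oddSupport]; omega
    have hdy : (oddThin j p q).d y = 0 := by
      refine d_basisVec_eq_zero ?_ ?_ <;>
      · rw [mem_oddSupport]; omega
    have hyt : y ∈ (oddThin j p q).tot j := mem_tot_thin.2 fun s hs => by
      rw [eq_of_coeff_basisVec_ne_zero hs]
      dsimp only; omega
    refine finrank_eq_one_of_generator y ⟨hyt, hdy⟩ ?_ ?_
    · rintro ⟨z, -, hz⟩
      have e : coeff (p, j - p) ((oddThin j p q).d z) = 0 := by
        -- If `d z = y`, then `d z` is supported in column `p`, which is exactly the hypothesis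
        -- forcing its degree `j` coordinates to vanish.
        refine coeff_d_eq_zero_of_lookingUp h z (fun a b hab => ?_) (by omega)
        have hab : coeff (a, b) ((oddThin j p q).d z) ≠ 0 := hab
        rw [hz] at hab
        have := eq_of_coeff_basisVec_ne_zero hab
        rw [Prod.mk.injEq] at this
        omega
      rw [hz, coeff_basisVec, if_pos ⟨rfl, hm⟩] at e
      exact one_ne_zero e
    · rintro x ⟨hxt, -⟩
      let D : Submodule ℂ (oddThin j p q).carrier :=
        ((oddThin j p q).tot (j - 1)).map (oddThin j p q).d ⊔ ℂ ∙ y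
      have key : ∀ n : ℕ, basisVec _ (isThin_oddSupport j p q) (p - n, j - p + n) ∈ D := by
        intro n
        induction n with
        | zero =>
          have : y ∈ D := Submodule.mem_sup_right (Submodule.mem_span_singleton_self y)
          simpa using this
        | succ n ih =>
          have e1 : p - ((n + 1 : ℕ) : ℤ) = p - n - 1 := by push_cast; ring
          have e2 : j - p + ((n + 1 : ℕ) : ℤ) = j - p + n + 1 := by push_cast; ring
          rw [e1, e2]
          by_cases hn : (p - n - 1, j - p + n + 1) ∈ oddSupport j p q
          · rw [mem_oddSupport] at hn
            have hn' : (p - n - 1, j - p + n) ∈ oddSupport j p q := by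
              rw [mem_oddSupport]; omega
            have e := d_basisVec (hS := isThin_oddSupport j p q) hn'
            have ht : basisVec _ (isThin_oddSupport j p q) (p - n - 1, j - p + n) ∈
                (oddThin j p q).tot (j - 1) := mem_tot_thin.2 fun s hs => by
              rw [eq_of_coeff_basisVec_ne_zero hs]
              dsimp only; omega
            rw [← sub_eq_of_eq_add' e, sub_add_cancel]
            exact sub_mem (Submodule.mem_sup_left ⟨_, ht, rfl⟩) ih
          · rw [basisVec_of_notMem hn]
            exact zero_mem _
      have hx : x ∈ D := mem_of_basisVec_mem fun ⟨a, b⟩ hab => by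
        have e : a + b = j := mem_tot_thin.1 hxt _ hab
        have hm := mem_oddSupport.1 (mem_of_coeff_ne_zero hab)
        have := key (p - a).toNat
        rw [Int.toNat_of_nonneg (by omega)] at this
        have e1 : p - (p - a) = a := by ring
        have e2 : j - p + (p - a) = b := by omega
        rwa [e1, e2] at this
      obtain ⟨u, hu, v, hv, rfl⟩ := Submodule.mem_sup.1 hx
      obtain ⟨c, rfl⟩ := Submodule.mem_span_singleton.1 hv
      exact ⟨c, by rw [add_sub_cancel_right]; exact hu⟩
  · refine finrank_eq_zero_of_le fun x hx => ?_
    have hx0 : x = 0 := coeff_ext fun ⟨a, b⟩ => by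
      rw [map_zero]
      by_contra hab
      have e : a + b = j := mem_tot_thin.1 hx.1 _ hab
      have hm := mem_oddSupport.1 (mem_of_coeff_ne_zero hab)
      refine hab (coeff_eq_zero_of_lookingUp h x (fun c d hcd => ?_) (by omega))
      exact absurd ((congrArg (coeff (c, d)) hx.2).trans (map_zero _)) hcd
    rw [hx0]; exact zero_mem _

theorem invariant_deRham_odd (k p q j : ℤ) :
    (oddZigzag k p q).invariant (.deRham j) = if j = k then 1 else 0 := by
  by_cases h : p + q < k
  · exact invariant_deRham_lookingDown h j
  · exact invariant_deRham_lookingUp (by omega) j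

/-! ### Even zigzags -/

theorem mem_horizontalSupport {p q a b : ℤ} {l : ℕ} : (a, b) ∈ horizontalSupport p q l ↔
    (a + b = p + q ∧ p ≤ a ∧ a < p + l) ∨ (a + b = p + q + 1 ∧ p < a ∧ a ≤ p + l) := by
  constructor
  · rintro ⟨i, h0, h1, h | h⟩ <;>
    · rw [Prod.mk.injEq] at h
      omega
  · rintro (h | h)
    · exact ⟨a - p, by omega, by omega, Or.inl (by rw [Prod.mk.injEq]; omega)⟩
    · exact ⟨a - p - 1, by omega, by omega, Or.inr (by rw [Prod.mk.injEq]; omega)⟩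

theorem mem_verticalSupport {p q a b : ℤ} {l : ℕ} : (a, b) ∈ verticalSupport p q l ↔
    (a + b = p + q ∧ q ≤ b ∧ b < q + l) ∨ (a + b = p + q + 1 ∧ q < b ∧ b ≤ q + l) := by
  constructor
  · rintro ⟨i, h0, h1, h | h⟩ <;>
    · rw [Prod.mk.injEq] at h
      omega
  · rintro (h | h)
    · exact ⟨b - q, by omega, by omega, Or.inl (by rw [Prod.mk.injEq]; omega)⟩
    · exact ⟨b - q - 1, by omega, by omega, Or.inr (by rw [Prod.mk.injEq]; omega)⟩

theorem invariant_frolicher_vertical (P Q : ℤ) (l : ℕ) {r : ℕ} (hr : 1 ≤ r) (p q : ℤ) :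
    (verticalZigzag P Q l).invariant (.frolicher r hr p q) = 0 := by
  by_cases h1 : (p, q) ∈ verticalSupport P Q l
  · by_cases h2 : (p, q + 1) ∈ verticalSupport P Q l
    · exact invariant_frolicher_of_succ_mem hr h2
    · refine invariant_frolicher_of_pred_mem hr h1 ?_
      rw [mem_verticalSupport] at h1 h2 ⊢
      omega
  · exact invariant_frolicher_of_notMem hr h1

/-- Only the two ends have no vertical partner. They lie `l` columns apart, and the differential of
page `l` matches them: the alternating sum `y` starts in column `P`, and `d y` is supported at the
far end, in column `P + l`. Both ends therefore live on pages `1, …, l` and vanish afterwards. -/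
theorem invariant_frolicher_horizontal (P Q : ℤ) {l : ℕ} (hl : 1 ≤ l) {r : ℕ} (hr : 1 ≤ r)
    (p q : ℤ) : (horizontalZigzag P Q l).invariant (.frolicher r hr p q) =
      if r ≤ l ∧ ((p = P ∧ q = Q) ∨ (p = P + l ∧ q = Q - l + 1)) then 1 else 0 := by
  classical
  obtain ⟨y, hy⟩ := exists_alternating (hS := isThin_horizontalSupport P Q l)
    (finite_horizontalSupport P Q l) (P + Q)
  have hy1 : ∀ a b, coeff (a, b) y ≠ 0 → a + b = P + Q ∧ P ≤ a := by
    intro a b hab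
    rw [hy] at hab
    have := (ite_ne_right_iff.1 hab).1
    rw [mem_horizontalSupport] at this
    omega
  have hy2 : ∀ a b, coeff (a, b) ((horizontalZigzag P Q l).d y) ≠ 0 → P + l ≤ a := by
    intro a b hab
    by_contra hlt
    refine absurd (coeff_d_alternating hy a b ?_) hab
    simp only [mem_horizontalSupport]
    omega
  by_cases h1 : p = P ∧ q = Q
  · obtain ⟨rfl, rfl⟩ := h1
    by_cases hrl : r ≤ l
    · rw [if_pos ⟨hrl, Or.inl ⟨rfl, rfl⟩⟩]
      refine invariant_frolicher_eq_one hr y ?_ ?_ ?_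
      · rw [mem_pageCycles_thin]
        refine ⟨hy1, fun a b hab => ?_⟩
        have := hy2 a b hab
        omega
      · rw [hy, if_pos]
        · exact zpow_ne_zero _ (by norm_num)
        · rw [mem_horizontalSupport]; omega
      · intro z _
        rw [coeff_d, coeff_of_notMem, coeff_of_notMem, add_zero, ite_self] <;>
        · rw [mem_horizontalSupport]; omega
    · rw [if_neg (fun h => hrl h.1)]
      refine invariant_frolicher_eq_zero_of_cycles hr fun x hx => ?_
      -- Since `r > l`, all coordinates of `d x` in columns up to `p + l` vanish. Starting from `(p
      -- + l, q - l)`, just outside the support, this propagates zero leftwards to `(p, q)`.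
      have key := coeff_eq_zero_of_coeff_d' (a := p + l) (b := q - l) (z := x) l
        (coeff_of_notMem (by rw [mem_horizontalSupport]; omega) x) (by
          intro n hn
          refine ⟨by rw [mem_horizontalSupport]; omega, ?_⟩
          by_contra h'
          have := (mem_pageCycles_thin.1 hx).2 _ _ h'
          omega) l le_rfl
      simpa using key
  by_cases h2 : p = P + l ∧ q = Q - l + 1
  · obtain ⟨rfl, rfl⟩ := h2
    by_cases hrl : r ≤ l
    · rw [if_pos ⟨hrl, Or.inr ⟨rfl, rfl⟩⟩]
      refine invariant_frolicher_eq_one hr (basisVec _ _ (P + l, Q - l + 1))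
        (basisVec_mem_pageCycles _ ?_ ?_) ?_ ?_
      · rw [mem_horizontalSupport]; omega
      · rw [mem_horizontalSupport]; omega
      · rw [coeff_basisVec, if_pos]
        · exact one_ne_zero
        · refine ⟨rfl, ?_⟩
          rw [mem_horizontalSupport]; omega
      · intro z hz
        obtain ⟨hz1, hz2⟩ := mem_pageCycles_thin.1 hz
        have h0 : coeff (P, Q) z = 0 := by
          by_contra h'
          have := hz1 _ _ h'
          omega
        -- As `r ≤ l`, `z` starts to the right of column `P`, which gives `h0`. Its differential is
        -- only allowed from column `P + l` on, so the `l - 1` intermediate coordinates of `d z`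
        -- vanish and carry zero up to the last arrow.
        have key := coeff_eq_zero_of_coeff_d (a := P) (b := Q) (z := z) (l - 1) h0 (by
          intro n hn
          refine ⟨by rw [mem_horizontalSupport]; omega, ?_⟩
          by_contra h'
          have := hz2 _ _ h'
          omega) (l - 1) le_rfl
        have e1 : P + ((l - 1 : ℕ) : ℤ) = P + l - 1 := by omega
        have e2 : Q - ((l - 1 : ℕ) : ℤ) = Q - l + 1 := by omega
        rw [e1, e2] at key
        rw [coeff_d, key, coeff_of_notMem, add_zero, ite_self]
        rw [mem_horizontalSupport]; omega
    · rw [if_neg (fun h => hrl h.1)]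
      -- For `r > l` the start `P + l - r + 1` of the allowed filtration is at most `P`, so `y`
      -- qualifies as a preimage.
      refine invariant_frolicher_eq_zero_of_boundary hr y ?_ ?_
      · rw [mem_pageCycles_thin]
        refine ⟨fun a b hab => ?_, fun a b hab => ?_⟩
        · have := hy1 a b hab
          omega
        · have := hy2 a b hab
          omega
      · rw [coeff_d, if_pos, hy, hy, if_pos, if_neg, add_zero]
        · exact zpow_ne_zero _ (by norm_num)
        · rw [mem_horizontalSupport]; omega
        · rw [mem_horizontalSupport]; omega
        · rw [mem_horizontalSupport]; omega
  rw [if_neg (by omega)]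
  by_cases h3 : (p, q) ∈ horizontalSupport P Q l
  · by_cases h4 : (p, q + 1) ∈ horizontalSupport P Q l
    · exact invariant_frolicher_of_succ_mem hr h4
    · refine invariant_frolicher_of_pred_mem hr h3 ?_
      rw [mem_horizontalSupport] at h3 h4 ⊢
      omega
  · exact invariant_frolicher_of_notMem hr h3

/-! ### Exchanging the two gradings -/

/-- Stated for linear equivalences and not for `Iso`, because the exchange of the two gradings does
not preserve bidegrees. -/
theorem finrank_subquotient_congr {X Y : Type} [AddCommGroup X] [Module ℂ X] [AddCommGroup Y]
    [Module ℂ Y] (e : X ≃ₗ[ℂ] Y) {N D : Submodule ℂ X} {N' D' : Submodule ℂ Y}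
    (hN : N.map e.toLinearMap = N') (hD : D.map e.toLinearMap = D') :
    Module.finrank ℂ (N ⧸ D.submoduleOf N) = Module.finrank ℂ (N' ⧸ D'.submoduleOf N') := by
  subst hD
  refine LinearEquiv.finrank_eq (Submodule.Quotient.equiv _ _ (e.ofSubmodules _ _ hN) ?_)
  ext y
  constructor
  · rintro ⟨x, hx, rfl⟩
    exact ⟨x, hx, rfl⟩
  · rintro ⟨x, hx, hxy⟩
    refine ⟨(e.ofSubmodules _ _ hN).symm y, ?_, by simp⟩
    have : (((e.ofSubmodules _ _ hN).symm y : N) : X) = x := by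
      apply e.injective
      rw [LinearEquiv.ofSubmodules_symm_apply, LinearEquiv.apply_symm_apply]
      exact hxy.symm
    change (((e.ofSubmodules _ _ hN).symm y : N) : X) ∈ D
    rw [this]; exact hx

theorem map_pageCycles {A B : DoubleComplex} (e : A.carrier ≃ₗ[ℂ] B.carrier)
    (he : ∀ x, e (A.d x) = B.d (e x)) {F : ℤ → ℤ → Submodule ℂ A.carrier}
    {G : ℤ → ℤ → Submodule ℂ B.carrier} (h : ∀ l k x, e x ∈ G l k ↔ x ∈ F l k) (r l k : ℤ) :
    (A.pageCycles F r l k).map e.toLinearMap = B.pageCycles G r l k := by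
  ext y
  constructor
  · rintro ⟨x, ⟨h1, h2⟩, rfl⟩
    refine ⟨(h _ _ _).2 h1, ?_⟩
    change B.d (e x) ∈ G (l + r) (k + 1)
    rw [← he]; exact (h _ _ _).2 h2
  · rintro ⟨h1, h2⟩
    refine ⟨e.symm y, ⟨(h _ _ _).1 ?_, (h _ _ _).1 ?_⟩, e.apply_symm_apply y⟩
    · rw [e.apply_symm_apply]; exact h1
    · rw [he, e.apply_symm_apply]; exact h2

theorem map_pageBoundaries {A B : DoubleComplex} (e : A.carrier ≃ₗ[ℂ] B.carrier)
    (he : ∀ x, e (A.d x) = B.d (e x)) {F : ℤ → ℤ → Submodule ℂ A.carrier}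
    {G : ℤ → ℤ → Submodule ℂ B.carrier} (h : ∀ l k x, e x ∈ G l k ↔ x ∈ F l k) (r l k : ℤ) :
    (A.pageBoundaries F r l k).map e.toLinearMap = B.pageBoundaries G r l k := by
  have hc : e.toLinearMap ∘ₗ A.d = B.d ∘ₗ e.toLinearMap := LinearMap.ext he
  rw [pageBoundaries, Submodule.map_sup, map_pageCycles e he h, ← Submodule.map_comp, hc,
    Submodule.map_comp, map_pageCycles e he h, pageBoundaries]

/-- The linear equivalence between the thin complexes of a set and of its mirror image. -/
noncomputable def swapEquiv {S T : Set (ℤ × ℤ)} (hS : IsThin S) (hT : IsThin T)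
    (h : ∀ s : ℤ × ℤ, s ∈ S ↔ Equiv.prodComm ℤ ℤ s ∈ T) :
    (thin S hS).carrier ≃ₗ[ℂ] (thin T hT).carrier :=
  toFinsupp S hS ≪≫ₗ Finsupp.domLCongr ((Equiv.prodComm ℤ ℤ).subtypeEquiv h) ≪≫ₗ
    (toFinsupp T hT).symm

theorem coeff_swapEquiv {S T : Set (ℤ × ℤ)} (hS : IsThin S) (hT : IsThin T)
    (h : ∀ s : ℤ × ℤ, s ∈ S ↔ Equiv.prodComm ℤ ℤ s ∈ T) (x : (thin S hS).carrier) (a b : ℤ) :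
    coeff (a, b) (swapEquiv hS hT h x) = coeff (b, a) x := by
  by_cases hab : (a, b) ∈ T
  · rw [coeff_mk hab, coeff_mk ((h (b, a)).2 hab)]
    simp only [swapEquiv, LinearEquiv.trans_apply, LinearEquiv.apply_symm_apply]
    rfl
  · rw [coeff_of_notMem hab, coeff_of_notMem (fun h' => hab ((h (b, a)).1 h'))]

/-- Reflection in the diagonal commutes with `d` without any sign, because all arrows of a thin
complex are the identity. It exchanges the column and row filtrations. -/
theorem invariant_conjFrolicher_thin {S T : Set (ℤ × ℤ)} (hS : IsThin S) (hT : IsThin T)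
    (h : ∀ s : ℤ × ℤ, s ∈ S ↔ Equiv.prodComm ℤ ℤ s ∈ T) {r : ℕ} (hr : 1 ≤ r) (p q : ℤ) :
    (thin S hS).invariant (.conjFrolicher r hr p q) =
      (thin T hT).invariant (.frolicher r hr q p) := by
  let e := swapEquiv hS hT h
  have he : ∀ x, e ((thin S hS).d x) = (thin T hT).d (e x) := by
    intro x
    refine coeff_ext fun ⟨a, b⟩ => ?_
    rw [coeff_swapEquiv, coeff_d, coeff_d, coeff_swapEquiv, coeff_swapEquiv, add_comm]
    classical exact if_congr (h (b, a)) rfl rfl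
  have hF : ∀ l k x, e x ∈ (thin T hT).filtration l k ↔ x ∈ (thin S hS).conjFiltration l k := by
    intro l k x
    rw [mem_filtration_thin, mem_conjFiltration_thin]
    constructor
    · rintro hx ⟨a, b⟩ hab
      have := hx (b, a) (by rw [coeff_swapEquiv]; exact hab)
      dsimp only at *; omega
    · rintro hx ⟨a, b⟩ hab
      rw [coeff_swapEquiv] at hab
      have := hx (b, a) hab
      dsimp only at *; omega
  refine finrank_subquotient_congr e ?_ ?_
  · refine (map_pageCycles e he hF r q (p + q)).trans ?_
    rw [add_comm]; rfl
  · refine (map_pageBoundaries e he hF r q (p + q)).trans ?_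
    rw [add_comm]; rfl

theorem invariant_conjFrolicher_odd (k P Q : ℤ) {r : ℕ} (hr : 1 ≤ r) (p q : ℤ) :
    (oddZigzag k P Q).invariant (.conjFrolicher r hr p q) =
      if p + q = k ∧ q = Q then 1 else 0 := by
  refine (invariant_conjFrolicher_thin _ (isThin_oddSupport k Q P) ?_ hr p q).trans
    ((invariant_frolicher_odd k Q P hr q p).trans ?_)
  · rintro ⟨a, b⟩
    rw [Equiv.prodComm_apply, Prod.swap, mem_oddSupport, mem_oddSupport]
    omega
  · rw [add_comm]

theorem invariant_conjFrolicher_horizontal (P Q : ℤ) (l : ℕ) {r : ℕ} (hr : 1 ≤ r) (p q : ℤ) :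
    (horizontalZigzag P Q l).invariant (.conjFrolicher r hr p q) = 0 := by
  refine (invariant_conjFrolicher_thin _ (isThin_verticalSupport Q P l) ?_ hr p q).trans
    (invariant_frolicher_vertical Q P l hr q p)
  rintro ⟨a, b⟩
  rw [Equiv.prodComm_apply, Prod.swap, mem_horizontalSupport, mem_verticalSupport]
  omega

theorem invariant_conjFrolicher_vertical (P Q : ℤ) {l : ℕ} (hl : 1 ≤ l) {r : ℕ} (hr : 1 ≤ r)
    (p q : ℤ) : (verticalZigzag P Q l).invariant (.conjFrolicher r hr p q) =
      if r ≤ l ∧ ((q = Q ∧ p = P) ∨ (q = Q + l ∧ p = P - l + 1)) then 1 else 0 := by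
  refine (invariant_conjFrolicher_thin _ (isThin_horizontalSupport Q P l) ?_ hr p q).trans
    (invariant_frolicher_horizontal Q P hl hr q p)
  rintro ⟨a, b⟩
  rw [Equiv.prodComm_apply, Prod.swap, mem_horizontalSupport, mem_verticalSupport]
  omega

/-! ### Generation by zigzags -/

open Classical in
/-- A direct sum splits along a partition of its index set. -/
theorem nonempty_iso_directSum_split {κ α β : Type} (F : κ → DoubleComplex) (i : α → κ)
    (j : β → κ) (hi : Function.Injective i) (hj : Function.Injective j) (hij : ∀ a b, i a ≠ j b)
    (hc : ∀ k, (∃ a, i a = k) ∨ ∃ b, j b = k) :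
    Nonempty (Iso (directSum F)
      ((directSum fun a => F (i a)).sum (directSum fun b => F (j b)))) := by
  let φ : (Π₀ k, (F k).carrier) →ₗ[ℂ] (Π₀ a, (F (i a)).carrier) × (Π₀ b, (F (j b)).carrier) :=
    { toFun := fun x => (DFinsupp.comapDomain i hi x, DFinsupp.comapDomain j hj x)
      map_add' := fun x y => by simp
      map_smul' := fun c x => by simp }
  have h1 : ∀ x a, (φ x).1 a = x (i a) := fun x a => rfl
  have h2 : ∀ x b, (φ x).2 b = x (j b) := fun x b => rfl
  have hφ : Function.Bijective φ := by
    constructor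
    · intro x y hxy
      ext k
      rcases hc k with ⟨a, rfl⟩ | ⟨b, rfl⟩
      · rw [← h1, ← h1, hxy]
      · rw [← h2, ← h2, hxy]
    · rw [← LinearMap.range_eq_top, eq_top_iff]
      rintro ⟨a, b⟩ -
      have ha : (a, 0) ∈ LinearMap.range φ := by
        induction a using DFinsupp.induction with
        | h0 => exact zero_mem _
        | ha s v f _ _ ih =>
          have : (DFinsupp.single s v, 0) ∈ LinearMap.range φ := by
            refine ⟨DFinsupp.single (i s) v, Prod.ext (DFinsupp.comapDomain_single
              (β := fun k => (F k).carrier) i hi s v) ?_⟩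
            refine DFinsupp.ext fun b => ?_
            rw [h2, DFinsupp.single_eq_of_ne (hij s b).symm]; rfl
          simpa using add_mem this ih
      have hb : (0, b) ∈ LinearMap.range φ := by
        induction b using DFinsupp.induction with
        | h0 => exact zero_mem _
        | ha s v f _ _ ih =>
          have : (0, DFinsupp.single s v) ∈ LinearMap.range φ := by
            refine ⟨DFinsupp.single (j s) v, Prod.ext ?_ (DFinsupp.comapDomain_single
              (β := fun k => (F k).carrier) j hj s v)⟩
            refine DFinsupp.ext fun a => ?_
            rw [h1, DFinsupp.single_eq_of_ne (hij a s)]; rfl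
          simpa using add_mem this ih
      simpa using add_mem ha hb
  refine ⟨{ toEquiv := LinearEquiv.ofBijective φ hφ, mem_comp_iff := ?_, map_del := ?_,
            map_delbar := ?_ }⟩
  · intro p q x
    constructor
    · rintro ⟨ha, hb⟩ k
      rcases hc k with ⟨a, rfl⟩ | ⟨b, rfl⟩
      · exact ha a
      · exact hb b
    · exact fun h => ⟨fun a => h (i a), fun b => h (j b)⟩
  · intro x
    exact Prod.ext (DFinsupp.ext fun a => rfl) (DFinsupp.ext fun b => rfl)
  · intro x
    exact Prod.ext (DFinsupp.ext fun a => rfl) (DFinsupp.ext fun b => rfl)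

theorem IsBounded.of_injective {A B : DoubleComplex} (hB : B.IsBounded) (f : Hom A B)
    (hf : Function.Injective f.toLin) : A.IsBounded := by
  obtain ⟨N, hN⟩ := hB
  refine ⟨N, fun p q h => ?_⟩
  rw [eq_bot_iff]
  intro x hx
  have := f.map_comp p q x hx
  rw [hN p q h, Submodule.mem_bot] at this
  exact hf (this.trans (map_zero _).symm)

theorem isBounded_directSum {ι : Type} {F : ι → DoubleComplex} {N : ℤ}
    (h : ∀ i p q, N < |p| + |q| → (F i).comp p q = ⊥) : (directSum F).IsBounded := by
  refine ⟨N, fun p q hpq => ?_⟩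
  rw [eq_bot_iff]
  intro x hx
  refine DFinsupp.ext fun i => ?_
  have := hx i
  rwa [h i p q hpq] at this

theorem comp_eq_bot_of_directSum {ι : Type} {F : ι → DoubleComplex} {p q : ℤ}
    (h : (directSum F).comp p q = ⊥) (i : ι) : (F i).comp p q = ⊥ := by
  classical
  rw [eq_bot_iff]
  intro x hx
  have h1 := (directSumIncl F i).map_comp p q x hx
  rw [h, Submodule.mem_bot] at h1
  have h2 : (directSumProj F i).toLin ((directSumIncl F i).toLin x) = x :=
    DFinsupp.single_eq_same (β := fun i => (F i).carrier)
  rw [Submodule.mem_bot, ← h2, h1, map_zero]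

theorem isBounded_thin {S : Set (ℤ × ℤ)} (hS : IsThin S) (hfin : S.Finite) :
    (thin S hS).IsBounded := by
  obtain ⟨N, hN⟩ := (hfin.image fun s => |s.1| + |s.2|).bddAbove
  refine ⟨N, fun p q h => ?_⟩
  rw [eq_bot_iff]
  intro x hx
  refine (Submodule.mem_bot ℂ).2 (coeff_ext fun s => ?_)
  rw [map_zero]
  by_contra hs
  have hs' := mem_of_coeff_ne_zero hs
  rw [mem_comp_thin.1 hx s hs] at hs'
  have := hN ⟨_, hs', rfl⟩
  dsimp only at this
  omega

theorem reducedClass_eq_of_iso {A B : BoundedFin} (h : Nonempty (Iso A.1 B.1)) :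
    reducedClass A = reducedClass B := by
  have : (⟦A⟧ : IsoClass) = ⟦B⟧ := Quotient.sound h
  rw [reducedClass, reducedClass, formalClass, formalClass, this]

theorem reducedClass_eq_add {A B C : BoundedFin} (h : Nonempty (Iso C.1 (A.1.sum B.1))) :
    reducedClass C = reducedClass A + reducedClass B := by
  have : formalClass C = formalClass A + formalClass B := by
    rw [← sub_eq_zero]
    exact (QuotientAddGroup.eq_zero_iff _).2 (AddSubgroup.subset_closure ⟨A, B, C, h, rfl⟩)
  rw [reducedClass, this]; rfl

/-- The Eilenberg swindle: a bounded direct sum of squares has class zero. -/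
theorem reducedClass_eq_zero_of_squares (A : BoundedFin) {ι : Type} (s : ι → Shape)
    (e : Nonempty (Iso A.1 (directSum fun i => (s i).complex)))
    (hs : ∀ i, ¬ (s i).IsZigzag) : reducedClass A = 0 := by
  obtain ⟨e⟩ := e
  obtain ⟨N, hN⟩ := A.2.1
  -- One bound `N` valid for all summands: boundedness of the infinite sum `B` below needs this
  -- uniformity.
  have hb : ∀ i p q, N < |p| + |q| → (s i).complex.comp p q = ⊥ := by
    intro i p q hpq
    refine comp_eq_bot_of_directSum (F := fun i => (s i).complex) ?_ i
    rw [eq_bot_iff]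
    intro x hx
    have := e.symm.toHom.map_comp p q x hx
    rw [hN p q hpq, Submodule.mem_bot] at this
    exact e.symm.toEquiv.injective (this.trans (map_zero _).symm)
  let B : BoundedFin := ⟨directSum fun x : ι × ℕ => (s x.1).complex,
    isBounded_directSum fun x => hb x.1, ι × ℕ, fun x => s x.1, ⟨Iso.refl _⟩, by
      simp [hs]⟩
  let A' : BoundedFin := ⟨directSum fun i => (s i).complex, isBounded_directSum hb,
    ι, s, ⟨Iso.refl _⟩, by simp [hs]⟩
  -- `B` is a countable sum of copies of `A'`. Splitting off copy `0` and shifting the others gives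
  -- `B ≅ A' ⊕ B`, so `[A'] = 0`.
  have h := reducedClass_eq_add (A := A') (B := B) (C := B)
    (nonempty_iso_directSum_split (fun x : ι × ℕ => (s x.1).complex) (fun i : ι => (i, 0))
      (fun x : ι × ℕ => (x.1, x.2 + 1)) (fun a b h => (Prod.mk.inj h).1)
      (fun a b h => by
        simp only [Prod.mk.injEq, add_left_inj] at h
        exact Prod.ext h.1 h.2)
      (fun a b h => by simp [Prod.ext_iff] at h)
      (fun ⟨i, n⟩ => by
        cases n with
        | zero => exact Or.inl ⟨i, rfl⟩
        | succ n => exact Or.inr ⟨(i, n), rfl⟩))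
  rw [reducedClass_eq_of_iso (B := A') ⟨e⟩]
  exact left_eq_add.1 ((add_comm _ _).trans h.symm).symm

/-- Induction on the number of zigzag summands, not of all summands, since there may be infinitely
many squares. When no zigzag is left, the swindle applies. -/
theorem reducedClass_mem_of_zigzags (R : AddSubgroup ReducedGroup)
    (hR : ∀ (t : Shape) (h : t.complex.IsBounded ∧ t.complex.HasFinitelyManyZigzags),
      t.IsZigzag → reducedClass ⟨t.complex, h⟩ ∈ R) (A : BoundedFin) : reducedClass A ∈ R := by
  obtain ⟨ι, s, e, hfin⟩ := A.2.2
  induction hn : {i | (s i).IsZigzag}.ncard generalizing A ι with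
  | zero =>
    rw [Set.ncard_eq_zero hfin] at hn
    rw [reducedClass_eq_zero_of_squares A s e fun i hi => Set.notMem_empty i (hn ▸ hi)]
    exact zero_mem _
  | succ n ih =>
    obtain ⟨i, hi⟩ : {i | (s i).IsZigzag}.Nonempty := by
      rw [← Set.ncard_pos hfin]; omega
    obtain ⟨f⟩ := nonempty_iso_directSum_split (fun i => (s i).complex) (fun _ : Unit => i)
      (fun j : {j // j ≠ i} => (j : ι)) (fun _ _ _ => rfl) Subtype.val_injective
      (fun _ b => b.2.symm) (fun k => by
        by_cases h : k = i
        · exact Or.inl ⟨(), h.symm⟩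
        · exact Or.inr ⟨⟨k, h⟩, rfl⟩)
    obtain ⟨e⟩ := e
    have g := e.trans f
    have hb : (((directSum fun _ : Unit => (s i).complex)).sum
        (directSum fun j : {j // j ≠ i} => (s j).complex)).IsBounded :=
      A.2.1.of_injective g.symm.toHom g.symm.toEquiv.injective
    have hfin' : {j : {j // j ≠ i} | (s j).IsZigzag}.Finite :=
      hfin.preimage Subtype.val_injective.injOn
    let B : BoundedFin := ⟨directSum fun _ : Unit => (s i).complex,
      hb.of_injective (sumInl _ _) LinearMap.inl_injective,
      Unit, fun _ => s i, ⟨Iso.refl _⟩, Set.toFinite _⟩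
    let C : BoundedFin := ⟨directSum fun j : {j // j ≠ i} => (s j).complex,
      hb.of_injective (sumInr _ _) LinearMap.inr_injective, _, _, ⟨Iso.refl _⟩, hfin'⟩
    have h0 := isoDirectSumUnit (s i).complex
    let B' : BoundedFin := ⟨(s i).complex, B.2.1.of_injective h0.toHom h0.toEquiv.injective,
      Unit, fun _ => s i, ⟨h0⟩, Set.toFinite _⟩
    rw [reducedClass_eq_add (A := B) (B := C) (C := A) ⟨g⟩,
      ← reducedClass_eq_of_iso (A := B') (B := B) ⟨h0⟩]
    refine add_mem (hR _ _ hi) (ih C _ _ ⟨Iso.refl _⟩ hfin' ?_)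
    have e1 : Subtype.val '' {j : {j // j ≠ i} | (s j).IsZigzag} = {i | (s i).IsZigzag} \ {i} := by
      ext k
      simp only [Set.mem_image, Set.mem_ofPred_eq, Subtype.exists, exists_and_left, exists_prop,
        exists_eq_right_right, Set.mem_sdiff, Set.mem_singleton_iff]
    rw [← Set.ncard_image_of_injective _ Subtype.val_injective, e1,
      Set.ncard_sdiff_singleton_of_mem hi, hn, Nat.add_sub_cancel]

theorem eq_top_of_zigzags (R : AddSubgroup ReducedGroup)
    (hR : ∀ (t : Shape) (h : t.complex.IsBounded ∧ t.complex.HasFinitelyManyZigzags),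
      t.IsZigzag → reducedClass ⟨t.complex, h⟩ ∈ R) (x : ReducedGroup) : x ∈ R := by
  obtain ⟨y, rfl⟩ := QuotientAddGroup.mk_surjective x
  obtain ⟨f, rfl⟩ := QuotientAddGroup.mk_surjective y
  induction f using FreeAbelianGroup.induction_on with
  | zero => exact zero_mem _
  | of c =>
    induction c using Quotient.inductionOn with
    | h A => exact reducedClass_mem_of_zigzags R hR A
  | neg c ih => exact neg_mem ih
  | add f g hf hg => exact add_mem hf hg

/-- The class of the horizontal even zigzag of length `2 * (m + 1)`. -/
noncomputable def horizontalClass (p q : ℤ) (m : ℕ) : ReducedGroup :=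
  reducedClass ⟨horizontalZigzag p q (m + 1),
    isBounded_thin _ (finite_horizontalSupport p q (m + 1)), Unit,
    fun _ => .horizontal p q (m + 1) (Nat.le_add_left 1 m), ⟨isoDirectSumUnit _⟩, Set.toFinite _⟩

/-- The class of the vertical even zigzag of length `2 * (m + 1)`. -/
noncomputable def verticalClass (p q : ℤ) (m : ℕ) : ReducedGroup :=
  reducedClass ⟨verticalZigzag p q (m + 1),
    isBounded_thin _ (finite_verticalSupport p q (m + 1)), Unit,
    fun _ => .vertical p q (m + 1) (Nat.le_add_left 1 m), ⟨isoDirectSumUnit _⟩, Set.toFinite _⟩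

/-- Every element of the reduced group is an integral combination of classes of zigzags. -/
theorem exists_zigzag_combination (x : ReducedGroup) :
    ∃ (u : ℤ × ℤ × ℤ →₀ ℤ) (v w : ℤ × ℤ × ℕ →₀ ℤ),
      x = u.sum (fun t n => n • oddClass t.1 t.2.1 t.2.2) +
        v.sum (fun t n => n • horizontalClass t.1 t.2.1 t.2.2) +
        w.sum (fun t n => n • verticalClass t.1 t.2.1 t.2.2) := by
  let f := Finsupp.linearCombination ℤ fun t : ℤ × ℤ × ℤ => oddClass t.1 t.2.1 t.2.2
  let g := Finsupp.linearCombination ℤ fun t : ℤ × ℤ × ℕ => horizontalClass t.1 t.2.1 t.2.2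
  let h := Finsupp.linearCombination ℤ fun t : ℤ × ℤ × ℕ => verticalClass t.1 t.2.1 t.2.2
  have key := eq_top_of_zigzags
    (f.toAddMonoidHom.range ⊔ g.toAddMonoidHom.range ⊔ h.toAddMonoidHom.range) (by
      intro t ht hz
      cases t with
      | square p q => exact absurd hz id
      | odd k p q =>
        refine AddSubgroup.mem_sup_left (AddSubgroup.mem_sup_left ⟨Finsupp.single (k, p, q) 1, ?_⟩)
        exact (Finsupp.linearCombination_single ℤ _ _).trans (one_smul _ _)
      | horizontal p q l hl =>
        obtain ⟨m, rfl⟩ : ∃ m, l = m + 1 := ⟨l - 1, by omega⟩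
        refine AddSubgroup.mem_sup_left (AddSubgroup.mem_sup_right ⟨Finsupp.single (p, q, m) 1, ?_⟩)
        exact (Finsupp.linearCombination_single ℤ _ _).trans (one_smul _ _)
      | vertical p q l hl =>
        obtain ⟨m, rfl⟩ : ∃ m, l = m + 1 := ⟨l - 1, by omega⟩
        refine AddSubgroup.mem_sup_right ⟨Finsupp.single (p, q, m) 1, ?_⟩
        exact (Finsupp.linearCombination_single ℤ _ _).trans (one_smul _ _)) x
  obtain ⟨_, hy, _, ⟨w, rfl⟩, rfl⟩ := AddSubgroup.mem_sup.1 key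
  obtain ⟨_, ⟨u, rfl⟩, _, ⟨v, rfl⟩, rfl⟩ := AddSubgroup.mem_sup.1 hy
  exact ⟨u, v, w, rfl⟩

/-! ### Pairings with the invariants -/

theorem chi_sum_apply {T : Type} (u : T →₀ ℤ) (A : T → BoundedFin) (i : Inv) :
    chi (u.sum fun t n => n • reducedClass (A t)) i =
      u.sum fun t n => n * ((A t).1.invariant i : ℤ) := by
  let φ : ReducedGroup →+ ℤ := (Pi.evalAddMonoidHom (fun _ : Inv => ℤ) i).comp chi
  change φ _ = _
  rw [map_finsuppSum]
  refine Finsupp.sum_congr fun t _ => ?_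
  rw [map_zsmul, smul_eq_mul]
  rfl

theorem sum_mul_sub {T : Type} (u : T →₀ ℤ) (F G : T → ℤ) :
    (u.sum fun t n => n * (F t - G t)) =
      (u.sum fun t n => n * F t) - u.sum fun t n => n * G t := by
  simp only [mul_sub, Finsupp.sum_sub]

theorem sum_mul_indicator_eq {T : Type} [DecidableEq T] (u : T →₀ ℤ) (t₀ : T) :
    (u.sum fun t n => n * if t = t₀ then 1 else 0) = u t₀ := by
  simp only [mul_ite, mul_one, mul_zero]
  exact Finsupp.sum_ite_self_eq' u t₀

/-! ### The combinations of odd zigzags given by fillings -/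

/-- A function that is the sum of a function of the column and a function of the row is orthogonal
to all fillings. -/
theorem IsFilling.sum_mul_eq_zero {S : Set (ℤ × ℤ)} {v : ℤ × ℤ →₀ ℤ} (hv : IsFilling S v)
    {F : ℤ → ℤ → ℤ} (f g : ℤ → ℤ) (h : ∀ p q, (p, q) ∈ S → F p q = f p + g q) :
    (v.sum fun x n => n * F x.1 x.2) = 0 := by
  have e : (v.sum fun x n => n * F x.1 x.2) =
      -- The support is enlarged to a rectangle so that the sum can be iterated in either order and
      -- complete rows and columns appear.
      ∑ x ∈ v.support.image Prod.fst ×ˢ v.support.image Prod.snd, v x * (f x.1 + g x.2) := by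
    rw [Finsupp.sum]
    refine (Finset.sum_congr rfl fun x hx => ?_).trans
      (Finset.sum_subset (fun x hx => Finset.mem_product.2 ⟨Finset.mem_image_of_mem _ hx,
        Finset.mem_image_of_mem _ hx⟩) fun x _ hx => ?_)
    · rw [h x.1 x.2 (hv.support_subset x.1 x.2 (Finsupp.mem_support_iff.1 hx))]
    · rw [Finsupp.notMem_support_iff.1 hx, zero_mul]
  rw [e]
  simp only [mul_add]
  rw [Finset.sum_add_distrib, Finset.sum_product, Finset.sum_product_right]
  have h1 : ∀ p, ∑ q ∈ v.support.image Prod.snd, v (p, q) = 0 := fun p => by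
    rw [← hv.column_sum p, finsum_eq_sum_of_support_subset]
    intro q hq
    exact Finset.mem_coe.2 (Finset.mem_image.2 ⟨(p, q), Finsupp.mem_support_iff.2 hq, rfl⟩)
  have h2 : ∀ q, ∑ p ∈ v.support.image Prod.fst, v (p, q) = 0 := fun q => by
    rw [← hv.row_sum q, finsum_eq_sum_of_support_subset]
    intro p hp
    exact Finset.mem_coe.2 (Finset.mem_image.2 ⟨(p, q), Finsupp.mem_support_iff.2 hp, rfl⟩)
  simp only [← Finset.sum_mul, h1, h2, zero_mul, Finset.sum_const_zero, add_zero]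

/-- The opposite quadrant `p < a`, `q < b` would give `p + q ≤ a + b - 2 ≤ k`, so it misses the
region. Hence the half-plane `a ≤ p` is the disjoint union of the quadrant and the half-plane `q <
b`, and the indicator is a difference. The side condition `C` records the total degree in which an
invariant is nonzero. -/
theorem exists_split_of_le (k a b : ℤ) (C : Prop) [Decidable C] (hC : C → a + b ≤ k + 2) :
    ∃ f g : ℤ → ℤ, ∀ p q, k < p + q →
      (if C ∧ a ≤ p ∧ b ≤ q then (1 : ℤ) else 0) = f p + g q := by
  refine ⟨fun p => if C ∧ a ≤ p then 1 else 0, fun q => if C ∧ q < b then -1 else 0,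
    fun p q h => ?_⟩
  by_cases hc : C
  · have := hC hc
    simp only [hc, true_and]
    split_ifs <;> omega
  · simp [hc]

theorem exists_split_of_ge (k a b : ℤ) (C : Prop) [Decidable C] (hC : C → k - 2 ≤ a + b) :
    ∃ f g : ℤ → ℤ, ∀ p q, p + q < k →
      (if C ∧ p ≤ a ∧ q ≤ b then (1 : ℤ) else 0) = f p + g q := by
  refine ⟨fun p => if C ∧ p ≤ a then 1 else 0, fun q => if C ∧ b < q then -1 else 0,
    fun p q h => ?_⟩
  by_cases hc : C
  · have := hC hc
    simp only [hc, true_and]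
    split_ifs <;> omega
  · simp [hc]

/-! ### Invariants of odd zigzags split into a column part and a row part -/

theorem cast_eq_ite {n : ℕ} {C D : Prop} [Decidable C] [Decidable D] (h : n = if C then 1 else 0)
    (hCD : C ↔ D) : (n : ℤ) = if D then 1 else 0 := by
  rw [h, Nat.cast_ite, Nat.cast_one, Nat.cast_zero]
  exact if_congr hCD rfl rfl

theorem mem_oddSupport_of_lt {k p q a b : ℤ} (h : k < p + q) : (a, b) ∈ oddSupport k p q ↔
    (a + b = k ∧ a ≤ p ∧ b ≤ q) ∨ (a + b = k - 1 ∧ a < p ∧ b < q) := by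
  rw [mem_oddSupport]; omega

theorem mem_oddSupport_of_gt {k p q a b : ℤ} (h : p + q < k) : (a, b) ∈ oddSupport k p q ↔
    (a + b = k ∧ p ≤ a ∧ q ≤ b) ∨ (a + b = k + 1 ∧ p < a ∧ q < b) := by
  rw [mem_oddSupport]; omega

theorem exists_split_invariant_of_lt (k : ℤ) (i : Inv) : ∃ f g : ℤ → ℤ, ∀ p q, k < p + q →
    ((oddZigzag k p q).invariant i : ℤ) = f p + g q := by
  classical
  -- Most cases only require naming the corner of a quadrant. The bound `k + 2` is attained for
  -- Varouchas A, with corner `(a + 1, b + 1)` and `a + b = k`.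
  have quad : ∀ (a b : ℤ) (C : Prop) [Decidable C], (C → a + b ≤ k + 2) →
      (∀ p q, k < p + q → ((oddZigzag k p q).invariant i : ℤ) =
        if C ∧ a ≤ p ∧ b ≤ q then 1 else 0) → ∃ f g : ℤ → ℤ, ∀ p q, k < p + q →
      ((oddZigzag k p q).invariant i : ℤ) = f p + g q := by
    intro a b C _ hC h
    obtain ⟨f, g, hfg⟩ := exists_split_of_le k a b C hC
    exact ⟨f, g, fun p q hpq => (h p q hpq).trans (hfg p q hpq)⟩
  cases i with
  | deRham j =>
    exact ⟨fun _ => if j = k then 1 else 0, fun _ => 0, fun p q _ => by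
      rw [add_zero]; exact cast_eq_ite (invariant_deRham_odd k p q j) Iff.rfl⟩
  | bottChern a b =>
    refine quad a b (a + b = k) (by omega) fun p q h =>
      cast_eq_ite (invariant_bottChern_thin a b) ?_
    simp only [mem_oddSupport_of_lt h]; omega
  | aeppli a b =>
    refine quad (a + 1) (b + 1) (a + b = k - 1) (by omega) fun p q h =>
      cast_eq_ite (invariant_aeppli_thin a b) ?_
    simp only [mem_oddSupport_of_lt h]; omega
  | dolbeault a b =>
    refine ⟨fun p => if a + b = k ∧ a = p then 1 else 0, fun _ => 0, fun p q h => ?_⟩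
    rw [add_zero]
    refine cast_eq_ite (invariant_dolbeault_thin a b) ?_
    simp only [mem_oddSupport_of_lt h]; omega
  | varouchasA a b =>
    refine quad (a + 1) (b + 1) (a + b = k) (by omega) fun p q h =>
      cast_eq_ite (invariant_varouchasA_thin a b) ?_
    simp only [mem_oddSupport_of_lt h]; omega
  | varouchasB a b =>
    refine quad a (b + 1) (a + b = k) (by omega) fun p q h =>
      cast_eq_ite (invariant_varouchasB_thin a b) ?_
    simp only [mem_oddSupport_of_lt h]; omega
  | varouchasC a b =>
    refine quad (a + 1) (b + 1) (a + b = k - 1) (by omega) fun p q h =>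
      cast_eq_ite (invariant_varouchasC_thin a b) ?_
    simp only [mem_oddSupport_of_lt h]; omega
  | varouchasD a b =>
    refine quad (a + 1) b (a + b = k) (by omega) fun p q h =>
      cast_eq_ite (invariant_varouchasD_thin a b) ?_
    simp only [mem_oddSupport_of_lt h]; omega
  | varouchasE a b =>
    refine quad (a + 1) (b + 1) (a + b = k - 1) (by omega) fun p q h =>
      cast_eq_ite (invariant_varouchasE_thin a b) ?_
    simp only [mem_oddSupport_of_lt h]; omega
  | varouchasF a b =>
    refine quad (a + 1) (b + 1) (a + b = k - 1) (by omega) fun p q h =>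
      cast_eq_ite (invariant_varouchasF_thin a b) ?_
    simp only [mem_oddSupport_of_lt h]; omega
  | frolicher r hr a b =>
    exact ⟨fun p => if a + b = k ∧ a = p then 1 else 0, fun _ => 0, fun p q _ => by
      rw [add_zero]; exact cast_eq_ite (invariant_frolicher_odd k p q hr a b) Iff.rfl⟩
  | conjFrolicher r hr a b =>
    exact ⟨fun _ => 0, fun q => if a + b = k ∧ b = q then 1 else 0, fun p q _ => by
      rw [zero_add]; exact cast_eq_ite (invariant_conjFrolicher_odd k p q hr a b) Iff.rfl⟩

/-- The mirror image for zigzags looking down: the quadrants open towards the lower left, and their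
corners satisfy `k - 2 ≤ a + b`. -/
theorem exists_split_invariant_of_gt (k : ℤ) (i : Inv) : ∃ f g : ℤ → ℤ, ∀ p q, p + q < k →
    ((oddZigzag k p q).invariant i : ℤ) = f p + g q := by
  classical
  have quad : ∀ (a b : ℤ) (C : Prop) [Decidable C], (C → k - 2 ≤ a + b) →
      (∀ p q, p + q < k → ((oddZigzag k p q).invariant i : ℤ) =
        if C ∧ p ≤ a ∧ q ≤ b then 1 else 0) → ∃ f g : ℤ → ℤ, ∀ p q, p + q < k →
      ((oddZigzag k p q).invariant i : ℤ) = f p + g q := by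
    intro a b C _ hC h
    obtain ⟨f, g, hfg⟩ := exists_split_of_ge k a b C hC
    exact ⟨f, g, fun p q hpq => (h p q hpq).trans (hfg p q hpq)⟩
  cases i with
  | deRham j =>
    exact ⟨fun _ => if j = k then 1 else 0, fun _ => 0, fun p q _ => by
      rw [add_zero]; exact cast_eq_ite (invariant_deRham_odd k p q j) Iff.rfl⟩
  | bottChern a b =>
    refine quad (a - 1) (b - 1) (a + b = k + 1) (by omega) fun p q h =>
      cast_eq_ite (invariant_bottChern_thin a b) ?_
    simp only [mem_oddSupport_of_gt h]; omega
  | aeppli a b =>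
    refine quad a b (a + b = k) (by omega) fun p q h => cast_eq_ite (invariant_aeppli_thin a b) ?_
    simp only [mem_oddSupport_of_gt h]; omega
  | dolbeault a b =>
    refine ⟨fun p => if a + b = k ∧ a = p then 1 else 0, fun _ => 0, fun p q h => ?_⟩
    rw [add_zero]
    refine cast_eq_ite (invariant_dolbeault_thin a b) ?_
    simp only [mem_oddSupport_of_gt h]; omega
  | varouchasA a b =>
    refine quad (a - 1) (b - 1) (a + b = k + 1) (by omega) fun p q h =>
      cast_eq_ite (invariant_varouchasA_thin a b) ?_
    simp only [mem_oddSupport_of_gt h]; omega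
  | varouchasB a b =>
    refine quad (a - 1) (b - 1) (a + b = k + 1) (by omega) fun p q h =>
      cast_eq_ite (invariant_varouchasB_thin a b) ?_
    simp only [mem_oddSupport_of_gt h]; omega
  | varouchasC a b =>
    refine quad (a - 1) b (a + b = k) (by omega) fun p q h =>
      cast_eq_ite (invariant_varouchasC_thin a b) ?_
    simp only [mem_oddSupport_of_gt h]; omega
  | varouchasD a b =>
    refine quad (a - 1) (b - 1) (a + b = k + 1) (by omega) fun p q h =>
      cast_eq_ite (invariant_varouchasD_thin a b) ?_
    simp only [mem_oddSupport_of_gt h]; omega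
  | varouchasE a b =>
    refine quad a (b - 1) (a + b = k) (by omega) fun p q h =>
      cast_eq_ite (invariant_varouchasE_thin a b) ?_
    simp only [mem_oddSupport_of_gt h]; omega
  | varouchasF a b =>
    refine quad (a - 1) (b - 1) (a + b = k) (by omega) fun p q h =>
      cast_eq_ite (invariant_varouchasF_thin a b) ?_
    simp only [mem_oddSupport_of_gt h]; omega
  | frolicher r hr a b =>
    exact ⟨fun p => if a + b = k ∧ a = p then 1 else 0, fun _ => 0, fun p q _ => by
      rw [add_zero]; exact cast_eq_ite (invariant_frolicher_odd k p q hr a b) Iff.rfl⟩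
  | conjFrolicher r hr a b =>
    exact ⟨fun _ => 0, fun q => if a + b = k ∧ b = q then 1 else 0, fun p q _ => by
      rw [zero_add]; exact cast_eq_ite (invariant_conjFrolicher_odd k p q hr a b) Iff.rfl⟩

theorem chi_fillingSum_eq_zero {k : ℤ} {S : Set (ℤ × ℤ)} {v : ℤ × ℤ →₀ ℤ} (hv : IsFilling S v)
    (h : ∀ i, ∃ f g : ℤ → ℤ, ∀ p q, (p, q) ∈ S →
      ((oddZigzag k p q).invariant i : ℤ) = f p + g q) : chi (fillingSum k v) = 0 := by
  funext i
  obtain ⟨f, g, hfg⟩ := h i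
  exact (chi_sum_apply v _ i).trans (hv.sum_mul_eq_zero f g hfg)

/-! ### The kernel of `χ` -/

/-- A finitely supported array in which every nonzero entry has a nonzero entry further to the left
is zero. -/
theorem eq_zero_of_shift {v : ℤ × ℤ × ℕ →₀ ℤ} (s : ℤ × ℤ × ℕ → ℤ × ℤ × ℕ) (c : ℤ × ℤ × ℕ → ℤ)
    (hs : ∀ t, c (s t) < c t) (h : ∀ t, v t + v (s t) = 0) : v = 0 := by
  by_contra hv
  obtain ⟨t, ht, hmin⟩ := Finset.exists_min_image v.support c (Finsupp.support_nonempty_iff.2 hv)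
  have h1 : v (s t) ≠ 0 := fun h0 => by
    have := h t
    rw [h0, add_zero] at this
    exact Finsupp.mem_support_iff.1 ht this
  have := hmin _ (Finsupp.mem_support_iff.2 h1)
  have := hs t
  omega

theorem sum_mul_indicator_or {T : Type} [DecidableEq T] (u : T →₀ ℤ) (t₁ t₂ : T)
    (F : T → ℤ) (hF : ∀ t, F t = (if t = t₁ then 1 else 0) - -(if t = t₂ then 1 else 0)) :
    (u.sum fun t n => n * F t) = u t₁ + u t₂ := by
  simp only [hF]
  rw [sum_mul_sub, sum_mul_indicator_eq]
  simp only [mul_neg]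
  rw [Finsupp.sum_neg, sum_mul_indicator_eq, sub_neg_eq_add]

/-- Translates a row or column sum of a filling, parametrised by `i`, into the pairing of `u` with
an indicator, which is the form in which the invariants deliver it. -/
theorem finsum_eq_sum_mul_indicator {T : Type} (u : T →₀ ℤ) {i : ℤ → T}
    (hi : Function.Injective i) (P : T → Prop) [DecidablePred P] (hP : ∀ t, P t → ∃ p, i p = t)
    (w : ℤ → ℤ) (hw : ∀ p, w p = if P (i p) then u (i p) else 0) :
    ∑ᶠ p, w p = u.sum fun t n => n * if P t then 1 else 0 := by
  have e : (u.sum fun t n => n * if P t then 1 else 0) = ∑ᶠ t, if P t then u t else 0 := by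
    rw [finsum_eq_sum_of_support_subset (s := u.support), Finsupp.sum]
    · simp
    · intro t ht
      rw [Function.mem_support, ite_ne_right_iff] at ht
      exact Finset.mem_coe.2 (Finsupp.mem_support_iff.2 ht.2)
  rw [e, funext hw, ← finsum_mem_range (f := fun t => if P t then u t else 0) hi]
  refine finsum_congr fun t => ?_
  by_cases ht : t ∈ Set.range i
  · simp [ht]
  · simp only [ht, finsum_false]
    exact (if_neg fun h => ht (hP t h)).symm

theorem fillingSum_add (k : ℤ) (f g : ℤ × ℤ →₀ ℤ) :
    fillingSum k (f + g) = fillingSum k f + fillingSum k g :=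
  Finsupp.sum_add_index' (fun _ => zero_zsmul _) fun _ _ _ => add_zsmul _ _ _

/-! ### Vanishing of the coefficients of even zigzags -/

theorem chi_combination_apply (u : ℤ × ℤ × ℤ →₀ ℤ) (v w : ℤ × ℤ × ℕ →₀ ℤ) (i : Inv) :
    chi (u.sum (fun t n => n • oddClass t.1 t.2.1 t.2.2) +
        v.sum (fun t n => n • horizontalClass t.1 t.2.1 t.2.2) +
        w.sum (fun t n => n • verticalClass t.1 t.2.1 t.2.2)) i =
      u.sum (fun t n => n * ((oddZigzag t.1 t.2.1 t.2.2).invariant i : ℤ)) +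
        v.sum (fun t n => n * ((horizontalZigzag t.1 t.2.1 (t.2.2 + 1)).invariant i : ℤ)) +
        w.sum (fun t n => n * ((verticalZigzag t.1 t.2.1 (t.2.2 + 1)).invariant i : ℤ)) := by
  rw [map_add, map_add, Pi.add_apply, Pi.add_apply]
  exact congrArg₂ _ (congrArg₂ _ (chi_sum_apply u _ i) (chi_sum_apply v _ i))
    (chi_sum_apply w _ i)

theorem horizontal_coefficients_eq_zero {u : ℤ × ℤ × ℤ →₀ ℤ} {v w : ℤ × ℤ × ℕ →₀ ℤ}
    (h : ∀ (r : ℕ) (hr : 1 ≤ r) (p q : ℤ),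
      u.sum (fun t n => n * ((oddZigzag t.1 t.2.1 t.2.2).invariant (.frolicher r hr p q) : ℤ)) +
        v.sum (fun t n => n *
          ((horizontalZigzag t.1 t.2.1 (t.2.2 + 1)).invariant (.frolicher r hr p q) : ℤ)) +
        w.sum (fun t n => n *
          ((verticalZigzag t.1 t.2.1 (t.2.2 + 1)).invariant (.frolicher r hr p q) : ℤ)) = 0) :
    v = 0 := by
  -- The shift sends the zigzag with left end `(p, q)` to the one of the same length whose right end
  -- is `(p, q)`. These are the two zigzags of that length seen by the spectral sequence at `(p,
  -- q)`.
  refine eq_zero_of_shift (fun t => (t.1 - t.2.2 - 1, t.2.1 + t.2.2, t.2.2)) (fun t => t.1)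
    (fun t => by dsimp only; omega) ?_
  rintro ⟨p, q, m⟩
  -- The zigzag with parameter `l` has length `2(l + 1)` and survives up to page `l + 1`.
  -- Subtracting page `m + 2` from page `m + 1` thus leaves only `l = m`. The odd terms are equal on
  -- both pages and cancel.
  have h1 := h (m + 1) (by omega) p q
  have h2 := h (m + 2) (by omega) p q
  simp only [invariant_frolicher_odd, invariant_frolicher_vertical,
    invariant_frolicher_horizontal _ _ (Nat.le_add_left 1 _)] at h1 h2
  have h3 := sub_eq_zero.2 (h1.trans h2.symm)
  rw [add_sub_add_right_eq_sub, add_sub_add_left_eq_sub, ← sum_mul_sub] at h3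
  rwa [sum_mul_indicator_or v (p, q, m) (p - m - 1, q + m, m)] at h3
  rintro ⟨P, Q, l⟩
  simp only [Prod.mk.injEq]
  push_cast
  split_ifs <;> omega

theorem vertical_coefficients_eq_zero {u : ℤ × ℤ × ℤ →₀ ℤ} {v w : ℤ × ℤ × ℕ →₀ ℤ}
    (h : ∀ (r : ℕ) (hr : 1 ≤ r) (p q : ℤ),
      u.sum (fun t n => n *
          ((oddZigzag t.1 t.2.1 t.2.2).invariant (.conjFrolicher r hr p q) : ℤ)) +
        v.sum (fun t n => n *
          ((horizontalZigzag t.1 t.2.1 (t.2.2 + 1)).invariant (.conjFrolicher r hr p q) : ℤ)) +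
        w.sum (fun t n => n *
          ((verticalZigzag t.1 t.2.1 (t.2.2 + 1)).invariant (.conjFrolicher r hr p q) : ℤ)) = 0) :
    w = 0 := by
  -- Same argument with the gradings exchanged: the shifted zigzag has its top end where the
  -- original has its bottom end.
  refine eq_zero_of_shift (fun t => (t.1 + t.2.2, t.2.1 - t.2.2 - 1, t.2.2)) (fun t => t.2.1)
    (fun t => by dsimp only; omega) ?_
  rintro ⟨p, q, m⟩
  have h1 := h (m + 1) (by omega) p q
  have h2 := h (m + 2) (by omega) p q
  simp only [invariant_conjFrolicher_odd, invariant_conjFrolicher_horizontal,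
    invariant_conjFrolicher_vertical _ _ (Nat.le_add_left 1 _)] at h1 h2
  have h3 := sub_eq_zero.2 (h1.trans h2.symm)
  rw [add_sub_add_left_eq_sub, ← sum_mul_sub] at h3
  rwa [sum_mul_indicator_or w (p, q, m) (p + m, q - m - 1, m)] at h3
  rintro ⟨P, Q, l⟩
  simp only [Prod.mk.injEq]
  push_cast
  split_ifs <;> omega

/-! ### Row and column sums recovered from the invariants of odd zigzags -/

theorem mem_oddSupport_of_eq {k p q a b : ℤ} (h : p + q = k) : (a, b) ∈ oddSupport k p q ↔
    a = p ∧ b = q := by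
  rw [mem_oddSupport]; omega

/-- Bott-Chern and Varouchas A, B, D share the second alternative: in the upper degree of a zigzag
looking down, each bidegree has two incoming and no outgoing arrows. They differ only in which ends
of a zigzag looking up they count: both ends and the dot for Bott-Chern, none for A, the bottom
right for B, the top left for D. Differences therefore detect single ends. -/
theorem invariant_bottChern_odd (k p q a b : ℤ) :
    ((oddZigzag k p q).invariant (.bottChern a b) : ℤ) =
      if (k = a + b ∧ a ≤ p ∧ b ≤ q) ∨ (k + 1 = a + b ∧ p < a ∧ q < b) then 1 else 0 := by
  classical
  refine cast_eq_ite (invariant_bottChern_thin a b) ?_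
  rcases lt_trichotomy (p + q) k with h | h | h
  · simp only [mem_oddSupport_of_gt h]; omega
  · simp only [mem_oddSupport_of_eq h]; omega
  · simp only [mem_oddSupport_of_lt h]; omega

theorem invariant_varouchasA_odd (k p q a b : ℤ) :
    ((oddZigzag k p q).invariant (.varouchasA a b) : ℤ) =
      if (k = a + b ∧ a < p ∧ b < q) ∨ (k + 1 = a + b ∧ p < a ∧ q < b) then 1 else 0 := by
  classical
  refine cast_eq_ite (invariant_varouchasA_thin a b) ?_
  rcases lt_trichotomy (p + q) k with h | h | h
  · simp only [mem_oddSupport_of_gt h]; omega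
  · simp only [mem_oddSupport_of_eq h]; omega
  · simp only [mem_oddSupport_of_lt h]; omega

theorem invariant_varouchasB_odd (k p q a b : ℤ) :
    ((oddZigzag k p q).invariant (.varouchasB a b) : ℤ) =
      if (k = a + b ∧ a ≤ p ∧ b < q) ∨ (k + 1 = a + b ∧ p < a ∧ q < b) then 1 else 0 := by
  classical
  refine cast_eq_ite (invariant_varouchasB_thin a b) ?_
  rcases lt_trichotomy (p + q) k with h | h | h
  · simp only [mem_oddSupport_of_gt h]; omega
  · simp only [mem_oddSupport_of_eq h]; omega
  · simp only [mem_oddSupport_of_lt h]; omega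

theorem invariant_varouchasD_odd (k p q a b : ℤ) :
    ((oddZigzag k p q).invariant (.varouchasD a b) : ℤ) =
      if (k = a + b ∧ a < p ∧ b ≤ q) ∨ (k + 1 = a + b ∧ p < a ∧ q < b) then 1 else 0 := by
  classical
  refine cast_eq_ite (invariant_varouchasD_thin a b) ?_
  rcases lt_trichotomy (p + q) k with h | h | h
  · simp only [mem_oddSupport_of_gt h]; omega
  · simp only [mem_oddSupport_of_eq h]; omega
  · simp only [mem_oddSupport_of_lt h]; omega

/-- If two functions are orthogonal to `u`, then so is their difference. -/
theorem sum_mul_eq_zero_of_sub {T : Type} {u : T →₀ ℤ} {F G H : T → ℤ}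
    (hF : (u.sum fun t n => n * F t) = 0) (hG : (u.sum fun t n => n * G t) = 0)
    (hH : ∀ t, H t = F t - G t) : (u.sum fun t n => n * H t) = 0 := by
  simp only [hH]
  rw [sum_mul_sub, hF, hG, sub_zero]

/-- The numerical invariants of a combination of odd zigzags vanish. -/
def IsNumericallyTrivial (u : ℤ × ℤ × ℤ →₀ ℤ) : Prop :=
  ∀ i, u.sum (fun t n => n * ((oddZigzag t.1 t.2.1 t.2.2).invariant i : ℤ)) = 0

namespace IsNumericallyTrivial

variable {u : ℤ × ℤ × ℤ →₀ ℤ}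

/-- B minus A counts the zigzags looking up with bottom right end `(a, b)`, that is, a whole column
of the upper region. -/
theorem column_above (h : IsNumericallyTrivial u) (a b : ℤ) :
    (u.sum fun t n => n * if t.1 = a + b ∧ t.2.1 = a ∧ b < t.2.2 then 1 else 0) = 0 := by
  refine sum_mul_eq_zero_of_sub (h (.varouchasB a b)) (h (.varouchasA a b)) fun t => ?_
  rw [invariant_varouchasA_odd, invariant_varouchasB_odd]
  split_ifs <;> omega

/-- D minus A counts the zigzags looking up with top left end `(a, b)`. -/
theorem row_above (h : IsNumericallyTrivial u) (a b : ℤ) :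
    (u.sum fun t n => n * if t.1 = a + b ∧ t.2.2 = b ∧ a < t.2.1 then 1 else 0) = 0 := by
  refine sum_mul_eq_zero_of_sub (h (.varouchasD a b)) (h (.varouchasA a b)) fun t => ?_
  rw [invariant_varouchasA_odd, invariant_varouchasD_odd]
  split_ifs <;> omega

/-- Bott-Chern minus B counts top left ends too, but includes the dot. Comparison with `row_above`
isolates the dot. -/
theorem row_above_dot (h : IsNumericallyTrivial u) (a b : ℤ) :
    (u.sum fun t n => n * if t.1 = a + b ∧ t.2.2 = b ∧ a ≤ t.2.1 then 1 else 0) = 0 := by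
  refine sum_mul_eq_zero_of_sub (h (.bottChern a b)) (h (.varouchasB a b)) fun t => ?_
  rw [invariant_bottChern_odd, invariant_varouchasB_odd]
  split_ifs <;> omega

theorem dot (h : IsNumericallyTrivial u) (a b : ℤ) :
    (u.sum fun t n => n * if t = (a + b, a, b) then 1 else 0) = 0 := by
  refine sum_mul_eq_zero_of_sub (h.row_above_dot a b) (h.row_above a b) fun t => ?_
  simp only [Prod.ext_iff]
  split_ifs <;> omega

theorem apply_dot (h : IsNumericallyTrivial u) (a b : ℤ) : u (a + b, a, b) = 0 := by
  rw [← sum_mul_indicator_eq u (a + b, a, b), h.dot a b]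

/-- The first Frölicher page sums over the entire column, on both sides of the antidiagonal.
Removing the part above and the dot leaves the part below. -/
theorem column_below (h : IsNumericallyTrivial u) (a b : ℤ) :
    (u.sum fun t n => n * if t.1 = a + b ∧ t.2.1 = a ∧ t.2.2 < b then 1 else 0) = 0 := by
  refine sum_mul_eq_zero_of_sub (sum_mul_eq_zero_of_sub (h (.frolicher 1 le_rfl a b))
    (h.column_above a b) fun t => rfl) (h.dot a b) fun t => ?_
  rw [invariant_frolicher_odd]
  simp only [Prod.ext_iff]
  split_ifs <;> omega

/-- The first conjugate page sums over the entire row, and `row_above_dot` removes the upper part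
and the dot at once. -/
theorem row_below (h : IsNumericallyTrivial u) (a b : ℤ) :
    (u.sum fun t n => n * if t.1 = a + b ∧ t.2.2 = b ∧ t.2.1 < a then 1 else 0) = 0 := by
  refine sum_mul_eq_zero_of_sub (h (.conjFrolicher 1 le_rfl a b)) (h.row_above_dot a b) fun t => ?_
  rw [invariant_conjFrolicher_odd]
  split_ifs <;> omega

open Classical in
theorem isFilling_filter_above (h : IsNumericallyTrivial u) (k : ℤ) :
    IsFilling (regionPlus k) ((u.curry k).filter (· ∈ regionPlus k)) where
  support_subset p q hpq := by
    rw [Finsupp.filter_apply] at hpq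
    exact (ite_ne_right_iff.1 hpq).1
  row_sum q := by
    -- Row `q` meets the antidiagonal at `p = k - q`, and its points in the region are those further
    -- right.
    rw [← h.row_above (k - q) q]
    refine finsum_eq_sum_mul_indicator u (i := fun p => (k, p, q)) ?_ _ ?_ _ fun p => ?_
    · intro p p' hp
      simpa using hp
    · rintro ⟨k', p', q'⟩ ⟨h1, h2, -⟩
      dsimp only at h1 h2
      exact ⟨p', Prod.ext (by dsimp only; omega) (Prod.ext rfl
        (by dsimp only; omega))⟩
    · rw [Finsupp.filter_apply, Finsupp.curry_apply]
      refine if_congr ?_ rfl rfl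
      change k < p + q ↔ _
      dsimp only; omega
  column_sum p := by
    rw [← h.column_above p (k - p)]
    refine finsum_eq_sum_mul_indicator u (i := fun q => (k, p, q)) ?_ _ ?_ _ fun q => ?_
    · intro q q' hq
      simpa using hq
    · rintro ⟨k', p', q'⟩ ⟨h1, h2, -⟩
      dsimp only at h1 h2
      exact ⟨q', Prod.ext (by dsimp only; omega) (Prod.ext (by dsimp only; omega)
        rfl)⟩
    · rw [Finsupp.filter_apply, Finsupp.curry_apply]
      refine if_congr ?_ rfl rfl
      change k < p + q ↔ _
      dsimp only; omega

-- The complement of the upper region also contains the antidiagonal, but the coefficients of the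
-- dots vanish, so the restriction is supported in the lower region.
open Classical in
theorem filter_notMem_apply (h : IsNumericallyTrivial u) (k p q : ℤ) :
    (u.curry k).filter (· ∉ regionPlus k) (p, q) = if p + q < k then u (k, p, q) else 0 := by
  rw [Finsupp.filter_apply, Finsupp.curry_apply]
  by_cases hk : p + q = k
  · subst hk
    rw [h.apply_dot, ite_self, ite_self]
  · refine if_congr ?_ rfl rfl
    change ¬ (k < p + q) ↔ _
    omega

open Classical in
theorem isFilling_filter_below (h : IsNumericallyTrivial u) (k : ℤ) :
    IsFilling (regionMinus k) ((u.curry k).filter (· ∉ regionPlus k)) where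
  support_subset p q hpq := by
    rw [h.filter_notMem_apply] at hpq
    exact (ite_ne_right_iff.1 hpq).1
  row_sum q := by
    rw [← h.row_below (k - q) q]
    refine finsum_eq_sum_mul_indicator u (i := fun p => (k, p, q)) ?_ _ ?_ _ fun p => ?_
    · intro p p' hp
      simpa using hp
    · rintro ⟨k', p', q'⟩ ⟨h1, h2, -⟩
      dsimp only at h1 h2
      exact ⟨p', Prod.ext (by dsimp only; omega) (Prod.ext rfl
        (by dsimp only; omega))⟩
    · rw [h.filter_notMem_apply]
      refine if_congr ?_ rfl rfl
      dsimp only; omega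
  column_sum p := by
    rw [← h.column_below p (k - p)]
    refine finsum_eq_sum_mul_indicator u (i := fun q => (k, p, q)) ?_ _ ?_ _ fun q => ?_
    · intro q q' hq
      simpa using hq
    · rintro ⟨k', p', q'⟩ ⟨h1, h2, -⟩
      dsimp only at h1 h2
      exact ⟨q', Prod.ext (by dsimp only; omega) (Prod.ext (by dsimp only; omega)
        rfl)⟩
    · rw [h.filter_notMem_apply]
      refine if_congr ?_ rfl rfl
      dsimp only; omega

end IsNumericallyTrivial

/-! ### Decomposition of kernel elements by total degree -/

theorem sum_oddClass_eq (u : ℤ × ℤ × ℤ →₀ ℤ) :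
    u.sum (fun t n => n • oddClass t.1 t.2.1 t.2.2) = u.curry.sum fun k f => fillingSum k f :=
  (Finsupp.sum_curry_index u fun k x n => n • oddClass k x.1 x.2).symm

end DoubleComplex

theorem mainTheorem2 :
    AddSubgroup.closure
        ({z : DoubleComplex.ReducedGroup | ∃ (k : ℤ) (v : ℤ × ℤ →₀ ℤ),
            DoubleComplex.IsFilling (DoubleComplex.regionPlus k) v ∧
              z = DoubleComplex.fillingSum k v} ∪
          {z : DoubleComplex.ReducedGroup | ∃ (k : ℤ) (v : ℤ × ℤ →₀ ℤ),
            DoubleComplex.IsFilling (DoubleComplex.regionMinus k) v ∧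
              z = DoubleComplex.fillingSum k v}) =
      DoubleComplex.chi.ker := by
  classical
  open DoubleComplex in
  apply le_antisymm
  · rw [AddSubgroup.closure_le]
    rintro z (⟨k, v, hv, rfl⟩ | ⟨k, v, hv, rfl⟩)
    · exact chi_fillingSum_eq_zero hv (exists_split_invariant_of_lt k)
    · exact chi_fillingSum_eq_zero hv (exists_split_invariant_of_gt k)
  · intro x hx
    obtain ⟨u, v, w, rfl⟩ := exists_zigzag_combination x
    -- The kernel condition, expanded as one linear equation in the coefficients `u`, `v`, `w` for
    -- each invariant.
    have h : ∀ i, _ = (0 : ℤ) := fun i =>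
      (chi_combination_apply u v w i).symm.trans (congrFun hx i)
    obtain rfl := horizontal_coefficients_eq_zero fun r hr p q => h (.frolicher r hr p q)
    obtain rfl := vertical_coefficients_eq_zero fun r hr p q => h (.conjFrolicher r hr p q)
    simp only [Finsupp.sum_zero_index, add_zero] at h ⊢
    have hu : IsNumericallyTrivial u := h
    rw [sum_oddClass_eq]
    refine AddSubgroup.sum_mem _ fun k _ => ?_
    -- For fixed `k` the coefficients are split into those looking up and the rest. Numerical
    -- triviality makes each part a filling of its own region.
    rw [← Finsupp.filter_add_filter_not (u.curry k) (· ∈ regionPlus k)]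
    beta_reduce
    rw [fillingSum_add]
    refine add_mem (AddSubgroup.subset_closure (Or.inl ⟨k, _, hu.isFilling_filter_above k, rfl⟩))
      (AddSubgroup.subset_closure (Or.inr ⟨k, _, hu.isFilling_filter_below k, rfl⟩))
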